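/- For $m\ge 0$ let $\sqrt{-\Delta+m^2}$ be the self-adjoint operator on $L^2(\mathbb{R}^3)$ given by multiplication by $\sqrt{|p|^2+m^2}$ in Fourier space, with domain $H^1(\mathbb{R}^3)$ (for $m=0$: the set of $f\in L^2(\mathbb{R}^3)$ with $|p|\hat f\in L^2(\mathbb{R}^3)$, which is the same space). For a nonnegative integer $\ell$ let $K_\ell$ be its restriction to the $\ell$-th angular momentum sector, i.e. the operator on $L^2_r:=L^2([0,\infty),r^2dr)$ such that $u$ belongs to the domain $D(K_\ell)$ with $K_\ell u=w$ if and only if, for every spherical harmonic $Y$ of degree $\ell$, the function $x\mapsto Y(x/|x|)\,u(|x|)$ is in the domain of $\sqrt{-\Delta+m^2}$ and $$\sqrt{-\Delta+m^2}\;Y(x/|x|)\,u(|x|)=Y(x/|x|)\,w(|x|).$$ There exists a constant $C$ such that, for all $m\ge 0$ and all nonnegative integers $\ell,\ell'$, the operator $(K_\ell-K_{\ell'})\,r$, with its natural domain $\{u\in L^2_r : ru\in L^2_r,\ ru\in D(K_\ell)\cap D(K_{\ell'})\}$, is densely defined and extends to a bounded operator on $L^2_r$ with $$\left\|(K_\ell-K_{\ell'})\,r\right\|_{\mathcal{B}(L^2([0,\infty),r^2dr))}\le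 C\,(1+\ell+\ell')\,|\ell-\ell'|.$$ -/

import Mathlib

open MeasureTheory Set
open scoped FourierTransform ENNReal

noncomputable section

namespace RadialKinetic

/-- Three-dimensional Euclidean space `ℝ³`. -/
abbrev R3 : Type := EuclideanSpace ℝ (Fin 3)

/-- The Hilbert space `L²(ℝ³; ℂ)`. -/
abbrev L2R3 : Type := Lp ℂ 2 (volume : Measure R3)

/-- The measure `r² dr` on `[0, ∞)`, seen as a measure on `ℝ`. -/
def radialMeasure : Measure ℝ :=
  (volume.restrict (Ici (0 : ℝ))).withDensity fun r => ENNReal.ofReal (r ^ 2)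

/-- The Hilbert space `L²([0, ∞), r² dr)` of complex-valued functions. -/
abbrev L2Rad : Type := Lp ℂ 2 radialMeasure

/-! ### Unbounded operators -/

/-- The operator of multiplication by the real function `g`, on its maximal domain
`{f ∈ L² : g f ∈ L²}`. -/
def mulOp {X : Type*} [MeasurableSpace X] (μ : Measure X) (g : X → ℝ) :
    Lp ℂ 2 μ →ₗ.[ℂ] Lp ℂ 2 μ where
  domain :=
    { carrier := {f | MemLp (fun x => (g x : ℂ) * f x) 2 μ}
      add_mem' := by
        intro f₁ f₂ h₁ h₂
        refine (MemLp.add h₁ h₂).ae_eq ?_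
        filter_upwards [Lp.coeFn_add f₁ f₂] with x hx
        rw [Pi.add_apply, hx, Pi.add_apply, mul_add]
      zero_mem' := by
        refine (MemLp.zero (ε := ℂ)).ae_eq ?_
        filter_upwards [Lp.coeFn_zero ℂ 2 μ] with x hx
        rw [hx]; simp
      smul_mem' := by
        intro c f h
        refine (MemLp.const_smul h c).ae_eq ?_
        filter_upwards [Lp.coeFn_smul c f] with x hx
        simp only [Pi.smul_apply, hx, smul_eq_mul]
        ring }
  toFun :=
    { toFun := fun f => MemLp.toLp (fun x => (g x : ℂ) * f.1 x) f.2
      map_add' := by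
        intro f₁ f₂
        refine Lp.ext ?_
        refine (MemLp.coeFn_toLp _).trans ?_
        refine Filter.EventuallyEq.trans ?_ (Lp.coeFn_add _ _).symm
        filter_upwards [Lp.coeFn_add f₁.1 f₂.1, MemLp.coeFn_toLp f₁.2, MemLp.coeFn_toLp f₂.2]
          with x hx h₁ h₂
        simp only [Pi.add_apply, h₁, h₂, Submodule.coe_add, hx]
        ring
      map_smul' := by
        intro c f
        refine Lp.ext ?_
        refine (MemLp.coeFn_toLp _).trans ?_
        refine Filter.EventuallyEq.trans ?_ (Lp.coeFn_smul _ _).symm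
        filter_upwards [Lp.coeFn_smul c f.1, MemLp.coeFn_toLp f.2] with x hx h
        simp only [Pi.smul_apply, RingHom.id_apply, h, Submodule.coe_smul, hx, smul_eq_mul]
        ring }

/-- The composition `A B` of two unbounded operators, on its natural domain
`{x ∈ D(B) : B x ∈ D(A)}`. -/
def compOp {E F G : Type*} [AddCommGroup E] [Module ℂ E] [AddCommGroup F] [Module ℂ F]
    [AddCommGroup G] [Module ℂ G] (A : F →ₗ.[ℂ] G) (B : E →ₗ.[ℂ] F) : E →ₗ.[ℂ] G where
  domain := (A.domain.comap B.toFun).map B.domain.subtype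
  toFun :=
    { toFun := fun x => A ⟨B ⟨x.1, by
          obtain ⟨y, -, hy⟩ := x.2
          exact hy ▸ y.2⟩, by
          obtain ⟨y, hyA, hy⟩ := x.2
          have hy' : y = ⟨x.1, hy ▸ y.2⟩ := Subtype.ext hy
          rw [← hy']
          exact hyA⟩
      map_add' := by
        intro x y
        rw [← LinearPMap.map_add]
        congr 1
        refine Subtype.ext ?_
        change B _ = B _ + B _
        rw [← LinearPMap.map_add]
        rfl
      map_smul' := by
        intro c x
        rw [RingHom.id_apply, ← LinearPMap.map_smul]
        congr 1
        refine Subtype.ext ?_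
        change B _ = c • B _
        rw [← LinearPMap.map_smul]
        rfl }

/-- The unitary Fourier transform on `L²(ℝ³)`, which extends
`𝓕 f (ξ) = ∫ e^{-2πi x·ξ} f(x) dx`. -/
def fourierL2 : L2R3 ≃ₗᵢ[ℂ] L2R3 := Lp.fourierTransformₗᵢ R3 ℂ

/-- Multiplication by `√(m² + |2πξ|²)` on `L²(ℝ³)`. -/
def symbolOp (m : ℝ) : L2R3 →ₗ.[ℂ] L2R3 :=
  mulOp volume fun ξ : R3 => √(m ^ 2 + (2 * Real.pi * ‖ξ‖) ^ 2)

/-- The self-adjoint operator `√(m² - Δ)` on `L²(ℝ³)`: the Fourier multiplier with symbol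
`√(m² + |2πξ|²)`, on its maximal domain. -/
def sqrtOp (m : ℝ) : L2R3 →ₗ.[ℂ] L2R3 where
  domain := (symbolOp m).domain.comap fourierL2.toLinearEquiv.toLinearMap
  toFun :=
    { toFun := fun f => fourierL2.symm (symbolOp m ⟨fourierL2 f.1, f.2⟩)
      map_add' := by
        intro f g
        rw [← map_add, ← LinearPMap.map_add]
        congr 2
        exact Subtype.ext (map_add fourierL2 f.1 g.1)
      map_smul' := by
        intro c f
        rw [RingHom.id_apply, ← map_smul, ← LinearPMap.map_smul]
        congr 2
        exact Subtype.ext (map_smul fourierL2 c f.1) }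

/-! ### Spherical harmonics and functions of the form `Y(x/|x|) u(|x|)` -/

/-- The solid harmonics of degree `ℓ`: complex polynomials on `ℝ³` which are homogeneous of degree
`ℓ` and harmonic. Their restrictions to the unit sphere are the spherical harmonics of degree `ℓ`,
i.e. the linear combinations of `Y_ℓ^k`, `k = -ℓ, …, ℓ`. -/
def solidHarmonic (ℓ : ℕ) : Set (MvPolynomial (Fin 3) ℂ) :=
  {p | p.IsHomogeneous ℓ ∧ ∑ i, MvPolynomial.pderiv i (MvPolynomial.pderiv i p) = 0}

/-- The function `x ↦ p(x/|x|)` on `ℝ³` (with a junk value at `x = 0`). -/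
def angular (p : MvPolynomial (Fin 3) ℂ) (x : R3) : ℂ :=
  MvPolynomial.eval (fun i => ((x i / ‖x‖ : ℝ) : ℂ)) p

lemma map_norm_volume : (volume : Measure R3).map (fun x => ‖x‖) =
    ((volume : Measure R3).toSphere univ) • radialMeasure := by
  have h0 : (volume : Measure R3) =
      ((volume : Measure R3).comap (Subtype.val : ({0}ᶜ : Set R3) → R3)).map Subtype.val := by
    rw [map_comap_subtype_coe (measurableSet_singleton _).compl, Measure.restrict_eq_self_of_ae_mem (by simp [ae_iff])]
  have hc : (fun x : R3 => ‖x‖) ∘ (Subtype.val : ({0}ᶜ : Set R3) → R3) =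
      (Subtype.val : Ioi (0 : ℝ) → ℝ) ∘ Prod.snd ∘ homeomorphUnitSphereProd R3 := by
    ext x; simp
  have hmp := (volume : Measure R3).measurePreserving_homeomorphUnitSphereProd
  have hr : (Measure.volumeIoiPow 2).map (Subtype.val : Ioi (0 : ℝ) → ℝ) = radialMeasure := by
    ext s hs
    rw [Measure.map_apply measurable_subtype_coe hs, Measure.volumeIoiPow,
      withDensity_apply _ (measurable_subtype_coe hs), radialMeasure, withDensity_apply _ hs,
      setLIntegral_subtype measurableSet_Ioi _ fun a : ℝ => ENNReal.ofReal (a ^ 2),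
      Subtype.image_preimage_coe, Measure.restrict_restrict hs,
      Measure.restrict_congr_set (show (s ∩ Ici (0 : ℝ) : Set ℝ) =ᵐ[volume] (s ∩ Ioi 0 : Set ℝ) from
        (Filter.EventuallyEq.refl _ _).inter Ioi_ae_eq_Ici.symm), Set.inter_comm]
  conv_lhs => rw [h0]
  rw [Measure.map_map measurable_norm measurable_subtype_coe, hc, ← Function.comp_assoc,
    ← Measure.map_map (measurable_subtype_coe.comp measurable_snd)
      (homeomorphUnitSphereProd R3).measurable, hmp.map_eq,
    ← Measure.map_map measurable_subtype_coe measurable_snd, Measure.map_snd_prod,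
    Measure.map_smul]
  simp [hr]

lemma quasiMeasurePreserving_norm :
    Measure.QuasiMeasurePreserving (fun x : R3 => ‖x‖) volume radialMeasure :=
  ⟨measurable_norm, by
    rw [map_norm_volume]
    exact Measure.smul_absolutelyContinuous⟩

lemma measurable_angular (p : MvPolynomial (Fin 3) ℂ) : Measurable (angular p) := by
  have h : Measurable fun x : R3 => fun i : Fin 3 => ((x i / ‖x‖ : ℝ) : ℂ) := by fun_prop
  exact (MvPolynomial.continuous_eval p).measurable.comp h

lemma exists_bound_angular (p : MvPolynomial (Fin 3) ℂ) : ∃ M : ℝ, ∀ x, ‖angular p x‖ ≤ M := by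
  obtain ⟨M, hM⟩ := (isCompact_closedBall (0 : Fin 3 → ℂ) 1).exists_bound_of_continuousOn
    (MvPolynomial.continuous_eval p).continuousOn
  refine ⟨M, fun x => hM _ ?_⟩
  rw [mem_closedBall_zero_iff, pi_norm_le_iff_of_nonneg zero_le_one]
  intro i
  rw [Complex.norm_real, norm_div, norm_norm]
  exact div_le_one_of_le₀ (PiLp.norm_apply_le x i) (norm_nonneg _)

lemma memLp_sector (p : MvPolynomial (Fin 3) ℂ) (u : L2Rad) :
    MemLp (fun x : R3 => angular p x * u ‖x‖) 2 volume := by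
  obtain ⟨M, hM⟩ := exists_bound_angular p
  have h1 : MemLp u 2 ((volume : Measure R3).map fun x => ‖x‖) := by
    rw [map_norm_volume]
    exact (Lp.memLp u).smul_measure (measure_ne_top _ _)
  have h2 : MemLp (fun x : R3 => u ‖x‖) 2 volume := h1.comp_of_map measurable_norm.aemeasurable
  refine MemLp.of_le_mul (c := M) h2
    ((measurable_angular p).aestronglyMeasurable.mul h2.1) (.of_forall fun x => ?_)
  rw [norm_mul]
  gcongr
  exact hM x

/-- The map which sends `u ∈ L²([0, ∞), r² dr)` to the function `x ↦ p(x/|x|) u(|x|)` of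
`L²(ℝ³)`. -/
def sector (p : MvPolynomial (Fin 3) ℂ) : L2Rad →ₗ[ℂ] L2R3 where
  toFun u := MemLp.toLp (fun x : R3 => angular p x * u ‖x‖) (memLp_sector p u)
  map_add' := by
    intro u v
    refine Lp.ext ?_
    refine (MemLp.coeFn_toLp _).trans ?_
    refine Filter.EventuallyEq.trans ?_ (Lp.coeFn_add _ _).symm
    filter_upwards [quasiMeasurePreserving_norm.ae (Lp.coeFn_add u v),
      MemLp.coeFn_toLp (memLp_sector p u), MemLp.coeFn_toLp (memLp_sector p v)] with x hx h₁ h₂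
    simp only [Pi.add_apply, h₁, h₂, hx]
    ring
  map_smul' := by
    intro c u
    refine Lp.ext ?_
    refine (MemLp.coeFn_toLp _).trans ?_
    refine Filter.EventuallyEq.trans ?_ (Lp.coeFn_smul _ _).symm
    filter_upwards [quasiMeasurePreserving_norm.ae (Lp.coeFn_smul c u),
      MemLp.coeFn_toLp (memLp_sector p u)] with x hx h₁
    simp only [Pi.smul_apply, RingHom.id_apply, h₁, hx, smul_eq_mul]
    ring

/-! ### The operators `K_ℓ` -/

/-- The graph of `K_ℓ`: the pairs `(u, w)` of radial functions such that, for every spherical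
harmonic `Y` of degree `ℓ`, the function `Y(x/|x|) u(|x|)` is in the domain of `√(m² - Δ)` and
`√(m² - Δ) (Y(x/|x|) u(|x|)) = Y(x/|x|) w(|x|)`. -/
def kineticGraph (m : ℝ) (ℓ : ℕ) : Submodule ℂ (L2Rad × L2Rad) :=
  ⨅ p ∈ solidHarmonic ℓ, (sqrtOp m).graph.comap ((sector p).prodMap (sector p))

/-- The operator `K_ℓ` on `L²([0, ∞), r² dr)`, the restriction of `√(m² - Δ)` to the `ℓ`-th angular
momentum sector: the operator whose graph is `kineticGraph m ℓ` (see `kineticOp_graph`). -/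
def kineticOp (m : ℝ) (ℓ : ℕ) : L2Rad →ₗ.[ℂ] L2Rad :=
  (kineticGraph m ℓ).toLinearPMap

/-- The solid harmonic `(x₁ + i x₂)^ℓ`. -/
lemma pow_mem_solidHarmonic (ℓ : ℕ) :
    (MvPolynomial.X 0 + MvPolynomial.C Complex.I * MvPolynomial.X 1 : MvPolynomial (Fin 3) ℂ) ^ ℓ ∈
      solidHarmonic ℓ := by
  constructor
  · have h : (MvPolynomial.X 0 + MvPolynomial.C Complex.I * MvPolynomial.X 1 :
        MvPolynomial (Fin 3) ℂ).IsHomogeneous 1 :=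
      (MvPolynomial.isHomogeneous_X ℂ 0).add
        ((MvPolynomial.isHomogeneous_X ℂ 1).C_mul Complex.I)
    simpa using h.pow ℓ
  · have hI : (MvPolynomial.C Complex.I * MvPolynomial.C Complex.I : MvPolynomial (Fin 3) ℂ) =
        -1 := by
      rw [← MvPolynomial.C_mul, Complex.I_mul_I]; simp
    simp only [Fin.sum_univ_three, Derivation.leibniz_pow, map_add, Derivation.leibniz,
      MvPolynomial.pderiv_X, MvPolynomial.pderiv_C, map_nsmul, smul_eq_mul]
    simp
    linear_combination (ℓ : MvPolynomial (Fin 3) ℂ) * ((ℓ - 1 : ℕ) : MvPolynomial (Fin 3) ℂ) *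
      (MvPolynomial.X 0 + MvPolynomial.C Complex.I * MvPolynomial.X 1) ^ (ℓ - 1 - 1) * hI

lemma sector_injective (ℓ : ℕ) (w : L2Rad)
    (h : sector ((MvPolynomial.X 0 + MvPolynomial.C Complex.I * MvPolynomial.X 1) ^ ℓ) w = 0) :
    w = 0 := by
  have hne : ∀ᵐ x : R3, x 0 ≠ 0 := by
    have h1 : volume ((LinearMap.ker (EuclideanSpace.proj (0 : Fin 3) : R3 →L[ℝ] ℝ).toLinearMap :
        Submodule ℝ R3) : Set R3) = 0 := by
      refine Measure.addHaar_submodule _ _ fun htop => ?_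
      have : EuclideanSpace.single (0 : Fin 3) (1 : ℝ) ∈
          LinearMap.ker (EuclideanSpace.proj (0 : Fin 3) : R3 →L[ℝ] ℝ).toLinearMap := by
        rw [htop]; trivial
      simp at this
    rw [ae_iff]
    convert h1 using 2
    ext x
    simp
  have hw : ∀ᵐ x : R3, w ‖x‖ = 0 := by
    have h2 := MemLp.coeFn_toLp (memLp_sector
      ((MvPolynomial.X 0 + MvPolynomial.C Complex.I * MvPolynomial.X 1) ^ ℓ) w)
    have h3 : ⇑(sector ((MvPolynomial.X 0 + MvPolynomial.C Complex.I * MvPolynomial.X 1) ^ ℓ) w)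
        =ᵐ[volume] 0 := by
      rw [h]; exact Lp.coeFn_zero _ _ _
    filter_upwards [hne, h2, h3] with x hx h2x h3x
    have h4 := h2x.symm.trans h3x
    rw [Pi.zero_apply, mul_eq_zero] at h4
    refine h4.resolve_left fun h5 => hx ?_
    simp only [angular, map_pow, map_add, map_mul, MvPolynomial.eval_X, MvPolynomial.eval_C] at h5
    have h6 := congrArg Complex.re (eq_zero_of_pow_eq_zero h5)
    have hx0 : ‖x‖ ≠ 0 := fun h0 => hx (by simp [norm_eq_zero.1 h0])
    simpa [hx0] using h6
  have hS : MeasurableSet {r : ℝ | w r = 0} :=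
    (Lp.stronglyMeasurable w).measurable (measurableSet_singleton 0)
  rw [← ae_map_iff measurable_norm.aemeasurable hS, map_norm_volume,
    Measure.ae_ennreal_smul_measure_iff (by simp [Real.pi_pos])] at hw
  exact Lp.ext (Filter.EventuallyEq.trans hw (Lp.coeFn_zero ℂ 2 radialMeasure).symm)

lemma kineticGraph_functional (m : ℝ) (ℓ : ℕ) (x : L2Rad × L2Rad) (hx : x ∈ kineticGraph m ℓ)
    (hx0 : x.1 = 0) : x.2 = 0 := by
  simp only [kineticGraph, Submodule.mem_iInf, Submodule.mem_comap] at hx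
  have h := hx _ (pow_mem_solidHarmonic ℓ)
  refine sector_injective ℓ _ ((sqrtOp m).graph_fst_eq_zero_snd h ?_)
  simp [hx0]

lemma kineticOp_graph (m : ℝ) (ℓ : ℕ) : (kineticOp m ℓ).graph = kineticGraph m ℓ :=
  Submodule.toLinearPMap_graph_eq _ (kineticGraph_functional m ℓ)

/-- The operator `(K_ℓ - K_ℓ') r`, on its natural domain
`{u : r u ∈ L²([0, ∞), r² dr), r u ∈ D(K_ℓ) ∩ D(K_ℓ')}`. -/
def kineticDiffMul (m : ℝ) (ℓ ℓ' : ℕ) : L2Rad →ₗ.[ℂ] L2Rad :=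
  compOp (kineticOp m ℓ - kineticOp m ℓ') (mulOp radialMeasure fun r => r)

end RadialKinetic

end

namespace RadialKinetic

/-! The square root is a superposition of heat semigroups: `√λ` is, up to a positive constant, `∫ (1
- e^{-λ/x}) x^{-1/2} dx` over `x > 0`. With `λ = (m² + |2πξ|²)/(4π)` the exponential is a mass
factor `e^{-m²/(4πx)} ≤ 1` times the Gaussian multiplier `e^{-π|ξ|²/x}`. In the difference `K_ℓ -
K_ℓ'` the constant term cancels. What remains is the difference of the heat kernels of the two
sectors, and the mass factor can only decrease its size; this gives uniformity in `m`.

In the sector `ℓ` the heat kernel is `z^ℓ/ℓ! ∫ e^{-πx(r²+s²-2rsτ)} (1-τ²)^ℓ dτ` up to a common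
factor, with `z = πxrs`; this is the Legendre projection of the heat kernel of `ℝ³` after Rodrigues'
formula. One integration by parts (`heatKernel_sub_succ`) shows that consecutive kernels differ by
the same integral with weight `(1-τ)(1-τ²)^n`, which is nonnegative. Integrating in `x` gives a
Gamma integral, and `rs(1-τ²) ≤ r²+s²-2rsτ` removes all dependence on `n` but a factor `n+1`
(`lintegral_heatKernel_sub_succ_le`). The remaining kernel `logKernel r s`, multiplied by the `s`
coming from the operator `r`, is bounded by a Schur test with weight `1/r`
(`lintegral_logKernel_le`). Summing `n+1` between `ℓ` and `ℓ'` gives at most `(1+ℓ+ℓ')|ℓ-ℓ'|`.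

The kernel is identified with the Fourier multiplier by testing on `r^ℓ e^{-πar²}`: Bochner's
relation (`fourier_polyGauss`) computes the Fourier side, a direct Gaussian integral the kernel
side, and these functions are total in the radial space (`eq_top_of_radialGauss_mem`). Totality also
shows that the Fourier transform preserves each sector, so that smooth functions with compact
support in `(0, ∞)` lie in every domain; hence the dense domain. -/

/-! ### Bochner's relation for solid harmonics times Gaussians -/

/-- The Fourier transform on `L²` agrees with the Fourier integral on `L¹ ∩ L²`. -/
lemma coeFn_fourierL2_toLp {f : R3 → ℂ} (h1 : Integrable f) (h2 : MemLp f 2 volume) :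
    ⇑(fourierL2 (h2.toLp f)) =ᵐ[volume] 𝓕 f := by
  set G := fourierL2 (h2.toLp f) with hG
  have hcont : Continuous (𝓕 f) :=
    VectorFourier.fourierIntegral_continuous Real.continuous_fourierChar continuous_inner h1
  have hl1 : LocallyIntegrable (⇑G) volume := (Lp.memLp G).locallyIntegrable (by norm_num)
  have hl2 : LocallyIntegrable (𝓕 f) volume := hcont.locallyIntegrable
  have key : ∀ᵐ x, (⇑G - 𝓕 f) x = 0 := by
    -- Both functions define the same tempered distribution: each transform can be moved onto the
    -- test function, on one side by definition and on the other by Fubini.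
    refine ae_eq_zero_of_integral_contDiff_smul_eq_zero (hl1.sub hl2) fun g hg hgc => ?_
    have hg₁ : HasCompactSupport (Complex.ofRealCLM ∘ g) := hgc.comp_left rfl
    have hg₂ : ContDiff ℝ (⊤ : ℕ∞) (Complex.ofRealCLM ∘ g) := by fun_prop
    set φ := hg₁.toSchwartzMap hg₂ with hφ
    have e1 := DFunLike.congr_fun (Lp.fourier_toTemperedDistribution_eq (h2.toLp f)) φ
    rw [TemperedDistribution.fourier_apply, Lp.toTemperedDistribution_apply,
      Lp.toTemperedDistribution_apply] at e1
    have e2 : ∫ x, (𝓕 φ) x • (h2.toLp f) x = ∫ x, (𝓕 (φ : R3 → ℂ)) x • f x := by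
      refine integral_congr_ae ?_
      filter_upwards [h2.coeFn_toLp] with x hx
      rw [hx]; rfl
    have e3 : ∫ x, (𝓕 (φ : R3 → ℂ)) x • f x = ∫ x, φ x • (𝓕 f) x := by
      have := VectorFourier.integral_fourierIntegral_smul_eq_flip (L := innerₗ R3)
        (μ := (volume : Measure R3)) (ν := volume) Real.continuous_fourierChar continuous_inner
        φ.integrable h1
      rwa [flip_innerₗ] at this
    have e4 : ∫ x, φ x • G x = ∫ x, φ x • (𝓕 f) x := by
      rw [← e3, ← e2, e1]; rfl
    have i1 : Integrable (fun x => φ x • G x) := by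
      have := hl1.integrable_smul_left_of_hasCompactSupport φ.continuous hg₁
      exact this
    have i2 : Integrable (fun x => φ x • (𝓕 f) x) :=
      hl2.integrable_smul_left_of_hasCompactSupport φ.continuous hg₁
    have : ∀ x, g x • (⇑G - 𝓕 f) x = φ x • G x - φ x • (𝓕 f) x := by
      intro x
      simp [hφ, mul_sub]
    simp_rw [this]
    rw [integral_sub i1 i2, e4, sub_self]
  filter_upwards [key] with x hx
  exact sub_eq_zero.1 hx

/-- Evaluation of a polynomial at a real point. -/
noncomputable def polyFun (q : MvPolynomial (Fin 3) ℂ) (x : R3) : ℂ :=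
  MvPolynomial.eval (fun i => ((x i : ℝ) : ℂ)) q

lemma continuous_polyFun (q : MvPolynomial (Fin 3) ℂ) : Continuous (polyFun q) := by
  have h : Continuous fun x : R3 => fun i : Fin 3 => ((x i : ℝ) : ℂ) := by fun_prop
  exact (MvPolynomial.continuous_eval q).comp h

lemma contDiff_polyFun (q : MvPolynomial (Fin 3) ℂ) : ContDiff ℝ (⊤ : ℕ∞) (polyFun q) := by
  induction q using MvPolynomial.induction_on with
  | C c =>
    have : polyFun (MvPolynomial.C c) = fun _ => c := by ext x; simp [polyFun]
    rw [this]; exact contDiff_const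
  | add p q hp hq =>
    have : polyFun (p + q) = fun x => polyFun p x + polyFun q x := by
      ext x; simp [polyFun]
    rw [this]; exact hp.add hq
  | mul_X p i hp =>
    have : polyFun (p * MvPolynomial.X i) =
        fun x => polyFun p x * Complex.ofRealCLM ((EuclideanSpace.proj i : R3 →L[ℝ] ℝ) x) := by
      ext x; simp [polyFun]
    rw [this]
    exact hp.mul ((Complex.ofRealCLM.comp (EuclideanSpace.proj i : R3 →L[ℝ] ℝ)).contDiff)

/-- Each variable is absorbed by half of the Gaussian, so the induction must leave `b` free. -/
lemma exists_bound_polyFun_mul_exp (q : MvPolynomial (Fin 3) ℂ) {b : ℝ} (hb : 0 < b) :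
    ∃ C : ℝ, ∀ x, ‖polyFun q x‖ * Real.exp (-b * ‖x‖ ^ 2) ≤ C := by
  induction q using MvPolynomial.induction_on generalizing b with
  | C c =>
    refine ⟨‖c‖, fun x => ?_⟩
    have : Real.exp (-b * ‖x‖ ^ 2) ≤ 1 := Real.exp_le_one_iff.2 (by nlinarith [sq_nonneg ‖x‖])
    simpa [polyFun] using mul_le_mul_of_nonneg_left this (norm_nonneg c)
  | add p q hp hq =>
    obtain ⟨C, hC⟩ := hp hb
    obtain ⟨D, hD⟩ := hq hb
    refine ⟨C + D, fun x => ?_⟩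
    have : polyFun (p + q) x = polyFun p x + polyFun q x := by simp [polyFun]
    rw [this]
    calc _ ≤ (‖polyFun p x‖ + ‖polyFun q x‖) * Real.exp (-b * ‖x‖ ^ 2) := by
          gcongr; exact norm_add_le _ _
      _ ≤ _ := by rw [add_mul]; exact add_le_add (hC x) (hD x)
  | mul_X p i hp =>
    obtain ⟨C, hC⟩ := hp (half_pos hb)
    have hC0 : 0 ≤ C := le_trans (by positivity) (hC 0)
    refine ⟨C * (1 + 2 / b), fun x => ?_⟩
    have h1 : polyFun (p * MvPolynomial.X i) x = polyFun p x * (x i : ℝ) := by simp [polyFun]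
    have h2 : Real.exp (-b * ‖x‖ ^ 2) =
        Real.exp (-(b / 2) * ‖x‖ ^ 2) * Real.exp (-(b / 2) * ‖x‖ ^ 2) := by
      rw [← Real.exp_add]; ring_nf
    have h3 : ‖x‖ * Real.exp (-(b / 2) * ‖x‖ ^ 2) ≤ 1 + 2 / b := by
      have h5 := Real.add_one_le_exp (b / 2 * ‖x‖ ^ 2)
      have h6 : Real.exp (-(b / 2) * ‖x‖ ^ 2) = (Real.exp (b / 2 * ‖x‖ ^ 2))⁻¹ := by
        rw [← Real.exp_neg]; ring_nf
      rw [h6, ← div_eq_mul_inv, div_le_iff₀ (Real.exp_pos _)]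
      calc ‖x‖ ≤ 1 + ‖x‖ ^ 2 := by nlinarith [sq_nonneg (‖x‖ - 1 / 2)]
        _ ≤ (1 + 2 / b) * (b / 2 * ‖x‖ ^ 2 + 1) := by
          have : (1 + 2 / b) * (b / 2 * ‖x‖ ^ 2 + 1) =
            1 + ‖x‖ ^ 2 + (b / 2 * ‖x‖ ^ 2 + 2 / b) := by field_simp; ring
          rw [this]
          have : 0 ≤ b / 2 * ‖x‖ ^ 2 + 2 / b := by positivity
          linarith
        _ ≤ _ := by gcongr
    rw [h1, h2, norm_mul, Complex.norm_real]
    calc _ = (‖polyFun p x‖ * Real.exp (-(b / 2) * ‖x‖ ^ 2)) *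
          (‖x i‖ * Real.exp (-(b / 2) * ‖x‖ ^ 2)) := by ring
      _ ≤ C * (1 + 2 / b) := by
        refine mul_le_mul (hC x) (le_trans ?_ h3) (by positivity) hC0
        gcongr
        exact PiLp.norm_apply_le x i

/-- The function `p(x) e^{-π a |x|²}`. -/
noncomputable def polyGauss (q : MvPolynomial (Fin 3) ℂ) (a : ℝ) (x : R3) : ℂ :=
  polyFun q x * (Real.exp (-(Real.pi * a) * ‖x‖ ^ 2) : ℝ)

lemma continuous_polyGauss (q : MvPolynomial (Fin 3) ℂ) (a : ℝ) : Continuous (polyGauss q a) := by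
  unfold polyGauss
  exact (continuous_polyFun q).mul (by fun_prop)

lemma exists_norm_polyGauss_le (q : MvPolynomial (Fin 3) ℂ) {a : ℝ} (ha : 0 < a) :
    ∃ C : ℝ, ∀ x, ‖polyGauss q a x‖ ≤ C * Real.exp (-(Real.pi * a / 2) * ‖x‖ ^ 2) := by
  obtain ⟨C, hC⟩ := exists_bound_polyFun_mul_exp q (b := Real.pi * a / 2) (by positivity)
  refine ⟨C, fun x => ?_⟩
  have h2 : Real.exp (-(Real.pi * a) * ‖x‖ ^ 2) =
      Real.exp (-(Real.pi * a / 2) * ‖x‖ ^ 2) * Real.exp (-(Real.pi * a / 2) * ‖x‖ ^ 2) := by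
    rw [← Real.exp_add]; ring_nf
  rw [polyGauss, norm_mul, Complex.norm_real, Real.norm_of_nonneg (Real.exp_pos _).le, h2,
    ← mul_assoc]
  gcongr
  exact hC x

lemma integrable_exp_neg_sq_norm {b : ℝ} (hb : 0 < b) :
    Integrable fun x : R3 => Real.exp (-b * ‖x‖ ^ 2) := by
  have h := (GaussianFourier.integrable_cexp_neg_mul_sq_norm_add (V := R3) (b := (b : ℂ))
    (by simpa using hb) 0 0).norm
  refine h.congr (.of_forall fun x => ?_)
  simp only [zero_mul, add_zero]
  rw [Complex.norm_exp]
  congr 1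
  norm_cast

lemma integrable_polyGauss (q : MvPolynomial (Fin 3) ℂ) {a : ℝ} (ha : 0 < a) :
    Integrable (polyGauss q a) := by
  obtain ⟨C, hC⟩ := exists_norm_polyGauss_le q ha
  refine ((integrable_exp_neg_sq_norm (b := Real.pi * a / 2) (by positivity)).const_mul C).mono'
    (continuous_polyGauss q a).aestronglyMeasurable (.of_forall hC)

lemma memLp_two_polyGauss (q : MvPolynomial (Fin 3) ℂ) {a : ℝ} (ha : 0 < a) :
    MemLp (polyGauss q a) 2 volume := by
  obtain ⟨C, hC⟩ := exists_norm_polyGauss_le q ha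
  refine (memLp_two_iff_integrable_sq_norm (continuous_polyGauss q a).aestronglyMeasurable).2 ?_
  refine ((integrable_exp_neg_sq_norm (b := Real.pi * a) (by positivity)).const_mul (C ^ 2)).mono'
    ((continuous_polyGauss q a).norm.pow 2).aestronglyMeasurable (.of_forall fun x => ?_)
  rw [norm_pow, norm_norm]
  refine (pow_le_pow_left₀ (norm_nonneg _) (hC x) 2).trans_eq ?_
  rw [mul_pow, ← Real.exp_nat_mul]
  ring_nf

lemma hasDerivAt_polyFun_line (q : MvPolynomial (Fin 3) ℂ) (x : R3) (i : Fin 3) :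
    HasDerivAt (fun t : ℝ => polyFun q (x + t • EuclideanSpace.single i (1 : ℝ)))
      (polyFun (MvPolynomial.pderiv i q) x) 0 := by
  induction q using MvPolynomial.induction_on with
  | C c => simpa [polyFun] using hasDerivAt_const (0 : ℝ) c
  | add p q hp hq =>
    have := hp.add hq
    refine (this.congr_deriv ?_).congr_of_eventuallyEq (.of_forall fun t => ?_) <;> simp [polyFun]
  | mul_X p j hp =>
    have h1 : HasDerivAt (fun t : ℝ => (((x + t • EuclideanSpace.single i (1 : ℝ) : R3) j : ℝ) : ℂ))
        (((if j = i then 1 else 0 : ℝ) : ℝ) : ℂ) 0 := by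
      refine HasDerivAt.ofReal_comp ?_
      have := ((hasDerivAt_id (0 : ℝ)).mul_const (if j = i then (1 : ℝ) else 0)).const_add (x j)
      simpa [Pi.single_apply] using this
    have := hp.mul h1
    refine (this.congr_deriv ?_).congr_of_eventuallyEq (.of_forall fun t => ?_)
    · by_cases hij : j = i
      · subst hij; simp [polyFun, Derivation.leibniz]; ring
      · simp [polyFun, Derivation.leibniz, MvPolynomial.pderiv_X, hij]; ring
    · simp [polyFun]

/-- The exponential `e^{-2πi x·ξ}`. -/
noncomputable def planeWave (ξ x : R3) : ℂ := Complex.exp (((-2 * Real.pi * inner ℝ x ξ : ℝ) : ℂ) * Complex.I)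

lemma continuous_planeWave (ξ : R3) : Continuous (planeWave ξ) := by
  unfold planeWave; fun_prop

lemma norm_planeWave (ξ x : R3) : ‖planeWave ξ x‖ = 1 := by
  rw [planeWave, Complex.norm_exp_ofReal_mul_I]

lemma fourier_eq_integral_planeWave (f : R3 → ℂ) (ξ : R3) :
    𝓕 f ξ = ∫ x, planeWave ξ x * f x := by
  rw [Real.fourier_eq']; rfl

lemma integrable_planeWave_mul (q : MvPolynomial (Fin 3) ℂ) {a : ℝ} (ha : 0 < a) (ξ : R3) :
    Integrable fun x => planeWave ξ x * polyGauss q a x := by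
  refine (integrable_polyGauss q ha).bdd_mul (c := 1)
    (continuous_planeWave ξ).aestronglyMeasurable (.of_forall fun x => (norm_planeWave ξ x).le)

lemma hasDerivAt_planeWave_line (ξ x : R3) (i : Fin 3) :
    HasDerivAt (fun t : ℝ => planeWave ξ (x + t • EuclideanSpace.single i (1 : ℝ)))
      (-2 * Real.pi * ξ i * Complex.I * planeWave ξ x) 0 := by
  have h1 : HasDerivAt (fun t : ℝ => -2 * Real.pi * (inner ℝ x ξ + t * ξ i))
      (-2 * Real.pi * ξ i) 0 := by
    have := (((hasDerivAt_id (0 : ℝ)).mul_const (ξ i)).const_add (inner ℝ x ξ)).const_mul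
      (-2 * Real.pi)
    simpa using this
  have h2 := (h1.ofReal_comp.mul_const Complex.I).cexp
  refine (h2.congr_deriv ?_).congr_of_eventuallyEq (.of_forall fun t => ?_)
  · simp [planeWave]; ring
  · simp [planeWave, inner_add_left, inner_smul_left, EuclideanSpace.inner_single_left]

lemma hasDerivAt_gauss_line (a : ℝ) (x : R3) (i : Fin 3) :
    HasDerivAt (fun t : ℝ => ((Real.exp (-(Real.pi * a) *
        ‖x + t • EuclideanSpace.single i (1 : ℝ)‖ ^ 2) : ℝ) : ℂ))
      (-(2 * Real.pi * a) * x i * (Real.exp (-(Real.pi * a) * ‖x‖ ^ 2) : ℝ)) 0 := by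
  have h0 : ∀ t : ℝ, ‖x + t • (EuclideanSpace.single i (1 : ℝ) : R3)‖ ^ 2 =
      ‖x‖ ^ 2 + 2 * (t * x i) + t ^ 2 := by
    intro t
    rw [norm_add_sq_real, inner_smul_right, norm_smul]
    simp [EuclideanSpace.inner_single_right]
  have h1 : HasDerivAt (fun t : ℝ => -(Real.pi * a) * (‖x‖ ^ 2 + 2 * (t * x i) + t ^ 2))
      (-(2 * Real.pi * a) * x i) 0 := by
    have := ((((hasDerivAt_id (0 : ℝ)).mul_const (x i)).const_mul 2).const_add (‖x‖ ^ 2)).add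
      (hasDerivAt_pow 2 (0 : ℝ))
    refine (this.const_mul (-(Real.pi * a))).congr_deriv ?_
    simp; ring
  refine (h1.exp.ofReal_comp.congr_deriv ?_).congr_of_eventuallyEq (.of_forall fun t => ?_)
  · push_cast
    simp
    ring
  · simp only [h0]

/-- Integration by parts: the derivative of the whole integrand along the `i`-th axis has integral
zero. The plane wave contributes `-2πi ξ_i`, the Gaussian `-2πa x_i`, and the identity is solved for
the term with `x_i`. -/
lemma integral_planeWave_pderiv (q : MvPolynomial (Fin 3) ℂ) {a : ℝ} (ha : 0 < a) (ξ : R3)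
    (i : Fin 3) :
    ∫ x, planeWave ξ x * polyGauss (q * MvPolynomial.X i) a x =
      (-Complex.I * ξ i / a) * (∫ x, planeWave ξ x * polyGauss q a x) +
      (1 / (2 * Real.pi * a)) *
        ∫ x, planeWave ξ x * polyGauss (MvPolynomial.pderiv i q) a x := by
  have hI := fun r => integrable_planeWave_mul r ha ξ
  set F' : R3 → ℂ := fun x => -2 * Real.pi * ξ i * Complex.I * (planeWave ξ x * polyGauss q a x) +
    (planeWave ξ x * polyGauss (MvPolynomial.pderiv i q) a x) +
    (-(2 * Real.pi * a)) * (planeWave ξ x * polyGauss (q * MvPolynomial.X i) a x) with hF'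
  have hF'i : Integrable F' :=
    (((hI q).const_mul _).add (hI _)).add ((hI _).const_mul _)
  have h := integral_bilinear_hasLineDerivAt_right_eq_neg_left_of_integrable
    (μ := (volume : Measure R3)) (f := fun _ : R3 => (1 : ℂ)) (f' := fun _ => (0 : ℂ))
    (g := fun x => planeWave ξ x * polyGauss q a x) (g' := F')
    (v := EuclideanSpace.single i (1 : ℝ)) (B := ContinuousLinearMap.mul ℝ ℂ)
    (by simp) (by simpa using hF'i) (by simpa using hI q)
    (fun x _ => by simpa [HasLineDerivAt] using! hasDerivAt_const (0 : ℝ) (1 : ℂ))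
    (fun x _ => by
      have := (hasDerivAt_planeWave_line ξ x i).mul
        ((hasDerivAt_polyFun_line q x i).mul (hasDerivAt_gauss_line a x i))
      refine (this.congr_deriv ?_).congr_of_eventuallyEq (.of_forall fun t => ?_)
      · simp [hF', polyGauss, polyFun]
        ring
      · simp [polyGauss])
  simp only [ContinuousLinearMap.mul_apply', one_mul, zero_mul, integral_zero, neg_zero] at h
  simp only [hF'] at h
  rw [integral_add (f := fun x => _ + _) (((hI q).const_mul _).add (hI _)) ((hI _).const_mul _),
    integral_add ((hI q).const_mul _) (hI _), integral_const_mul, integral_const_mul] at h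
  have ha' : (a : ℂ) ≠ 0 := by exact_mod_cast ha.ne'
  have hpi : (Real.pi : ℂ) ≠ 0 := by exact_mod_cast Real.pi_ne_zero
  field_simp
  linear_combination -h

lemma pderiv_mem_solidHarmonic {ℓ : ℕ} {p : MvPolynomial (Fin 3) ℂ}
    (hp : p ∈ solidHarmonic (ℓ + 1)) (i : Fin 3) : MvPolynomial.pderiv i p ∈ solidHarmonic ℓ := by
  refine ⟨by simpa using hp.1.pderiv (i := i), ?_⟩
  have h := congrArg (fun r : MvPolynomial (Fin 3) ℂ => MvPolynomial.pderiv i r) hp.2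
  rw [map_sum, map_zero] at h
  rw [← h]
  refine Finset.sum_congr rfl fun j _ => ?_
  have hc : ∀ r : MvPolynomial (Fin 3) ℂ, MvPolynomial.pderiv j (MvPolynomial.pderiv i r) =
      MvPolynomial.pderiv i (MvPolynomial.pderiv j r) := fun r => by
    have hb : ⁅MvPolynomial.pderiv (R := ℂ) (σ := Fin 3) j,
        MvPolynomial.pderiv (R := ℂ) (σ := Fin 3) i⁆ = 0 := by
      refine MvPolynomial.derivation_ext fun k => ?_
      rw [Derivation.commutator_apply]
      simp [MvPolynomial.pderiv_X, Pi.single_apply, apply_ite]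
    have := DFunLike.congr_fun hb r
    rw [Derivation.commutator_apply] at this
    simpa [sub_eq_zero] using this
  rw [hc, hc]

/-- The Gaussian average of a solid harmonic is its value at the (complex) center. -/
lemma integral_planeWave_polyGauss {ℓ : ℕ} {p : MvPolynomial (Fin 3) ℂ} (hp : p ∈ solidHarmonic ℓ)
    {a : ℝ} (ha : 0 < a) (ξ : R3) :
    ∫ x, planeWave ξ x * polyGauss p a x =
      MvPolynomial.eval (fun i => -Complex.I * ξ i / a) p *
        ∫ x, planeWave ξ x * polyGauss 1 a x := by
  induction ℓ generalizing p with
  | zero =>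
    have h := MvPolynomial.totalDegree_eq_zero_iff_eq_C.1 (Nat.le_zero.1 hp.1.totalDegree_le)
    rw [h, MvPolynomial.eval_C, ← integral_const_mul]
    congr 1
    ext x
    simp [polyGauss, polyFun]; ring
  | succ n ih =>
    set N : MvPolynomial (Fin 3) ℂ → ℂ := fun q => ∫ x, planeWave ξ x * polyGauss q a x with hN
    have hadd : ∀ q r, N (q + r) = N q + N r := fun q r => by
      rw [hN]
      simp only
      rw [← integral_add (integrable_planeWave_mul q ha ξ) (integrable_planeWave_mul r ha ξ)]
      congr 1; ext x; simp [polyGauss, polyFun]; ring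
    have hsmul : ∀ (c : ℂ) q, N (MvPolynomial.C c * q) = c * N q := fun c q => by
      rw [hN]
      simp only
      rw [← integral_const_mul]
      congr 1; ext x; simp [polyGauss, polyFun]; ring
    have hzero : N 0 = 0 := by simpa using hsmul 0 0
    have hsum : ∀ f : Fin 3 → MvPolynomial (Fin 3) ℂ, N (∑ i, f i) = ∑ i, N (f i) := fun f => by
      simp only [Fin.sum_univ_three, hadd]
    -- Euler's identity writes `(n+1) p` as the sum of `x_i ∂_i p`. Integration by parts with `∂_i
    -- p`, harmonic of degree `n`, gives the induction hypothesis plus second derivatives, which add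
    -- up to the Laplacian of `p` and vanish.
    have hEuler := hp.1.sum_X_mul_pderiv
    have e1 : N (∑ i, MvPolynomial.X i * MvPolynomial.pderiv i p) = ((n + 1 : ℕ) : ℂ) * N p := by
      rw [hEuler, nsmul_eq_mul, ← hsmul]
      simp
    have e2 : ∀ i, N (MvPolynomial.X i * MvPolynomial.pderiv i p) =
        (-Complex.I * ξ i / a) * (MvPolynomial.eval (fun i => -Complex.I * ξ i / a)
          (MvPolynomial.pderiv i p) * N 1) +
        (1 / (2 * Real.pi * a)) * N (MvPolynomial.pderiv i (MvPolynomial.pderiv i p)) := fun i => by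
      rw [mul_comm (MvPolynomial.X i)]
      rw [← ih (pderiv_mem_solidHarmonic hp i)]
      exact integral_planeWave_pderiv _ ha ξ i
    rw [hsum, Finset.sum_congr rfl fun i _ => e2 i, Finset.sum_add_distrib, ← Finset.mul_sum,
      ← hsum, hp.2, hzero, mul_zero, add_zero] at e1
    have e3 := congrArg (MvPolynomial.eval (fun i => -Complex.I * ξ i / a)) hEuler
    simp only [map_sum, map_mul, MvPolynomial.eval_X, nsmul_eq_mul, map_natCast] at e3
    have hn : ((n + 1 : ℕ) : ℂ) ≠ 0 := by exact_mod_cast Nat.succ_ne_zero n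
    refine mul_left_cancel₀ hn ?_
    change ((n + 1 : ℕ) : ℂ) * N p = _ * (_ * N 1)
    rw [← e1, ← mul_assoc, ← e3, Finset.sum_mul]
    simp only [mul_assoc]

lemma polyFun_eval_smul {ℓ : ℕ} {p : MvPolynomial (Fin 3) ℂ} (hp : p.IsHomogeneous ℓ) (c : ℂ)
    (w : Fin 3 → ℂ) : MvPolynomial.eval (fun i => c * w i) p = c ^ ℓ * MvPolynomial.eval w p := by
  rw [MvPolynomial.eval_eq, MvPolynomial.eval_eq, Finset.mul_sum]
  refine Finset.sum_congr rfl fun d hd => ?_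
  have := hp (MvPolynomial.mem_support_iff.1 hd)
  rw [Finset.prod_congr rfl fun i _ => mul_pow c (w i) (d i), Finset.prod_mul_distrib,
    Finset.prod_pow_eq_pow_sum]
  have h2 : ∑ i ∈ d.support, d i = ℓ := by
    rw [← this]; simp [Finsupp.weight_apply, Finsupp.sum]
  rw [h2]
  ring

/-- Bochner's relation: the Fourier transform of a solid harmonic times a Gaussian. -/
lemma fourier_polyGauss {ℓ : ℕ} {p : MvPolynomial (Fin 3) ℂ} (hp : p ∈ solidHarmonic ℓ)
    {a : ℝ} (ha : 0 < a) (ξ : R3) :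
    𝓕 (polyGauss p a) ξ =
      ((-Complex.I) ^ ℓ * ((a ^ (-(ℓ + 3 / 2 : ℝ)) : ℝ) : ℂ)) * polyGauss p a⁻¹ ξ := by
  rw [fourier_eq_integral_planeWave, integral_planeWave_polyGauss hp ha]
  have h1 : ∫ x, planeWave ξ x * polyGauss 1 a x =
      (((a ^ (-(3 / 2 : ℝ)) : ℝ)) : ℂ) * (Real.exp (-(Real.pi * a⁻¹) * ‖ξ‖ ^ 2) : ℝ) := by
    have h2 := fourier_gaussian_innerProductSpace (V := R3) (b := ((Real.pi * a : ℝ) : ℂ))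
      (by rw [Complex.ofReal_re]; positivity) ξ
    rw [fourier_eq_integral_planeWave] at h2
    have h3 : ∀ x : R3, planeWave ξ x * polyGauss 1 a x =
        planeWave ξ x * Complex.exp (-((Real.pi * a : ℝ) : ℂ) * (‖x‖ : ℂ) ^ 2) := fun x => by
      simp [polyGauss, polyFun]
    simp_rw [h3]
    rw [h2]
    have hpi : (Real.pi : ℂ) ≠ 0 := by exact_mod_cast Real.pi_ne_zero
    have ha' : (a : ℂ) ≠ 0 := by exact_mod_cast ha.ne'
    congr 1
    · rw [show ((Real.pi : ℂ) / ((Real.pi * a : ℝ) : ℂ)) = ((a⁻¹ : ℝ) : ℂ) by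
        push_cast; field_simp]
      rw [show ((Module.finrank ℝ R3 : ℂ) / 2) = (((3 / 2 : ℝ)) : ℂ) by simp,
        ← Complex.ofReal_cpow (by positivity), Real.inv_rpow ha.le, Real.rpow_neg ha.le]
    · push_cast
      congr 1
      field_simp
  -- By homogeneity the factor `-i/a` of the complex center comes out as `(-i)^ℓ a^{-ℓ}`; the
  -- Gaussian itself contributes `a^{-3/2}`.
  have h4 : (fun i => -Complex.I * ((ξ i : ℝ) : ℂ) / (a : ℂ)) =
      fun i => (-Complex.I * ((a⁻¹ : ℝ) : ℂ)) * ((ξ i : ℝ) : ℂ) := by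
    ext i; push_cast; ring
  rw [h1, h4, polyFun_eval_smul hp.1, polyGauss, polyFun, mul_pow, neg_add, Real.rpow_add ha,
    Real.rpow_neg ha.le, Real.rpow_neg ha.le, Real.rpow_natCast]
  push_cast
  ring

/-! ### Polar coordinates and the norm of a sector -/

lemma map_val_volumeIoiPow :
    (Measure.volumeIoiPow 2).map (Subtype.val : Ioi (0 : ℝ) → ℝ) = radialMeasure := by
  ext s hs
  rw [Measure.map_apply measurable_subtype_coe hs, Measure.volumeIoiPow,
    withDensity_apply _ (measurable_subtype_coe hs), radialMeasure, withDensity_apply _ hs,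
    setLIntegral_subtype measurableSet_Ioi _ fun a : ℝ => ENNReal.ofReal (a ^ 2),
    Subtype.image_preimage_coe, Measure.restrict_restrict hs,
    Measure.restrict_congr_set (show (s ∩ Ici (0 : ℝ) : Set ℝ) =ᵐ[volume] (s ∩ Ioi 0 : Set ℝ) from
      (Filter.EventuallyEq.refl _ _).inter Ioi_ae_eq_Ici.symm), Set.inter_comm]

/-- The square of the `L²` norm of a polynomial on the unit sphere. -/
noncomputable def sphereWeight (p : MvPolynomial (Fin 3) ℂ) : ℝ≥0∞ :=
  ∫⁻ ω : Metric.sphere (0 : R3) 1, ‖polyFun p ω‖ₑ ^ 2 ∂(volume : Measure R3).toSphere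

/-- Off the origin, space is the product of the sphere and the half-line, and there the integrand is
a product of a function of each factor. -/
lemma lintegral_angular_of_measurable (p : MvPolynomial (Fin 3) ℂ) {g : ℝ → ℝ≥0∞}
    (hg : Measurable g) :
    ∫⁻ x : R3, ‖angular p x‖ₑ ^ 2 * g ‖x‖ = sphereWeight p * ∫⁻ r, g r ∂radialMeasure := by
  have hmp := (volume : Measure R3).measurePreserving_homeomorphUnitSphereProd
  have hF : Measurable fun x : R3 => ‖angular p x‖ₑ ^ 2 * g ‖x‖ :=
    ((measurable_angular p).enorm.pow_const 2).mul (hg.comp measurable_norm)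
  have h0 : (volume : Measure R3) =
      ((volume : Measure R3).comap (Subtype.val : ({0}ᶜ : Set R3) → R3)).map Subtype.val := by
    rw [map_comap_subtype_coe (measurableSet_singleton _).compl,
      Measure.restrict_eq_self_of_ae_mem (by simp [ae_iff])]
  have hG : Measurable fun z : Metric.sphere (0 : R3) 1 × Ioi (0 : ℝ) =>
      ‖polyFun p z.1‖ₑ ^ 2 * g z.2 :=
    (((continuous_polyFun p).measurable.comp
      (measurable_subtype_coe.comp measurable_fst)).enorm.pow_const 2).mul
      (hg.comp (measurable_subtype_coe.comp measurable_snd))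
  conv_lhs => rw [h0]
  rw [lintegral_map hF measurable_subtype_coe]
  have h1 : ∀ x : ({0}ᶜ : Set R3), ‖angular p x‖ₑ ^ 2 * g ‖(x : R3)‖ =
      (fun z : Metric.sphere (0 : R3) 1 × Ioi (0 : ℝ) => ‖polyFun p z.1‖ₑ ^ 2 * g z.2)
        (homeomorphUnitSphereProd R3 x) := by
    intro x
    simp only [homeomorphUnitSphereProd_apply_snd_coe, angular, polyFun,
      homeomorphUnitSphereProd_apply_fst_coe]
    congr 6
    ext i
    simp [div_eq_inv_mul]
  simp_rw [h1]
  rw [hmp.lintegral_comp hG, show Module.finrank ℝ R3 - 1 = 2 by simp,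
    lintegral_prod_mul (f := fun ω : Metric.sphere (0 : R3) 1 => ‖polyFun p ω‖ₑ ^ 2)
      (g := fun r : Ioi (0 : ℝ) => g r), sphereWeight, ← map_val_volumeIoiPow,
    lintegral_map hg measurable_subtype_coe]
  · exact (((continuous_polyFun p).measurable.comp
      measurable_subtype_coe).enorm.pow_const 2).aemeasurable
  · exact (hg.comp measurable_subtype_coe).aemeasurable

/-- Integration in polar coordinates of `|p(x/|x|)|² g(|x|)`. -/
lemma lintegral_angular (p : MvPolynomial (Fin 3) ℂ) {g : ℝ → ℝ≥0∞}
    (hg : AEMeasurable g radialMeasure) :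
    ∫⁻ x : R3, ‖angular p x‖ₑ ^ 2 * g ‖x‖ = sphereWeight p * ∫⁻ r, g r ∂radialMeasure := by
  rw [lintegral_congr_ae hg.ae_eq_mk, ← lintegral_angular_of_measurable p hg.measurable_mk]
  refine lintegral_congr_ae ?_
  filter_upwards [quasiMeasurePreserving_norm.ae hg.ae_eq_mk] with x hx
  rw [hx]

lemma sphereWeight_ne_top (p : MvPolynomial (Fin 3) ℂ) : sphereWeight p ≠ ∞ := by
  obtain ⟨M, hM⟩ := (isCompact_sphere (0 : R3) 1).exists_bound_of_continuousOn
    (continuous_polyFun p).continuousOn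
  refine ne_top_of_le_ne_top ?_ (lintegral_mono (g := fun _ => ENNReal.ofReal M ^ 2) fun ω => ?_)
  · rw [lintegral_const]
    exact ENNReal.mul_ne_top (by simp) (measure_ne_top _ _)
  · refine pow_le_pow_left' ?_ 2
    rw [← ofReal_norm]
    exact ENNReal.ofReal_le_ofReal (hM _ ω.2)

/-- The solid harmonic `(x₁ + i x₂)^ℓ`. -/
noncomputable def axialHarmonic (ℓ : ℕ) : MvPolynomial (Fin 3) ℂ :=
  (MvPolynomial.X 0 + MvPolynomial.C Complex.I * MvPolynomial.X 1) ^ ℓ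

lemma axialHarmonic_mem (ℓ : ℕ) : axialHarmonic ℓ ∈ solidHarmonic ℓ := pow_mem_solidHarmonic ℓ

lemma polyFun_eq_norm_pow_mul_angular {ℓ : ℕ} {p : MvPolynomial (Fin 3) ℂ}
    (hp : p.IsHomogeneous ℓ) (x : R3) : polyFun p x = ((‖x‖ ^ ℓ : ℝ) : ℂ) * angular p x := by
  rw [angular, Complex.ofReal_pow, ← polyFun_eval_smul hp, polyFun]
  congr 2
  ext i
  by_cases hx : x = 0
  · simp [hx]
  · have : (‖x‖ : ℂ) ≠ 0 := by exact_mod_cast norm_ne_zero_iff.2 hx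
    push_cast
    field_simp

/-- The polynomial is continuous and equals `1` at the first basis vector. A single harmonic of
positive weight in each degree suffices to transfer norms and inner products between a sector and
the radial space. -/
lemma sphereWeight_axialHarmonic_ne_zero (ℓ : ℕ) : sphereWeight (axialHarmonic ℓ) ≠ 0 := by
  intro h
  have h1 := lintegral_angular (axialHarmonic ℓ) (g := fun _ => 1) aemeasurable_const
  rw [h, zero_mul] at h1
  simp only [mul_one] at h1
  rw [lintegral_eq_zero_iff ((measurable_angular _).enorm.pow_const 2)] at h1
  have h2 : polyFun (axialHarmonic ℓ) =ᵐ[volume] fun _ => 0 := by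
    filter_upwards [h1] with x hx
    rw [polyFun_eq_norm_pow_mul_angular (axialHarmonic_mem ℓ).1]
    simp only [Pi.zero_apply, ne_eq, OfNat.ofNat_ne_zero, not_false_eq_true, pow_eq_zero_iff,
      enorm_eq_zero] at hx
    rw [hx, mul_zero]
  have h3 := congrFun ((Continuous.ae_eq_iff_eq volume (continuous_polyFun _)
    continuous_const).1 h2) (EuclideanSpace.single 0 1)
  simp [polyFun, axialHarmonic] at h3

lemma ofReal_norm_sq_eq_lintegral {X : Type*} [MeasurableSpace X] {μ : Measure X}
    (f : Lp ℂ 2 μ) : ENNReal.ofReal (‖f‖ ^ 2) = ∫⁻ x, ‖f x‖ₑ ^ 2 ∂μ := by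
  have h := eLpNorm_nnreal_pow_eq_lintegral (f := ⇑f) (μ := μ) (p := 2) (by norm_num)
  norm_num at h
  rw [← h, Lp.norm_def, ENNReal.ofReal_pow ENNReal.toReal_nonneg,
    ENNReal.ofReal_toReal (Lp.eLpNorm_ne_top f)]

lemma coeFn_sector (p : MvPolynomial (Fin 3) ℂ) (u : L2Rad) :
    ⇑(sector p u) =ᵐ[volume] fun x => angular p x * u ‖x‖ :=
  MemLp.coeFn_toLp (memLp_sector p u)

lemma norm_sector_sq (p : MvPolynomial (Fin 3) ℂ) (u : L2Rad) :
    ‖sector p u‖ ^ 2 = (sphereWeight p).toReal * ‖u‖ ^ 2 := by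
  have h1 : ENNReal.ofReal (‖sector p u‖ ^ 2) = sphereWeight p * ENNReal.ofReal (‖u‖ ^ 2) := by
    rw [ofReal_norm_sq_eq_lintegral, ofReal_norm_sq_eq_lintegral, ← lintegral_angular]
    · refine lintegral_congr_ae ?_
      filter_upwards [coeFn_sector p u] with x hx
      rw [hx, enorm_mul, mul_pow]
    · exact (Lp.stronglyMeasurable u).measurable.enorm.pow_const 2 |>.aemeasurable
  have h2 := congrArg ENNReal.toReal h1
  rwa [ENNReal.toReal_mul, ENNReal.toReal_ofReal (by positivity),
    ENNReal.toReal_ofReal (by positivity)] at h2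

lemma norm_sector (p : MvPolynomial (Fin 3) ℂ) (u : L2Rad) :
    ‖sector p u‖ = √(sphereWeight p).toReal * ‖u‖ := by
  rw [← Real.sqrt_sq (norm_nonneg (sector p u)), norm_sector_sq, Real.sqrt_mul (by positivity),
    Real.sqrt_sq (norm_nonneg u)]

lemma continuous_sector (p : MvPolynomial (Fin 3) ℂ) : Continuous (sector p) :=
  AddMonoidHomClass.continuous_of_bound (sector p) _ fun u => (norm_sector p u).le

lemma sphereWeight_axialHarmonic_pos (ℓ : ℕ) : 0 < (sphereWeight (axialHarmonic ℓ)).toReal :=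
  ENNReal.toReal_pos (sphereWeight_axialHarmonic_ne_zero ℓ) (sphereWeight_ne_top _)

/-- The map `u ↦ Y u`, for the spherical harmonic `Y` proportional to `axialHarmonic ℓ` which has
unit norm on the sphere. -/
noncomputable def sectorIsometry (ℓ : ℕ) : L2Rad →ₗᵢ[ℂ] L2R3 where
  toLinearMap := (((√(sphereWeight (axialHarmonic ℓ)).toReal)⁻¹ : ℝ) : ℂ) • sector (axialHarmonic ℓ)
  norm_map' u := by
    have h := Real.sqrt_pos.2 (sphereWeight_axialHarmonic_pos ℓ)
    rw [LinearMap.smul_apply, norm_smul, norm_sector, Complex.norm_real,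
      Real.norm_of_nonneg (by positivity), ← mul_assoc, inv_mul_cancel₀ h.ne', one_mul]

lemma inner_sector (ℓ : ℕ) (u v : L2Rad) :
    inner ℂ (sector (axialHarmonic ℓ) u) (sector (axialHarmonic ℓ) v) =
      ((sphereWeight (axialHarmonic ℓ)).toReal : ℂ) * inner ℂ u v := by
  have h := (sectorIsometry ℓ).inner_map_map u v
  have hp := Real.sqrt_pos.2 (sphereWeight_axialHarmonic_pos ℓ)
  have hs := Real.mul_self_sqrt (sphereWeight_axialHarmonic_pos ℓ).le
  set c := √(sphereWeight (axialHarmonic ℓ)).toReal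
  change inner ℂ ((((c⁻¹ : ℝ) : ℂ)) • sector (axialHarmonic ℓ) u)
    ((((c⁻¹ : ℝ) : ℂ)) • sector (axialHarmonic ℓ) v) = _ at h
  rw [inner_smul_left, inner_smul_right, Complex.conj_ofReal] at h
  have hc : (c : ℂ) ≠ 0 := by exact_mod_cast hp.ne'
  rw [← h, ← hs]
  push_cast
  field_simp

/-- Converse of `memLp_sector`: since the angular weight is not zero, finiteness of the product in
polar coordinates forces finiteness of the radial factor. -/
lemma memLp_radial_of_sector (ℓ : ℕ) {u : ℝ → ℂ} (hu : AEStronglyMeasurable u radialMeasure)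
    (h : MemLp (fun x : R3 => angular (axialHarmonic ℓ) x * u ‖x‖) 2 volume) :
    MemLp u 2 radialMeasure := by
  refine ⟨hu, ?_⟩
  have key : ∀ {X : Type} [MeasurableSpace X] (μ : Measure X) (f : X → ℂ),
      eLpNorm f 2 μ < ∞ ↔ ∫⁻ x, ‖f x‖ₑ ^ 2 ∂μ < ∞ := fun μ f => by
    have h := eLpNorm_nnreal_pow_eq_lintegral (f := f) (μ := μ) (p := 2) (by norm_num)
    norm_num at h
    rw [← h, ENNReal.pow_lt_top_iff]; simp
  have h2 := h.2
  rw [key] at h2 ⊢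
  simp only [enorm_mul, mul_pow] at h2
  rw [lintegral_angular _ (g := fun r => ‖u r‖ₑ ^ 2) (hu.enorm.pow_const 2)] at h2
  exact (ENNReal.mul_lt_top_iff.1 h2).elim And.right fun h => h.elim
    (fun h => absurd h (sphereWeight_axialHarmonic_ne_zero ℓ)) fun h => by simp [h]

/-! ### Totality of the radial Gaussians and invariance of the sectors under the Fourier transform
-/

/-- The function `r ↦ r^ℓ e^{-π a r²}`. -/
noncomputable def radialGaussFun (ℓ : ℕ) (a r : ℝ) : ℂ :=
  ((r ^ ℓ * Real.exp (-(Real.pi * a) * r ^ 2) : ℝ) : ℂ)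

lemma continuous_radialGaussFun (ℓ : ℕ) (a : ℝ) : Continuous (radialGaussFun ℓ a) := by
  unfold radialGaussFun; fun_prop

lemma angular_mul_radialGaussFun {ℓ : ℕ} {p : MvPolynomial (Fin 3) ℂ}
    (hp : p.IsHomogeneous ℓ) (a : ℝ) (x : R3) :
    angular p x * radialGaussFun ℓ a ‖x‖ = polyGauss p a x := by
  rw [polyGauss, polyFun_eq_norm_pow_mul_angular hp, radialGaussFun]
  push_cast
  ring

lemma memLp_radialGaussFun (ℓ : ℕ) {a : ℝ} (ha : 0 < a) :
    MemLp (radialGaussFun ℓ a) 2 radialMeasure := by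
  refine memLp_radial_of_sector ℓ (continuous_radialGaussFun ℓ a).aestronglyMeasurable ?_
  simp_rw [angular_mul_radialGaussFun (axialHarmonic_mem ℓ).1]
  exact memLp_two_polyGauss _ ha

/-- The function `r ↦ r^ℓ e^{-π a r²}` as an element of `L²([0, ∞), r² dr)`. -/
noncomputable def radialGauss (ℓ : ℕ) {a : ℝ} (ha : 0 < a) : L2Rad :=
  (memLp_radialGaussFun ℓ ha).toLp

lemma sector_radialGauss {ℓ : ℕ} {p : MvPolynomial (Fin 3) ℂ}
    (hp : p.IsHomogeneous ℓ) {a : ℝ} (ha : 0 < a) :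
    sector p (radialGauss ℓ ha) = (memLp_two_polyGauss p ha).toLp := by
  refine Lp.ext ?_
  refine (coeFn_sector p _).trans (Filter.EventuallyEq.trans ?_ (MemLp.coeFn_toLp _).symm)
  filter_upwards [quasiMeasurePreserving_norm.ae (memLp_radialGaussFun ℓ ha).coeFn_toLp] with x hx
  rw [radialGauss, hx, angular_mul_radialGaussFun hp]

/-- The Fourier transform of `Y(x/|x|) |x|^ℓ e^{-π a |x|²}`. -/
lemma fourierL2_sector_radialGauss {ℓ : ℕ} {p : MvPolynomial (Fin 3) ℂ}
    (hp : p ∈ solidHarmonic ℓ) {a : ℝ} (ha : 0 < a) :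
    fourierL2 (sector p (radialGauss ℓ ha)) =
      sector p ((((-Complex.I) ^ ℓ * ((a ^ (-(ℓ + 3 / 2 : ℝ)) : ℝ) : ℂ))) •
        radialGauss ℓ (inv_pos.2 ha)) := by
  rw [map_smul, sector_radialGauss hp.1, sector_radialGauss hp.1]
  refine Lp.ext ?_
  refine (coeFn_fourierL2_toLp (integrable_polyGauss p ha) _).trans ?_
  refine Filter.EventuallyEq.trans ?_ (Lp.coeFn_smul _ _).symm
  filter_upwards [(memLp_two_polyGauss p (inv_pos.2 ha)).coeFn_toLp] with x hx
  rw [fourier_polyGauss hp ha, Pi.smul_apply, hx, smul_eq_mul]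

lemma ae_radialMeasure_pos : ∀ᵐ r ∂radialMeasure, 0 < r := by
  rw [radialMeasure]
  refine (withDensity_absolutelyContinuous _ _).ae_le ?_
  rw [← Measure.restrict_congr_set Ioi_ae_eq_Ici]
  exact ae_restrict_mem measurableSet_Ioi

instance : IsLocallyFiniteMeasure radialMeasure := by
  rw [radialMeasure]
  exact IsLocallyFiniteMeasure.withDensity_ofReal (by fun_prop)

lemma integral_polynomial_mul_eq_zero {F : ℝ → ℂ} (hF : Integrable F radialMeasure)
    (h : ∀ n : ℕ, ∫ r, ((Real.exp (-Real.pi * r ^ 2) ^ n : ℝ) : ℂ) * F r ∂radialMeasure = 0)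
    (P : Polynomial ℝ) :
    ∫ r, ((P.eval (Real.exp (-Real.pi * r ^ 2)) : ℝ) : ℂ) * F r ∂radialMeasure = 0 := by
  have hi : ∀ n : ℕ, Integrable (fun r => ((Real.exp (-Real.pi * r ^ 2) ^ n : ℝ) : ℂ) * F r)
      radialMeasure := fun n => by
    refine hF.bdd_mul (c := 1) (by fun_prop) (.of_forall fun r => ?_)
    rw [Complex.norm_real, Real.norm_of_nonneg (by positivity)]
    refine pow_le_one₀ (Real.exp_pos _).le (Real.exp_le_one_iff.2 ?_)
    have := Real.pi_pos
    nlinarith [sq_nonneg r]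
  have e : ∀ r, ((P.eval (Real.exp (-Real.pi * r ^ 2)) : ℝ) : ℂ) * F r =
      ∑ i ∈ Finset.range (P.natDegree + 1),
        (P.coeff i : ℂ) * (((Real.exp (-Real.pi * r ^ 2) ^ i : ℝ) : ℂ) * F r) := fun r => by
    rw [Polynomial.eval_eq_sum_range, Complex.ofReal_sum, Finset.sum_mul]
    refine Finset.sum_congr rfl fun i _ => ?_
    push_cast; ring
  simp_rw [e]
  rw [integral_finsetSum _ fun i _ => (hi i).const_mul _]
  simp_rw [integral_const_mul, h, mul_zero, Finset.sum_const_zero]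

/-- The variable `y = e^{-πr²}` maps the half-line into `[0, 1]`, where polynomials are dense; this
is a test function read in that variable. The compact support makes it vanish near `y = 0`. At `y =
0` itself the default `log 0 = 0` produces `g 0`, whence the hypothesis on that value. -/
lemma continuousOn_comp_sqrt_neg_log {g : ℝ → ℝ} (hg : Continuous g) (hc : HasCompactSupport g)
    (h0 : g 0 = 0) : ContinuousOn (fun y => g √(-Real.log y / Real.pi)) (Icc 0 1) := by
  intro y hy
  rcases hy.1.eq_or_lt with rfl | hy0
  · obtain ⟨R, hR⟩ := hc.isCompact.isBounded.subset_closedBall 0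
    have hz : (fun y => g √(-Real.log y / Real.pi)) =ᶠ[nhdsWithin 0 (Icc 0 1)] fun _ => 0 := by
      have h1 : ∀ᶠ y in nhdsWithin (0 : ℝ) (Icc 0 1), y < Real.exp (-Real.pi * R ^ 2) :=
        nhdsWithin_le_nhds (gt_mem_nhds (Real.exp_pos _))
      filter_upwards [h1, self_mem_nhdsWithin] with z hz hz01
      rcases hz01.1.eq_or_lt with rfl | hz0
      · simpa using h0
      · by_contra hne
        have h2 := hR (subset_tsupport _ hne)
        rw [mem_closedBall_zero_iff, Real.norm_of_nonneg (Real.sqrt_nonneg _)] at h2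
        have h3 := (Real.log_lt_iff_lt_exp hz0).2 hz
        have h4 : R ^ 2 < -Real.log z / Real.pi := by
          rw [lt_div_iff₀ Real.pi_pos]; linarith
        have h5 : 0 ≤ R := (Real.sqrt_nonneg _).trans h2
        rw [Real.sqrt_le_left h5] at h2
        linarith
    have : g √(-Real.log 0 / Real.pi) = 0 := by simpa using h0
    exact continuousWithinAt_const.congr_of_eventuallyEq hz this
  · refine ContinuousAt.continuousWithinAt ?_
    refine hg.continuousAt.comp (Real.continuous_sqrt.continuousAt.comp ?_)
    exact ((Real.continuousAt_log hy0.ne').neg).div_const _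

/-- Weierstrass approximation in `y = e^{-πr²}`: polynomials in `y` integrate to zero against `F`,
and a uniform error `ε / (I + 1)` costs at most `ε`, where `I` is the integral of `‖F‖`. -/
lemma integral_contDiff_mul_eq_zero {F : ℝ → ℂ} (hF : Integrable F radialMeasure)
    (h : ∀ n : ℕ, ∫ r, ((Real.exp (-Real.pi * r ^ 2) ^ n : ℝ) : ℂ) * F r ∂radialMeasure = 0)
    {g : ℝ → ℝ} (hg : Continuous g) (hc : HasCompactSupport g) (h0 : g 0 = 0) :
    ∫ r, g r • F r ∂radialMeasure = 0 := by
  obtain ⟨B, hB⟩ := hc.exists_bound_of_continuous hg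
  have hgi : Integrable (fun r => (g r : ℂ) * F r) radialMeasure :=
    hF.bdd_mul (c := B) (by fun_prop) (.of_forall fun r => by simpa using hB r)
  rw [← norm_le_zero_iff]
  refine le_of_forall_pos_le_add fun ε hε => ?_
  rw [zero_add]
  set I := ∫ r, ‖F r‖ ∂radialMeasure
  have hI : 0 ≤ I := integral_nonneg fun _ => norm_nonneg _
  obtain ⟨P, hP⟩ := exists_polynomial_near_of_continuousOn 0 1 _
    (continuousOn_comp_sqrt_neg_log hg hc h0) (ε / (I + 1)) (by positivity)
  have hkey : ∀ᵐ r ∂radialMeasure,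
      ‖(g r : ℂ) * F r - ((P.eval (Real.exp (-Real.pi * r ^ 2)) : ℝ) : ℂ) * F r‖ ≤
        ε / (I + 1) * ‖F r‖ := by
    filter_upwards [ae_radialMeasure_pos] with r hr
    rw [← sub_mul, norm_mul]
    gcongr
    have h1 := hP (Real.exp (-Real.pi * r ^ 2)) ⟨(Real.exp_pos _).le, Real.exp_le_one_iff.2 (by
      have := Real.pi_pos
      nlinarith [sq_nonneg r])⟩
    have h2 : √(-Real.log (Real.exp (-Real.pi * r ^ 2)) / Real.pi) = r := by
      rw [Real.log_exp]
      have : -(-Real.pi * r ^ 2) / Real.pi = r ^ 2 := by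
        have := Real.pi_ne_zero
        field_simp
      rw [this, Real.sqrt_sq hr.le]
    simp only [h2] at h1
    rw [← Complex.ofReal_sub, Complex.norm_real, Real.norm_eq_abs, abs_sub_comm]
    exact h1.le
  have hPi : Integrable (fun r => ((P.eval (Real.exp (-Real.pi * r ^ 2)) : ℝ) : ℂ) * F r)
      radialMeasure := by
    have h1 : Integrable (fun r => ε / (I + 1) * ‖F r‖) radialMeasure := hF.norm.const_mul _
    have h2 : Integrable (fun r => (g r : ℂ) * F r -
        ((P.eval (Real.exp (-Real.pi * r ^ 2)) : ℝ) : ℂ) * F r) radialMeasure := by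
      refine h1.mono' (hgi.1.sub (AEStronglyMeasurable.mul ?_ hF.1)) hkey
      exact (Complex.continuous_ofReal.comp
        (P.continuous.comp (by fun_prop))).aestronglyMeasurable
    refine (hgi.sub h2).congr (.of_forall fun r => ?_)
    simp
  have e : ∫ r, g r • F r ∂radialMeasure = ∫ r, ((g r : ℂ) * F r -
      ((P.eval (Real.exp (-Real.pi * r ^ 2)) : ℝ) : ℂ) * F r) ∂radialMeasure := by
    rw [integral_sub hgi hPi, integral_polynomial_mul_eq_zero hF h, sub_zero]
    rfl
  rw [e]
  refine (norm_integral_le_of_norm_le (hF.norm.const_mul _) hkey).trans ?_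
  rw [integral_const_mul]
  calc ε / (I + 1) * I ≤ ε / (I + 1) * (I + 1) := by gcongr; linarith
    _ = ε := by field_simp

lemma ae_eq_zero_of_forall_contDiff {F : ℝ → ℂ} (hF : LocallyIntegrable F radialMeasure)
    (h : ∀ g : ℝ → ℝ, ContDiff ℝ (⊤ : ℕ∞) g → HasCompactSupport g → tsupport g ⊆ Ioi 0 →
      ∫ r, g r • F r ∂radialMeasure = 0) : F =ᵐ[radialMeasure] 0 := by
  have := isOpen_Ioi.ae_eq_zero_of_integral_contDiff_smul_eq_zero (hF.locallyIntegrableOn _) h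
  filter_upwards [this, ae_radialMeasure_pos] with r h1 h2 using h1 h2

/-- The Gaussian with parameter `n + 1` is `e^{-πnr²}` times the one with parameter `1`, so integer
parameters already give all the moments of `F` in the variable `e^{-πr²}`. The weight in `F` makes
it integrable and has no zero on `r > 0`. -/
lemma eq_zero_of_inner_radialGauss (ℓ : ℕ) (u : L2Rad)
    (h : ∀ (a : ℝ) (ha : 0 < a), inner ℂ (radialGauss ℓ ha) u = 0) : u = 0 := by
  set F : ℝ → ℂ := fun r => radialGaussFun ℓ 1 r * u r with hFd
  have hF : Integrable F radialMeasure :=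
    (memLp_radialGaussFun ℓ one_pos).integrable_mul (Lp.memLp u)
  have hz : F =ᵐ[radialMeasure] 0 := by
    refine ae_eq_zero_of_forall_contDiff hF.locallyIntegrable fun g hg hc hs => ?_
    refine integral_contDiff_mul_eq_zero hF (fun n => ?_) hg.continuous hc ?_
    · have ha : (0 : ℝ) < n + 1 := by positivity
      rw [← h _ ha, L2.inner_def]
      refine integral_congr_ae ?_
      filter_upwards [(memLp_radialGaussFun ℓ ha).coeFn_toLp] with r hr
      rw [radialGauss, hr, RCLike.inner_apply, hFd]
      simp only [radialGaussFun, Complex.conj_ofReal]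
      rw [mul_comm (u r), ← mul_assoc, ← Complex.ofReal_mul]
      congr 2
      rw [← Real.exp_nat_mul, mul_left_comm, ← Real.exp_add]
      ring_nf
    · by_contra h0
      exact lt_irrefl (0 : ℝ) (hs (subset_tsupport _ h0))
  refine Lp.ext ?_
  filter_upwards [hz, Lp.coeFn_zero ℂ 2 radialMeasure, ae_radialMeasure_pos] with r h1 h2 h3
  rw [h2]
  rw [hFd] at h1
  refine (mul_eq_zero.1 h1).resolve_left ?_
  rw [radialGaussFun, Complex.ofReal_eq_zero]
  positivity

/-- The radial Gaussians are total in `L²([0, ∞), r² dr)`. -/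
lemma eq_top_of_radialGauss_mem (ℓ : ℕ) (V : Submodule ℂ L2Rad) (hV : IsClosed (V : Set L2Rad))
    (h : ∀ (a : ℝ) (ha : 0 < a), radialGauss ℓ ha ∈ V) : V = ⊤ := by
  rw [← hV.submodule_topologicalClosure_eq, Submodule.topologicalClosure_eq_top_iff,
    Submodule.eq_bot_iff]
  intro u hu
  exact eq_zero_of_inner_radialGauss ℓ u fun a ha => (Submodule.mem_orthogonal _ _).1 hu _ (h a ha)

/-- A unitary operator which preserves the `ℓ`-th sector on Gaussians preserves the sector. -/
lemma exists_sector_of_radialGauss (ℓ : ℕ) (A : L2R3 ≃ₗᵢ[ℂ] L2R3)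
    (hA : ∀ (a : ℝ) (ha : 0 < a), ∃ w, ∀ p ∈ solidHarmonic ℓ,
      A (sector p (radialGauss ℓ ha)) = sector p w) (u : L2Rad) :
    ∃ w, ∀ p ∈ solidHarmonic ℓ, A (sector p u) = sector p w := by
  -- The pairs `(u, w)` with one `w` good for every harmonic form a closed subspace. Since `A`
  -- preserves norms, so does the passage from `u` to `w`; the first projection is then an isometry,
  -- its range is closed, and it contains the total family of Gaussians.
  let Γ : Submodule ℂ (L2Rad × L2Rad) :=
    ⨅ p ∈ solidHarmonic ℓ, LinearMap.eqLocus
      (A.toLinearEquiv.toLinearMap ∘ₗ sector p ∘ₗ LinearMap.fst ℂ L2Rad L2Rad)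
      (sector p ∘ₗ LinearMap.snd ℂ L2Rad L2Rad)
  have hmem : ∀ z, z ∈ Γ ↔ ∀ p ∈ solidHarmonic ℓ, A (sector p z.1) = sector p z.2 := by
    intro z; simp [Γ, Submodule.mem_iInf, LinearMap.mem_eqLocus]
  have hclosed : IsClosed (Γ : Set (L2Rad × L2Rad)) := by
    have : (Γ : Set (L2Rad × L2Rad)) =
        ⋂ p ∈ solidHarmonic ℓ, {z | A (sector p z.1) = sector p z.2} := by
      ext z; simp [hmem]
    rw [this]
    refine isClosed_biInter fun p _ => isClosed_eq ?_ ?_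
    · exact A.continuous.comp ((continuous_sector p).comp continuous_fst)
    · exact (continuous_sector p).comp continuous_snd
  have hnorm : ∀ z ∈ Γ, ‖z.2‖ = ‖z.1‖ := fun z hz => by
    have h := congrArg norm ((hmem z).1 hz _ (axialHarmonic_mem ℓ))
    rw [A.norm_map, norm_sector, norm_sector] at h
    exact (mul_left_cancel₀ (Real.sqrt_pos.2 (sphereWeight_axialHarmonic_pos ℓ)).ne' h).symm
  let π : Γ →ₗᵢ[ℂ] L2Rad :=
    { toLinearMap := LinearMap.fst ℂ L2Rad L2Rad ∘ₗ Γ.subtype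
      norm_map' := fun z => by
        change ‖(z : L2Rad × L2Rad).1‖ = max _ _
        exact (max_eq_left (hnorm _ z.2).le).symm }
  have hcs : CompleteSpace Γ := hclosed.completeSpace_coe
  have hr : IsClosed ((LinearMap.range π.toLinearMap : Submodule ℂ L2Rad) : Set L2Rad) := by
    have := π.isometry.isClosedEmbedding.isClosed_range
    exact this
  have htop := eq_top_of_radialGauss_mem ℓ _ hr fun a ha => by
    obtain ⟨w, hw⟩ := hA a ha
    exact ⟨⟨(radialGauss ℓ ha, w), (hmem _).2 hw⟩, rfl⟩
  have hu : u ∈ LinearMap.range π.toLinearMap := by rw [htop]; trivial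
  obtain ⟨z, rfl⟩ := hu
  exact ⟨z.1.2, (hmem _).1 z.2⟩

lemma exists_fourierL2_sector (ℓ : ℕ) (u : L2Rad) :
    ∃ w, ∀ p ∈ solidHarmonic ℓ, fourierL2 (sector p u) = sector p w :=
  exists_sector_of_radialGauss ℓ fourierL2
    (fun _ ha => ⟨_, fun _ hp => fourierL2_sector_radialGauss hp ha⟩) u

lemma exists_fourierL2_symm_sector (ℓ : ℕ) (u : L2Rad) :
    ∃ w, ∀ p ∈ solidHarmonic ℓ, fourierL2.symm (sector p u) = sector p w := by
  refine exists_sector_of_radialGauss ℓ fourierL2.symm (fun a ha => ?_) u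
  -- Bochner's relation read backwards: the Gaussian with parameter `a` is a multiple of the
  -- transform of the one with parameter `a⁻¹`.
  refine ⟨((-Complex.I) ^ ℓ * ((a⁻¹ ^ (-(ℓ + 3 / 2 : ℝ)) : ℝ) : ℂ))⁻¹ •
    radialGauss ℓ (inv_pos.2 ha), fun p hp => ?_⟩
  have hc : ((-Complex.I) ^ ℓ * ((a⁻¹ ^ (-(ℓ + 3 / 2 : ℝ)) : ℝ) : ℂ)) ≠ 0 := by
    refine mul_ne_zero (pow_ne_zero _ (neg_ne_zero.2 Complex.I_ne_zero)) ?_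
    exact_mod_cast (Real.rpow_pos_of_pos (inv_pos.2 ha) _).ne'
  rw [LinearIsometryEquiv.symm_apply_eq, map_smul, map_smul,
    fourierL2_sector_radialGauss hp (inv_pos.2 ha), map_smul, smul_smul, inv_mul_cancel₀ hc,
    one_smul]
  simp only [inv_inv]

/-! ### Test functions in the domain and density -/

lemma contDiff_angular_mul {g : ℝ → ℝ} (hg : ContDiff ℝ (⊤ : ℕ∞) g)
    (hs : tsupport g ⊆ Ioi 0) (p : MvPolynomial (Fin 3) ℂ) :
    ContDiff ℝ (⊤ : ℕ∞) fun x : R3 => angular p x * (g ‖x‖ : ℂ) := by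
  refine contDiff_iff_contDiffAt.2 fun x => ?_
  by_cases hx : x = 0
  · have h0 : (0 : ℝ) ∉ tsupport g := fun h => lt_irrefl (0 : ℝ) (hs h)
    have h1 : ∀ᶠ r in nhds (0 : ℝ), g r = 0 := by
      filter_upwards [(isClosed_tsupport g).isOpen_compl.mem_nhds h0] with r hr
      exact image_eq_zero_of_notMem_tsupport hr
    have h2 : ∀ᶠ y in nhds x, g ‖y‖ = 0 := by
      have : Filter.Tendsto (fun y : R3 => ‖y‖) (nhds x) (nhds 0) := by
        have := continuous_norm.tendsto x
        rwa [hx, norm_zero, ← hx] at this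
      exact this.eventually h1
    refine (contDiffAt_const (c := (0 : ℂ))).congr_of_eventuallyEq ?_
    filter_upwards [h2] with y hy
    simp [hy]
  · have h1 : ContDiffAt ℝ (⊤ : ℕ∞) (fun y : R3 => ‖y‖) x := contDiffAt_norm ℝ hx
    have h2 : ContDiffAt ℝ (⊤ : ℕ∞) (fun y : R3 => ‖y‖⁻¹ • y) x :=
      (h1.inv (norm_ne_zero_iff.2 hx)).smul contDiffAt_id
    have h3 : angular p = fun y => polyFun p (‖y‖⁻¹ • y) := by
      ext y
      simp [angular, polyFun, div_eq_inv_mul]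
    rw [h3]
    refine ((contDiff_polyFun p).contDiffAt.comp x h2).mul ?_
    exact Complex.ofRealCLM.contDiff.contDiffAt.comp x (hg.contDiffAt.comp x h1)

lemma hasCompactSupport_angular_mul {g : ℝ → ℝ} (hc : HasCompactSupport g)
    (p : MvPolynomial (Fin 3) ℂ) :
    HasCompactSupport fun x : R3 => angular p x * (g ‖x‖ : ℂ) := by
  obtain ⟨R, hR⟩ := hc.isCompact.isBounded.subset_closedBall 0
  refine HasCompactSupport.of_support_subset_isCompact (isCompact_closedBall (0 : R3) R) ?_
  intro x hx
  have h1 : g ‖x‖ ≠ 0 := fun h => hx (by simp [h])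
  have := hR (subset_tsupport _ h1)
  simpa using this

/-- The symbol `√(m² + (2π r)²)`. -/
noncomputable def dispersion (m r : ℝ) : ℝ := √(m ^ 2 + (2 * Real.pi * r) ^ 2)

lemma continuous_dispersion (m : ℝ) : Continuous (dispersion m) := by
  unfold dispersion; fun_prop

lemma memLp_dispersion_mul_schwartz (m : ℝ) (ψ : SchwartzMap R3 ℂ) :
    MemLp (fun ξ : R3 => (dispersion m ‖ξ‖ : ℂ) * ψ ξ) 2 volume := by
  -- The symbol is not smooth when `m = 0`; it is dominated by a polynomial through `√t ≤ 1 + t`.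
  have hg : Function.HasTemperateGrowth fun ξ : R3 => ((m ^ 2 + 1 + (2 * Real.pi) ^ 2 * ‖ξ‖ ^ 2 : ℝ) : ℂ) := by
    fun_prop
  have h1 := (SchwartzMap.smulLeftCLM ℂ
    (fun ξ : R3 => ((m ^ 2 + 1 + (2 * Real.pi) ^ 2 * ‖ξ‖ ^ 2 : ℝ) : ℂ)) ψ).memLp 2 volume
  refine h1.of_le ?_ (.of_forall fun ξ => ?_)
  · exact ((Complex.continuous_ofReal.comp ((continuous_dispersion m).comp continuous_norm)).mul
      ψ.continuous).aestronglyMeasurable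
  · rw [SchwartzMap.smulLeftCLM_apply_apply hg, norm_mul, norm_smul, Complex.norm_real,
      Complex.norm_real]
    gcongr
    rw [dispersion, Real.norm_of_nonneg (Real.sqrt_nonneg _), Real.norm_of_nonneg (by positivity)]
    refine Real.sqrt_le_iff.2 ⟨by positivity, ?_⟩
    nlinarith [sq_nonneg m, sq_nonneg (2 * Real.pi * ‖ξ‖)]

lemma mem_graph_sqrtOp {m : ℝ} {f h : L2R3} : (f, h) ∈ (sqrtOp m).graph ↔
    ⇑(fourierL2 h) =ᵐ[volume] fun ξ => (dispersion m ‖ξ‖ : ℂ) * (fourierL2 f) ξ := by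
  rw [LinearPMap.mem_graph_iff]
  constructor
  · rintro ⟨y, hy, hy2⟩
    simp only at hy hy2
    rw [← hy2, ← hy]
    change ⇑(fourierL2 (fourierL2.symm (symbolOp m ⟨fourierL2 y.1, y.2⟩))) =ᵐ[volume] _
    rw [LinearIsometryEquiv.apply_symm_apply]
    exact MemLp.coeFn_toLp y.2
  · intro hae
    have hm : MemLp (fun ξ => (dispersion m ‖ξ‖ : ℂ) * (fourierL2 f) ξ) 2 volume :=
      (Lp.memLp (fourierL2 h)).ae_eq hae
    refine ⟨⟨f, hm⟩, rfl, ?_⟩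
    change fourierL2.symm (symbolOp m ⟨fourierL2 f, hm⟩) = h
    rw [LinearIsometryEquiv.symm_apply_eq]
    exact Lp.ext ((MemLp.coeFn_toLp hm).trans hae.symm)

lemma mem_kineticGraph {m : ℝ} {ℓ : ℕ} {z : L2Rad × L2Rad} : z ∈ kineticGraph m ℓ ↔
    ∀ p ∈ solidHarmonic ℓ, (sector p z.1, sector p z.2) ∈ (sqrtOp m).graph := by
  simp [kineticGraph, Submodule.mem_iInf]

/-- The function `Y u` is smooth with compact support, so its transform is Schwartz and stays in
`L²` after multiplication by the symbol. That transform is again in the sector, and so is the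
inverse transform of the product; this yields one `w` valid for all harmonics of degree `ℓ`. -/
lemma exists_mem_kineticGraph (m : ℝ) (ℓ : ℕ) {g : ℝ → ℝ} (hg : ContDiff ℝ (⊤ : ℕ∞) g)
    (hc : HasCompactSupport g) (hs : tsupport g ⊆ Ioi 0) {u : L2Rad}
    (hu : ⇑u =ᵐ[radialMeasure] fun r => (g r : ℂ)) : ∃ w, (u, w) ∈ kineticGraph m ℓ := by
  obtain ⟨û, hû⟩ := exists_fourierL2_sector ℓ u
  set ψ : SchwartzMap R3 ℂ := (hasCompactSupport_angular_mul hc (axialHarmonic ℓ)).toSchwartzMap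
    (contDiff_angular_mul hg hs _)
  have h1 : sector (axialHarmonic ℓ) u = ψ.toLp 2 volume := by
    refine Lp.ext ((coeFn_sector _ _).trans
      (Filter.EventuallyEq.trans ?_ (ψ.coeFn_toLp 2 volume).symm))
    filter_upwards [quasiMeasurePreserving_norm.ae hu] with x hx
    rw [hx]; rfl
  have h2 : sector (axialHarmonic ℓ) û = (𝓕 ψ).toLp 2 volume := by
    rw [← hû _ (axialHarmonic_mem ℓ), h1]
    exact SchwartzMap.toLp_fourier_eq ψ
  have h3 : MemLp (fun r => (dispersion m r : ℂ) * û r) 2 radialMeasure := by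
    refine memLp_radial_of_sector ℓ (AEStronglyMeasurable.mul
      (Complex.continuous_ofReal.comp (continuous_dispersion m)).aestronglyMeasurable
      (Lp.aestronglyMeasurable û)) ?_
    refine (memLp_dispersion_mul_schwartz m (𝓕 ψ)).ae_eq ?_
    have h4 := coeFn_sector (axialHarmonic ℓ) û
    rw [h2] at h4
    filter_upwards [h4, (𝓕 ψ).coeFn_toLp 2 volume] with x hx hx2
    rw [← hx2, hx]; ring
  obtain ⟨w, hw⟩ := exists_fourierL2_symm_sector ℓ h3.toLp
  refine ⟨w, mem_kineticGraph.2 fun p hp => mem_graph_sqrtOp.2 ?_⟩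
  simp only
  rw [← hw p hp, LinearIsometryEquiv.apply_symm_apply, hû p hp]
  refine (coeFn_sector _ _).trans ?_
  filter_upwards [coeFn_sector p û, quasiMeasurePreserving_norm.ae h3.coeFn_toLp] with x hx hx2
  rw [hx, hx2]; ring

lemma mem_domain_kineticOp {m : ℝ} {ℓ : ℕ} {u : L2Rad} :
    u ∈ (kineticOp m ℓ).domain ↔ ∃ w, (u, w) ∈ kineticGraph m ℓ := by
  rw [LinearPMap.mem_domain_iff, kineticOp_graph]

/-- `(K_ℓ - K_ℓ') r` is densely defined. -/
lemma dense_domain_kineticDiffMul (m : ℝ) (ℓ ℓ' : ℕ) :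
    Dense ((kineticDiffMul m ℓ ℓ').domain : Set L2Rad) := by
  rw [Submodule.dense_iff_topologicalClosure_eq_top, Submodule.topologicalClosure_eq_top_iff,
    Submodule.eq_bot_iff]
  intro v hv
  refine (Lp.eq_zero_iff_ae_eq_zero).2 (ae_eq_zero_of_forall_contDiff
    ((Lp.memLp v).locallyIntegrable (by norm_num)) fun g hg hc hs => ?_)
  have hgm : MemLp (fun r => (g r : ℂ)) 2 radialMeasure :=
    Continuous.memLp_of_hasCompactSupport (by fun_prop) (hc.comp_left (g := Complex.ofReal) rfl)
  -- Multiplication by `r` preserves the test functions on `(0, ∞)`, so each of them lies in the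
  -- natural domain, and a vector orthogonal to all of them vanishes.
  have hc' : HasCompactSupport fun r => r * g r := hc.mul_left
  have hs' : tsupport (fun r => r * g r) ⊆ Ioi 0 := (tsupport_mul_subset_right).trans hs
  have hrm : MemLp (fun r => ((r * g r : ℝ) : ℂ)) 2 radialMeasure :=
    Continuous.memLp_of_hasCompactSupport (by fun_prop) (hc'.comp_left (g := Complex.ofReal) rfl)
  have hBm : MemLp (fun r => ((r : ℝ) : ℂ) * hgm.toLp _ r) 2 radialMeasure := by
    refine hrm.ae_eq ?_
    filter_upwards [hgm.coeFn_toLp] with r hr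
    rw [hr]; push_cast; rfl
  have hae : ⇑(mulOp radialMeasure (fun r => r) ⟨hgm.toLp, hBm⟩) =ᵐ[radialMeasure]
      fun r => ((r * g r : ℝ) : ℂ) := by
    refine (MemLp.coeFn_toLp hBm).trans ?_
    filter_upwards [hgm.coeFn_toLp] with r hr
    rw [hr]; push_cast; rfl
  have hdom : ∀ n, mulOp radialMeasure (fun r => r) ⟨hgm.toLp, hBm⟩ ∈ (kineticOp m n).domain :=
    fun n => mem_domain_kineticOp.2
      (exists_mem_kineticGraph m n (contDiff_id.mul hg) hc' hs' hae)
  have hmem : hgm.toLp ∈ (kineticDiffMul m ℓ ℓ').domain :=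
    ⟨⟨hgm.toLp, hBm⟩, ⟨hdom ℓ, hdom ℓ'⟩, rfl⟩
  have h := (Submodule.mem_orthogonal _ _).1 hv _ hmem
  rw [L2.inner_def] at h
  rw [← h]
  refine integral_congr_ae ?_
  filter_upwards [hgm.coeFn_toLp] with r hr
  rw [hr, RCLike.inner_apply, Complex.conj_ofReal, mul_comm]
  rfl

/-! ### Explicit Gaussian integrals -/

lemma lintegral_radialMeasure (g : ℝ → ℝ≥0∞) :
    ∫⁻ r, g r ∂radialMeasure = ∫⁻ r in Ioi 0, ENNReal.ofReal (r ^ 2) * g r := by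
  rw [radialMeasure, lintegral_withDensity_eq_lintegral_mul_non_measurable _ (by fun_prop)
    (.of_forall fun r => ENNReal.ofReal_lt_top), ← Measure.restrict_congr_set Ioi_ae_eq_Ici]
  rfl

/-- The Gamma integral at an integer, as a lower Lebesgue integral. -/
lemma lintegral_pow_mul_exp_neg (n : ℕ) {b : ℝ} (hb : 0 < b) :
    ∫⁻ v in Ioi 0, ENNReal.ofReal (v ^ n * Real.exp (-b * v)) =
      ENNReal.ofReal (n.factorial / b ^ (n + 1)) := by
  have h := Real.integral_rpow_mul_exp_neg_mul_Ioi (a := (n : ℝ) + 1) (r := b) (by positivity) hb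
  rw [Real.Gamma_nat_eq_factorial] at h
  have h1 : ∫ v in Ioi 0, v ^ n * Real.exp (-b * v) = n.factorial / b ^ (n + 1) := by
    have e : (1 / b) ^ ((n : ℝ) + 1) * (n.factorial : ℝ) = n.factorial / b ^ (n + 1) := by
      rw [show ((n : ℝ) + 1) = ((n + 1 : ℕ) : ℝ) by push_cast; ring, Real.rpow_natCast, div_pow,
        one_pow]
      field_simp
    rw [← e, ← h]
    refine setIntegral_congr_fun measurableSet_Ioi fun v hv => ?_
    simp [Real.rpow_natCast]
  have hpos : 0 < (n.factorial : ℝ) / b ^ (n + 1) := by positivity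
  -- A function that is not integrable has integral zero by convention, which the positive value
  -- excludes.
  have hi : IntegrableOn (fun v => v ^ n * Real.exp (-b * v)) (Ioi 0) := by
    by_contra hn
    rw [integral_undef hn] at h1
    exact hpos.ne h1
  rw [← h1, ofReal_integral_eq_lintegral_ofReal hi]
  filter_upwards [ae_restrict_mem measurableSet_Ioi] with v hv
  have hv' : (0 : ℝ) < v := hv
  positivity

lemma lintegral_exp_quadratic {b : ℝ} (hb : 0 < b) (c : ℝ) :
    ∫⁻ X : ℝ, ENNReal.ofReal (Real.exp (-b * X ^ 2 + c * X)) =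
      ENNReal.ofReal (√(Real.pi / b) * Real.exp (c ^ 2 / (4 * b))) := by
  have e : ∀ X : ℝ, ENNReal.ofReal (Real.exp (-b * X ^ 2 + c * X)) =
      ENNReal.ofReal (Real.exp (c ^ 2 / (4 * b))) *
        ENNReal.ofReal (Real.exp (-b * (X - c / (2 * b)) ^ 2)) := fun X => by
    rw [← ENNReal.ofReal_mul (Real.exp_pos _).le, ← Real.exp_add]
    congr 2
    field_simp
    ring
  simp_rw [e]
  rw [lintegral_const_mul _ (by fun_prop), lintegral_sub_right_eq_self
    (fun X => ENNReal.ofReal (Real.exp (-b * X ^ 2))), ← ofReal_integral_eq_lintegral_ofReal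
    (integrable_exp_neg_mul_sq hb) (.of_forall fun X => (Real.exp_pos _).le), integral_gaussian,
    ← ENNReal.ofReal_mul (Real.exp_pos _).le, mul_comm]

/-- The substitution `v = s² - X²` turns this into a Gamma integral; `s ds = dv / 2` gives the
factor `2`. -/
lemma lintegral_sq_sub_sq_pow (ℓ : ℕ) {b : ℝ} (hb : 0 < b) (X : ℝ) :
    ∫⁻ s in Ioi |X|, ENNReal.ofReal (s * (s ^ 2 - X ^ 2) ^ ℓ * Real.exp (-b * (s ^ 2 - X ^ 2))) =
      ENNReal.ofReal (ℓ.factorial / (2 * b ^ (ℓ + 1))) := by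
  have himg : (fun s : ℝ => s ^ 2 - X ^ 2) '' Ioi |X| = Ioi 0 := by
    ext v
    simp only [mem_image, mem_Ioi]
    constructor
    · rintro ⟨s, hs, rfl⟩
      have := sq_lt_sq.2 (hs.trans_le (le_abs_self s))
      linarith
    · intro hv
      refine ⟨√(v + X ^ 2), ?_, ?_⟩
      · rw [← Real.sqrt_sq_eq_abs]
        exact Real.sqrt_lt_sqrt (sq_nonneg X) (by linarith)
      · rw [Real.sq_sqrt (by positivity)]; ring
  have h := lintegral_image_eq_lintegral_abs_deriv_mul (s := Ioi |X|)
    (f := fun s : ℝ => s ^ 2 - X ^ 2) (f' := fun s => 2 * s) measurableSet_Ioi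
    (fun s _ => by
      have := ((hasDerivAt_pow 2 s).sub_const (X ^ 2)).hasDerivWithinAt (s := Ioi |X|)
      simpa using this)
    (fun s hs t ht hst => by
      have h1 : 0 ≤ s := (abs_nonneg X).trans (le_of_lt hs)
      have h2 : 0 ≤ t := (abs_nonneg X).trans (le_of_lt ht)
      have h3 : s ^ 2 = t ^ 2 := by simpa using hst
      exact (pow_left_inj₀ h1 h2 two_ne_zero).1 h3)
    (fun v => ENNReal.ofReal (v ^ ℓ * Real.exp (-b * v)))
  rw [himg, lintegral_pow_mul_exp_neg ℓ hb] at h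
  have e : ∫⁻ s in Ioi |X|, ENNReal.ofReal
        (s * (s ^ 2 - X ^ 2) ^ ℓ * Real.exp (-b * (s ^ 2 - X ^ 2))) =
      ∫⁻ s in Ioi |X|, ENNReal.ofReal (1 / 2) * (ENNReal.ofReal |2 * s| *
        ENNReal.ofReal ((s ^ 2 - X ^ 2) ^ ℓ * Real.exp (-b * (s ^ 2 - X ^ 2)))) := by
    refine setLIntegral_congr_fun measurableSet_Ioi fun s hs => ?_
    have h1 : 0 ≤ s := (abs_nonneg X).trans (le_of_lt hs)
    rw [abs_of_nonneg (by positivity), ← ENNReal.ofReal_mul (by positivity),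
      ← ENNReal.ofReal_mul (by positivity)]
    congr 1
    ring
  rw [e, lintegral_const_mul _ (by fun_prop), ← h, ← ENNReal.ofReal_mul (by positivity)]
  congr 1
  field_simp

lemma lintegral_Ioo_comp_mul {s : ℝ} (hs : 0 < s) (g : ℝ → ℝ≥0∞) :
    ∫⁻ τ in Ioo (-1) 1, ENNReal.ofReal s * g (s * τ) = ∫⁻ X in Ioo (-s) s, g X := by
  have himg : (fun τ : ℝ => s * τ) '' Ioo (-1) 1 = Ioo (-s) s := by
    rw [Set.image_mul_left_Ioo hs]; simp
  have h := lintegral_image_eq_lintegral_abs_deriv_mul (s := Ioo (-1 : ℝ) 1)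
    (f := fun τ : ℝ => s * τ) (f' := fun _ => s) measurableSet_Ioo
    (fun τ _ => by simpa using ((hasDerivAt_id τ).const_mul s).hasDerivWithinAt)
    (fun x _ y _ hxy => mul_left_cancel₀ hs.ne' hxy) g
  rw [himg, abs_of_pos hs] at h
  exact h.symm

/-- A Gaussian integral in cylindrical coordinates. -/
lemma lintegral_gauss_angular (ℓ : ℕ) {b : ℝ} (hb : 0 < b) (c : ℝ) :
    ∫⁻ s in Ioi 0, ∫⁻ τ in Ioo (-1) 1, ENNReal.ofReal
      (s ^ (2 * ℓ + 2) * (1 - τ ^ 2) ^ ℓ * Real.exp (-b * s ^ 2 + c * (s * τ))) =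
      ENNReal.ofReal (ℓ.factorial / (2 * b ^ (ℓ + 1)) *
        (√(Real.pi / b) * Real.exp (c ^ 2 / (4 * b)))) := by
  -- With the axial coordinate `X = sτ`, the quantity `s²(1-τ²) = s² - X²` is the squared distance
  -- to the axis. On the region `|X| < s` the order of integration is exchanged: the integral in `s`
  -- is a Gamma integral, the one in `X` a Gaussian.
  set G : ℝ → ℝ → ℝ≥0∞ := fun s X =>
    ENNReal.ofReal (s * (s ^ 2 - X ^ 2) ^ ℓ * Real.exp (-b * s ^ 2 + c * X)) with hG
  have hGm : Measurable (Function.uncurry G) := by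
    rw [hG]; unfold Function.uncurry; fun_prop
  have e1 : ∫⁻ s in Ioi 0, ∫⁻ τ in Ioo (-1) 1, ENNReal.ofReal
      (s ^ (2 * ℓ + 2) * (1 - τ ^ 2) ^ ℓ * Real.exp (-b * s ^ 2 + c * (s * τ))) =
      ∫⁻ s in Ioi 0, ∫⁻ X in Ioo (-s) s, G s X := by
    refine setLIntegral_congr_fun measurableSet_Ioi fun s hs => ?_
    have hs' : (0 : ℝ) < s := hs
    rw [← lintegral_Ioo_comp_mul hs']
    refine lintegral_congr fun τ => ?_
    rw [hG]
    simp only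
    rw [← ENNReal.ofReal_mul hs'.le]
    congr 1
    rw [show s ^ 2 - (s * τ) ^ 2 = s ^ 2 * (1 - τ ^ 2) by ring, mul_pow]
    ring
  have hS : MeasurableSet {z : ℝ × ℝ | |z.2| < z.1} :=
    measurableSet_lt (by fun_prop) (by fun_prop)
  set H : ℝ → ℝ → ℝ≥0∞ := fun s X =>
    ({z : ℝ × ℝ | |z.2| < z.1}).indicator (Function.uncurry G) (s, X) with hH
  have hHm : Measurable (Function.uncurry H) := hGm.indicator hS
  have e2 : ∫⁻ s in Ioi 0, ∫⁻ X in Ioo (-s) s, G s X = ∫⁻ s, ∫⁻ X, H s X := by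
    rw [← lintegral_indicator measurableSet_Ioi]
    refine lintegral_congr fun s => ?_
    by_cases hs : 0 < s
    · rw [indicator_of_mem (show s ∈ Ioi 0 from hs), ← lintegral_indicator measurableSet_Ioo]
      refine lintegral_congr fun X => ?_
      simp only [hH, indicator, mem_Ioo, mem_ofPred_eq, abs_lt, Function.uncurry]
    · rw [indicator_of_notMem (show s ∉ Ioi 0 from hs)]
      symm
      rw [lintegral_eq_zero_iff (hHm.of_uncurry_left)]
      refine .of_forall fun X => ?_
      refine indicator_of_notMem ?_ _
      simp only [mem_ofPred_eq, not_lt]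
      exact (not_lt.1 hs).trans (abs_nonneg X)
  rw [e1, e2, lintegral_lintegral_swap hHm.aemeasurable]
  have e3 : ∀ X, ∫⁻ s, H s X = ENNReal.ofReal (ℓ.factorial / (2 * b ^ (ℓ + 1))) *
      ENNReal.ofReal (Real.exp (-b * X ^ 2 + c * X)) := fun X => by
    rw [← lintegral_sq_sub_sq_pow ℓ hb X, ← lintegral_mul_const _ (by fun_prop),
      ← lintegral_indicator measurableSet_Ioi]
    refine lintegral_congr fun s => ?_
    simp only [hH, indicator, mem_Ioi, mem_ofPred_eq, Function.uncurry]
    split_ifs with h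
    · rw [hG]
      simp only
      rw [← ENNReal.ofReal_mul']
      · congr 1
        rw [mul_assoc _ (Real.exp _) (Real.exp _), ← Real.exp_add]
        ring_nf
      · positivity
    · rfl
  simp_rw [e3]
  rw [lintegral_const_mul _ (by fun_prop), lintegral_exp_quadratic hb,
    ← ENNReal.ofReal_mul (by positivity)]

lemma ofReal_intervalIntegral {F : ℝ → ℝ} (hF : Continuous F) (h0 : ∀ τ ∈ Icc (-1 : ℝ) 1, 0 ≤ F τ) :
    ENNReal.ofReal (∫ τ in (-1 : ℝ)..1, F τ) =
      ∫⁻ τ in Ioo (-1) 1, ENNReal.ofReal (F τ) := by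
  rw [intervalIntegral.integral_of_le (by norm_num), integral_Ioc_eq_integral_Ioo,
    ofReal_integral_eq_lintegral_ofReal]
  · exact (hF.integrableOn_Icc (a := -1) (b := 1)).mono_set Ioo_subset_Icc_self
  · filter_upwards [ae_restrict_mem measurableSet_Ioo] with τ hτ
    exact h0 τ (Ioo_subset_Icc_self hτ)

/-! ### The heat kernel in a sector -/

/-- The squared distance `r² + s² - 2 r s τ` between two points at distance `r` and `s` from the
origin, seen from there under an angle of cosine `τ`. -/
def chordSq (r s τ : ℝ) : ℝ := r ^ 2 + s ^ 2 - 2 * r * s * τ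

/-- The angular integral of the heat kernel in the sector `ℓ`. -/
noncomputable def angularInt (ℓ : ℕ) (x r s : ℝ) : ℝ :=
  ∫ τ in (-1 : ℝ)..1, Real.exp (-(Real.pi * x) * chordSq r s τ) * (1 - τ ^ 2) ^ ℓ

/-- The integral kernel of the heat semigroup (at time `1 / (4 π x)`) in the sector `ℓ`, with
respect to the measure `r² dr`. -/
noncomputable def heatKernel (ℓ : ℕ) (x r s : ℝ) : ℝ :=
  2 * Real.pi * x ^ (3 / 2 : ℝ) * ((Real.pi * x * r * s) ^ ℓ / ℓ.factorial) * angularInt ℓ x r s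

lemma continuous_angularInt (ℓ : ℕ) :
    Continuous fun z : ℝ × ℝ × ℝ => angularInt ℓ z.1 z.2.1 z.2.2 := by
  unfold angularInt chordSq
  refine intervalIntegral.continuous_parametric_intervalIntegral_of_continuous' ?_ _ _
  unfold Function.uncurry
  fun_prop

lemma measurable_heatKernel (ℓ : ℕ) :
    Measurable fun z : ℝ × ℝ × ℝ => heatKernel ℓ z.1 z.2.1 z.2.2 := by
  unfold heatKernel
  exact Measurable.mul (by fun_prop) (continuous_angularInt ℓ).measurable

lemma continuous_heatKernel (ℓ : ℕ) (x : ℝ) :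
    Continuous fun z : ℝ × ℝ => heatKernel ℓ x z.1 z.2 := by
  unfold heatKernel
  exact Continuous.mul (by fun_prop)
    ((continuous_angularInt ℓ).comp (f := fun z : ℝ × ℝ => (x, z.1, z.2)) (by fun_prop))

lemma one_sub_sq_nonneg {τ : ℝ} (hτ : τ ∈ Icc (-1 : ℝ) 1) : 0 ≤ 1 - τ ^ 2 := by
  nlinarith [hτ.1, hτ.2]

lemma angularInt_nonneg (ℓ : ℕ) (x r s : ℝ) : 0 ≤ angularInt ℓ x r s :=
  intervalIntegral.integral_nonneg (by norm_num) fun τ hτ => by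
    have := one_sub_sq_nonneg hτ
    positivity

lemma heatKernel_nonneg (ℓ : ℕ) {x r s : ℝ} (hx : 0 < x) (hr : 0 ≤ r) (hs : 0 ≤ s) :
    0 ≤ heatKernel ℓ x r s := by
  have := angularInt_nonneg ℓ x r s
  unfold heatKernel
  positivity

lemma heatKernel_comm (ℓ : ℕ) (x r s : ℝ) : heatKernel ℓ x r s = heatKernel ℓ x s r := by
  unfold heatKernel angularInt chordSq
  rw [show Real.pi * x * r * s = Real.pi * x * s * r by ring]
  simp only [show ∀ τ, r ^ 2 + s ^ 2 - 2 * r * s * τ = s ^ 2 + r ^ 2 - 2 * s * r * τ from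
    fun τ => by ring]

/-- The difference of the heat kernels of two consecutive sectors. -/
lemma heatKernel_sub_succ (n : ℕ) (x r s : ℝ) :
    heatKernel n x r s - heatKernel (n + 1) x r s =
      2 * Real.pi * x ^ (3 / 2 : ℝ) * ((Real.pi * x * r * s) ^ n / n.factorial) *
      ∫ τ in (-1 : ℝ)..1, Real.exp (-(Real.pi * x) * chordSq r s τ) *
        ((1 - τ) * (1 - τ ^ 2) ^ n) := by
  set z := Real.pi * x * r * s with hz
  set E : ℝ → ℝ := fun τ => Real.exp (-(Real.pi * x) * chordSq r s τ) with hE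
  have hEc : Continuous E := by rw [hE]; unfold chordSq; fun_prop
  have hEd : ∀ τ, HasDerivAt E (2 * z * E τ) τ := fun τ => by
    have h1 : HasDerivAt (fun τ => -(Real.pi * x) * chordSq r s τ) (2 * z) τ := by
      unfold chordSq
      have := (((hasDerivAt_id τ).const_mul (2 * r * s)).const_sub (r ^ 2 + s ^ 2)).const_mul
        (-(Real.pi * x))
      refine this.congr_deriv ?_
      rw [hz]; ring
    refine h1.exp.congr_deriv ?_
    rw [hE]; ring
  have hFd : ∀ τ, HasDerivAt (fun τ => E τ * (1 - τ ^ 2) ^ (n + 1))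
      (2 * (z * (E τ * (1 - τ ^ 2) ^ (n + 1)) - (n + 1) * (E τ * (τ * (1 - τ ^ 2) ^ n)))) τ := by
    intro τ
    have h1 := ((hasDerivAt_pow 2 τ).const_sub 1).pow (n + 1)
    refine ((hEd τ).mul h1).congr_deriv ?_
    simp only [Nat.add_sub_cancel, Pi.pow_apply]
    push_cast
    ring
  have hi : ∀ F : ℝ → ℝ, Continuous F → IntervalIntegrable F volume (-1) 1 :=
    fun F hF => hF.intervalIntegrable _ _
  -- The boundary terms vanish because of the factor `(1-τ²)^{n+1}`. The outcome is that the kernel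
  -- of index `n+1` is that of index `n` with an extra `τ` in the integrand, so the difference
  -- carries `1 - τ`.
  have h := intervalIntegral.integral_eq_sub_of_hasDerivAt (a := -1) (b := 1)
    (fun τ _ => hFd τ) (hi _ (by fun_prop))
  rw [intervalIntegral.integral_const_mul, intervalIntegral.integral_sub (hi _ (by fun_prop))
    (hi _ (by fun_prop)), intervalIntegral.integral_const_mul,
    intervalIntegral.integral_const_mul] at h
  norm_num at h
  have hsplit : ∫ τ in (-1 : ℝ)..1, E τ * ((1 - τ) * (1 - τ ^ 2) ^ n) =
      (∫ τ in (-1 : ℝ)..1, E τ * (1 - τ ^ 2) ^ n) -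
        ∫ τ in (-1 : ℝ)..1, E τ * (τ * (1 - τ ^ 2) ^ n) := by
    rw [← intervalIntegral.integral_sub (hi _ (by fun_prop)) (hi _ (by fun_prop))]
    congr 1; ext τ; ring
  have hn : (n.factorial : ℝ) ≠ 0 := by exact_mod_cast n.factorial_ne_zero
  have hn1 : ((n : ℝ) + 1) ≠ 0 := by positivity
  have key : ∫ τ in (-1 : ℝ)..1, E τ * (τ * (1 - τ ^ 2) ^ n) =
      z / (n + 1) * ∫ τ in (-1 : ℝ)..1, E τ * (1 - τ ^ 2) ^ (n + 1) := by
    rw [div_mul_eq_mul_div, eq_div_iff hn1]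
    linear_combination -h
  have hA : ∀ k, angularInt k x r s = ∫ τ in (-1 : ℝ)..1, E τ * (1 - τ ^ 2) ^ k := fun _ => rfl
  rw [hsplit, key, heatKernel, heatKernel, hA, hA, ← hz, Nat.factorial_succ, pow_succ z n]
  push_cast
  field_simp

/-- The weight `(1-τ)(1-τ²)^n` of the difference is nonnegative. This sign lets the differences be
integrated in `x` without absolute values, and lets every kernel be compared with that of index `0`.
-/
lemma heatKernel_succ_le (n : ℕ) {x r s : ℝ} (hx : 0 < x) (hr : 0 ≤ r) (hs : 0 ≤ s) :
    heatKernel (n + 1) x r s ≤ heatKernel n x r s := by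
  rw [← sub_nonneg, heatKernel_sub_succ]
  refine mul_nonneg (by positivity) (intervalIntegral.integral_nonneg (by norm_num) fun τ hτ => ?_)
  have := one_sub_sq_nonneg hτ
  have := sub_nonneg.2 hτ.2
  positivity

lemma heatKernel_antitone {x r s : ℝ} (hx : 0 < x) (hr : 0 ≤ r) (hs : 0 ≤ s) :
    Antitone fun n => heatKernel n x r s :=
  antitone_nat_of_succ_le fun n => heatKernel_succ_le n hx hr hs

/-- The action of the heat kernel on radial Gaussians. -/
lemma lintegral_heatKernel_mul_gauss (ℓ : ℕ) {x : ℝ} (hx : 0 < x) {a : ℝ} (ha : 0 ≤ a) {r : ℝ}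
    (hr : 0 ≤ r) :
    ∫⁻ s, ENNReal.ofReal (heatKernel ℓ x r s * (s ^ ℓ * Real.exp (-(Real.pi * a) * s ^ 2)))
        ∂radialMeasure =
      ENNReal.ofReal ((x / (a + x)) ^ (ℓ + 3 / 2 : ℝ) *
        (r ^ ℓ * Real.exp (-(Real.pi * (a * x / (a + x))) * r ^ 2))) := by
  rw [lintegral_radialMeasure]
  -- The total exponent is `-πxr² - b s² + c sτ`; the first term goes into the prefactor `K` and the
  -- others match `lintegral_gauss_angular`.
  set b := Real.pi * (a + x) with hb
  have hb0 : 0 < b := by have := Real.pi_pos; positivity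
  set c := 2 * Real.pi * x * r with hc
  set K := 2 * Real.pi * x ^ (3 / 2 : ℝ) * ((Real.pi * x * r) ^ ℓ / ℓ.factorial) *
    Real.exp (-(Real.pi * x) * r ^ 2) with hK
  have hK0 : 0 ≤ K := by positivity
  have e : ∀ s ∈ Ioi (0 : ℝ), ENNReal.ofReal (s ^ 2) * ENNReal.ofReal
      (heatKernel ℓ x r s * (s ^ ℓ * Real.exp (-(Real.pi * a) * s ^ 2))) =
      ENNReal.ofReal K * ∫⁻ τ in Ioo (-1) 1, ENNReal.ofReal
      (s ^ (2 * ℓ + 2) * (1 - τ ^ 2) ^ ℓ * Real.exp (-b * s ^ 2 + c * (s * τ))) := by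
    intro s hs
    have hs' : (0 : ℝ) < s := hs
    rw [← ofReal_intervalIntegral (by fun_prop) (fun τ hτ => by
      have := one_sub_sq_nonneg hτ
      positivity), ← ENNReal.ofReal_mul (by positivity), ← ENNReal.ofReal_mul hK0]
    congr 1
    unfold heatKernel angularInt chordSq
    have e1 : ∀ τ : ℝ, s ^ (2 * ℓ + 2) * (1 - τ ^ 2) ^ ℓ * Real.exp (-b * s ^ 2 + c * (s * τ)) =
        (s ^ (2 * ℓ + 2) * Real.exp (Real.pi * x * r ^ 2) * Real.exp (-(Real.pi * a) * s ^ 2)) *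
        (Real.exp (-(Real.pi * x) * (r ^ 2 + s ^ 2 - 2 * r * s * τ)) * (1 - τ ^ 2) ^ ℓ) := by
      intro τ
      have : Real.exp (-b * s ^ 2 + c * (s * τ)) = Real.exp (Real.pi * x * r ^ 2) *
          Real.exp (-(Real.pi * a) * s ^ 2) *
          Real.exp (-(Real.pi * x) * (r ^ 2 + s ^ 2 - 2 * r * s * τ)) := by
        rw [← Real.exp_add, ← Real.exp_add]
        congr 1
        rw [hb, hc]; ring
      rw [this]; ring
    simp_rw [e1]
    rw [intervalIntegral.integral_const_mul, hK]
    have e2 : Real.exp (-(Real.pi * x) * r ^ 2) * Real.exp (Real.pi * x * r ^ 2) = 1 := by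
      rw [← Real.exp_add]; simp
    rw [mul_pow (Real.pi * x * r) s]
    linear_combination (-(2 * Real.pi * x ^ (3 / 2 : ℝ) * ((Real.pi * x * r) ^ ℓ / ℓ.factorial) *
      s ^ (2 * ℓ + 2) * Real.exp (-(Real.pi * a) * s ^ 2) * ∫ τ in (-1 : ℝ)..1,
      (Real.exp (-(Real.pi * x) * (r ^ 2 + s ^ 2 - 2 * r * s * τ)) * (1 - τ ^ 2) ^ ℓ))) * e2
  rw [setLIntegral_congr_fun measurableSet_Ioi e, lintegral_const_mul' _ _ ENNReal.ofReal_ne_top,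
    lintegral_gauss_angular ℓ hb0, ← ENNReal.ofReal_mul hK0]
  congr 1
  have hax : 0 < a + x := by positivity
  have e1 : √(Real.pi / b) = (a + x) ^ (-(1 / 2) : ℝ) := by
    rw [hb, show Real.pi / (Real.pi * (a + x)) = (a + x)⁻¹ by
      have := Real.pi_ne_zero; field_simp, Real.sqrt_eq_rpow, Real.inv_rpow hax.le,
      ← Real.rpow_neg hax.le]
  have e2 : (x / (a + x)) ^ (ℓ + 3 / 2 : ℝ) = x ^ ℓ * x ^ (3 / 2 : ℝ) *
      ((a + x) ^ (-(1 / 2) : ℝ) / (a + x) ^ (ℓ + 1)) := by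
    have h1 : (a + x) ^ (ℓ + 3 / 2 : ℝ) = (a + x) ^ (ℓ + 1) * (a + x) ^ (1 / 2 : ℝ) := by
      rw [← Real.rpow_natCast, ← Real.rpow_add hax]
      congr 1
      push_cast; ring
    have h2 : (a + x) ^ (1 / 2 : ℝ) ≠ 0 := (Real.rpow_pos_of_pos hax _).ne'
    rw [Real.div_rpow hx.le hax.le, Real.rpow_add hx, Real.rpow_natCast, h1,
      Real.rpow_neg hax.le]
    field_simp
  have e3 : Real.exp (-(Real.pi * (a * x / (a + x))) * r ^ 2) =
      Real.exp (-(Real.pi * x) * r ^ 2) * Real.exp (c ^ 2 / (4 * b)) := by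
    rw [← Real.exp_add]
    congr 1
    have := Real.pi_ne_zero
    rw [hb, hc]
    field_simp
    ring
  rw [e1, e2, e3, hK, hb, mul_pow Real.pi (a + x), mul_pow, mul_pow]
  have hf : (ℓ.factorial : ℝ) ≠ 0 := by exact_mod_cast ℓ.factorial_ne_zero
  have := Real.pi_ne_zero
  field_simp
  ring

/-! ### The Schur test and the form of the heat semigroup -/

/-- A Schur test on `L²([0, ∞), r² dr)`, in its quadratic form. -/
lemma lintegral_schur_le {K : ℝ → ℝ → ℝ≥0∞} (hK : Measurable (Function.uncurry K)) {p a b : ℝ → ℝ}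
    (hpm : Measurable p) (ham : Measurable a) (hbm : Measurable b) (hp : ∀ r, 0 < r → 0 < p r)
    (A : ℝ≥0∞)
    (h1 : ∀ r, 0 < r → ∫⁻ s, K r s * ENNReal.ofReal (p s) ∂radialMeasure ≤
      A * ENNReal.ofReal (p r))
    (h2 : ∀ s, 0 < s → ∫⁻ r, K r s * ENNReal.ofReal (p r) ∂radialMeasure ≤
      A * ENNReal.ofReal (p s)) :
    ∫⁻ r, ∫⁻ s, ENNReal.ofReal (a r * b s) * K r s ∂radialMeasure ∂radialMeasure ≤
      A * (∫⁻ r, ENNReal.ofReal (a r ^ 2 / 2) ∂radialMeasure +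
        ∫⁻ s, ENNReal.ofReal (b s ^ 2 / 2) ∂radialMeasure) := by
  have hKl : ∀ r, Measurable fun s => K r s := fun r => hK.of_uncurry_left
  have hKr : ∀ s, Measurable fun r => K r s := fun s => hK.of_uncurry_right
  have hm1 : Measurable (Function.uncurry fun r s =>
      ENNReal.ofReal (a r ^ 2 / 2 / p r) * (K r s * ENNReal.ofReal (p s))) := by
    refine Measurable.mul ?_ (hK.mul ?_) <;> fun_prop
  have hm2 : Measurable (Function.uncurry fun r s =>
      ENNReal.ofReal (b s ^ 2 / 2 / p s) * (K r s * ENNReal.ofReal (p r))) := by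
    refine Measurable.mul ?_ (hK.mul ?_) <;> fun_prop
  calc ∫⁻ r, ∫⁻ s, ENNReal.ofReal (a r * b s) * K r s ∂radialMeasure ∂radialMeasure
      ≤ ∫⁻ r, ∫⁻ s, (ENNReal.ofReal (a r ^ 2 / 2 / p r) * (K r s * ENNReal.ofReal (p s)) +
          ENNReal.ofReal (b s ^ 2 / 2 / p s) * (K r s * ENNReal.ofReal (p r)))
          ∂radialMeasure ∂radialMeasure := by
        refine lintegral_mono_ae ?_
        filter_upwards [ae_radialMeasure_pos] with r hr
        refine lintegral_mono_ae ?_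
        filter_upwards [ae_radialMeasure_pos] with s hs
        have hpr := hp r hr
        have hps := hp s hs
        have e : ∀ X Y : ℝ, 0 ≤ X → ENNReal.ofReal X * (K r s * ENNReal.ofReal Y) =
            ENNReal.ofReal (X * Y) * K r s := fun X Y hX => by
          rw [ENNReal.ofReal_mul hX]; ring
        rw [e _ _ (by positivity), e _ _ (by positivity), ← add_mul,
          ← ENNReal.ofReal_add (by positivity) (by positivity)]
        gcongr
        -- Weighted arithmetic-geometric mean inequality, as the expansion of a square.
        have h3 : a r ^ 2 / 2 / p r * p s + b s ^ 2 / 2 / p s * p r - a r * b s =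
            (a r * p s - b s * p r) ^ 2 / (2 * p r * p s) := by
          field_simp; ring
        have h4 : 0 ≤ (a r * p s - b s * p r) ^ 2 / (2 * p r * p s) := by positivity
        linarith
    _ = ∫⁻ r, ∫⁻ s, ENNReal.ofReal (a r ^ 2 / 2 / p r) * (K r s * ENNReal.ofReal (p s))
          ∂radialMeasure ∂radialMeasure +
        ∫⁻ s, ∫⁻ r, ENNReal.ofReal (b s ^ 2 / 2 / p s) * (K r s * ENNReal.ofReal (p r))
          ∂radialMeasure ∂radialMeasure := by
        rw [← lintegral_lintegral_swap (μ := radialMeasure) (ν := radialMeasure) hm2.aemeasurable,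
          ← lintegral_add_left]
        · refine lintegral_congr fun r => ?_
          rw [lintegral_add_left]
          exact hm1.of_uncurry_left
        · exact hm1.lintegral_prod_right'
    _ ≤ ∫⁻ r, A * ENNReal.ofReal (a r ^ 2 / 2) ∂radialMeasure +
        ∫⁻ s, A * ENNReal.ofReal (b s ^ 2 / 2) ∂radialMeasure := by
        gcongr ?_ + ?_
        · refine lintegral_mono_ae ?_
          filter_upwards [ae_radialMeasure_pos] with r hr
          rw [lintegral_const_mul' _ _ ENNReal.ofReal_ne_top]
          refine (mul_le_mul_right (h1 r hr) _).trans_eq ?_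
          have := hp r hr
          rw [mul_left_comm, ← ENNReal.ofReal_mul (by positivity)]
          congr 2
          field_simp
        · refine lintegral_mono_ae ?_
          filter_upwards [ae_radialMeasure_pos] with r hr
          rw [lintegral_const_mul' _ _ ENNReal.ofReal_ne_top]
          refine (mul_le_mul_right (h2 r hr) _).trans_eq ?_
          have := hp r hr
          rw [mul_left_comm, ← ENNReal.ofReal_mul (by positivity)]
          congr 2
          field_simp
    _ = _ := by
        rw [lintegral_const_mul _ (by fun_prop), lintegral_const_mul _ (by fun_prop), mul_add]

lemma measurable_norm_coeFn (v : L2Rad) : Measurable fun r => ‖v r‖ :=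
  (Lp.stronglyMeasurable v).measurable.norm

lemma lintegral_norm_sq_half (v : L2Rad) :
    ∫⁻ r, ENNReal.ofReal (‖v r‖ ^ 2 / 2) ∂radialMeasure = ENNReal.ofReal (‖v‖ ^ 2 / 2) := by
  have h : ∀ x : ℝ, ENNReal.ofReal (x ^ 2 / 2) = ENNReal.ofReal (1 / 2) * ENNReal.ofReal (x ^ 2) :=
    fun x => by rw [← ENNReal.ofReal_mul (by norm_num)]; congr 1; ring
  simp_rw [h]
  rw [ofReal_norm_sq_eq_lintegral, lintegral_const_mul' _ _ ENNReal.ofReal_ne_top]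
  congr 1
  refine lintegral_congr fun r => ?_
  rw [ENNReal.ofReal_pow (norm_nonneg _), ofReal_norm]

lemma lintegral_schur_Lp_le {K : ℝ → ℝ → ℝ≥0∞} (hK : Measurable (Function.uncurry K)) {p : ℝ → ℝ}
    (hpm : Measurable p) (hp : ∀ r, 0 < r → 0 < p r) {A : ℝ} (hA : 0 ≤ A)
    (h1 : ∀ r, 0 < r → ∫⁻ s, K r s * ENNReal.ofReal (p s) ∂radialMeasure ≤
      ENNReal.ofReal A * ENNReal.ofReal (p r))
    (h2 : ∀ s, 0 < s → ∫⁻ r, K r s * ENNReal.ofReal (p r) ∂radialMeasure ≤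
      ENNReal.ofReal A * ENNReal.ofReal (p s)) (v u : L2Rad) :
    ∫⁻ r, ∫⁻ s, ENNReal.ofReal (‖v r‖ * ‖u s‖) * K r s ∂radialMeasure ∂radialMeasure ≤
      ENNReal.ofReal (A * ((‖v‖ ^ 2 + ‖u‖ ^ 2) / 2)) := by
  refine (lintegral_schur_le hK hpm (measurable_norm_coeFn v) (measurable_norm_coeFn u) hp _
    h1 h2).trans_eq ?_
  rw [lintegral_norm_sq_half, lintegral_norm_sq_half, ← ENNReal.ofReal_add (by positivity)
    (by positivity), ← ENNReal.ofReal_mul hA]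
  congr 1
  ring

lemma measurable_heatKernel_uncurry (ℓ : ℕ) (x : ℝ) :
    Measurable (Function.uncurry fun r s => ENNReal.ofReal (heatKernel ℓ x r s)) :=
  (continuous_heatKernel ℓ x).measurable.ennreal_ofReal

/-- The kernel decreases with `ℓ`, and for `ℓ = 0` the Gaussian identity at `a = 0` says that the
total mass is one. -/
lemma lintegral_heatKernel_le (ℓ : ℕ) {x r : ℝ} (hx : 0 < x) (hr : 0 < r) :
    ∫⁻ s, ENNReal.ofReal (heatKernel ℓ x r s) ∂radialMeasure ≤ 1 := by
  have h := lintegral_heatKernel_mul_gauss 0 hx le_rfl hr.le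
  have e : ENNReal.ofReal ((x / (0 + x)) ^ ((0 : ℕ) + 3 / 2 : ℝ) *
        (r ^ 0 * Real.exp (-(Real.pi * (0 * x / (0 + x))) * r ^ 2))) = 1 := by
    rw [zero_add, div_self hx.ne']; simp
  rw [e] at h
  rw [← h]
  refine lintegral_mono_ae ?_
  filter_upwards [ae_radialMeasure_pos] with s hs
  refine ENNReal.ofReal_le_ofReal ?_
  simpa using heatKernel_antitone hx hr.le hs.le (Nat.zero_le ℓ)

lemma lintegral_norm_mul_heatKernel_le (ℓ : ℕ) {x : ℝ} (hx : 0 < x) (v u : L2Rad) :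
    ∫⁻ r, ∫⁻ s, ENNReal.ofReal (‖v r‖ * ‖u s‖) * ENNReal.ofReal (heatKernel ℓ x r s)
      ∂radialMeasure ∂radialMeasure ≤ ENNReal.ofReal ((‖v‖ ^ 2 + ‖u‖ ^ 2) / 2) := by
  have h := lintegral_schur_Lp_le (measurable_heatKernel_uncurry ℓ x) (p := fun _ => 1)
    measurable_const (fun _ _ => one_pos) (A := 1) zero_le_one
    (fun r hr => by simpa using lintegral_heatKernel_le ℓ hx hr)
    (fun s hs => by
      simp_rw [heatKernel_comm ℓ x _ s]
      simpa using lintegral_heatKernel_le ℓ hx hs) v u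
  rwa [one_mul] at h

/-- The integrand of the sesquilinear form of the heat semigroup. -/
noncomputable def heatIntegrand (ℓ : ℕ) (x : ℝ) (v f : L2Rad) (z : ℝ × ℝ) : ℂ :=
  (starRingEnd ℂ (v z.1) * f z.2) * (heatKernel ℓ x z.1 z.2 : ℂ)

lemma aestronglyMeasurable_conj_mul (v f : L2Rad) :
    AEStronglyMeasurable (fun z : ℝ × ℝ => starRingEnd ℂ (v z.1) * f z.2)
      (radialMeasure.prod radialMeasure) := by
  refine StronglyMeasurable.aestronglyMeasurable ?_
  have h1 : StronglyMeasurable fun z : ℝ × ℝ => v z.1 :=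
    (Lp.stronglyMeasurable v).comp_measurable measurable_fst
  have h2 : StronglyMeasurable fun z : ℝ × ℝ => f z.2 :=
    (Lp.stronglyMeasurable f).comp_measurable measurable_snd
  exact (Complex.continuous_conj.comp_stronglyMeasurable h1).mul h2

lemma ae_prod_radialMeasure_pos :
    ∀ᵐ z ∂(radialMeasure.prod radialMeasure), 0 < z.1 ∧ 0 < z.2 := by
  have h1 := Measure.quasiMeasurePreserving_fst (μ := radialMeasure) (ν := radialMeasure)
    |>.ae ae_radialMeasure_pos
  have h2 := Measure.quasiMeasurePreserving_snd (μ := radialMeasure) (ν := radialMeasure)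
    |>.ae ae_radialMeasure_pos
  filter_upwards [h1, h2] with z hz1 hz2 using ⟨hz1, hz2⟩

lemma lintegral_enorm_heatIntegrand_le (ℓ : ℕ) {x : ℝ} (hx : 0 < x) (v f : L2Rad) :
    ∫⁻ z, ‖heatIntegrand ℓ x v f z‖ₑ ∂(radialMeasure.prod radialMeasure) ≤
      ENNReal.ofReal ((‖v‖ ^ 2 + ‖f‖ ^ 2) / 2) := by
  refine le_trans ?_ (lintegral_norm_mul_heatKernel_le ℓ hx v f)
  rw [← lintegral_prod (fun z : ℝ × ℝ => ENNReal.ofReal (‖v z.1‖ * ‖f z.2‖) *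
    ENNReal.ofReal (heatKernel ℓ x z.1 z.2))]
  · refine lintegral_mono_ae ?_
    filter_upwards [ae_prod_radialMeasure_pos] with z hz
    rw [← ENNReal.ofReal_mul (by positivity), ← ofReal_norm]
    refine ENNReal.ofReal_le_ofReal ?_
    rw [heatIntegrand, norm_mul, norm_mul, Complex.norm_real, RCLike.norm_conj,
      Real.norm_of_nonneg (heatKernel_nonneg ℓ hx hz.1.le hz.2.le)]
  · have h1 := measurable_norm_coeFn v
    have h2 := measurable_norm_coeFn f
    exact (Measurable.mul (by fun_prop) (measurable_heatKernel_uncurry ℓ x)).aemeasurable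

lemma integrable_heatIntegrand (ℓ : ℕ) {x : ℝ} (hx : 0 < x) (v f : L2Rad) :
    Integrable (heatIntegrand ℓ x v f) (radialMeasure.prod radialMeasure) :=
  ⟨(aestronglyMeasurable_conj_mul v f).mul (Complex.continuous_ofReal.comp
    (continuous_heatKernel ℓ x)).aestronglyMeasurable,
    (lintegral_enorm_heatIntegrand_le ℓ hx v f).trans_lt ENNReal.ofReal_lt_top⟩

/-- The sesquilinear form of the heat semigroup in the sector `ℓ`. -/
noncomputable def heatForm (ℓ : ℕ) (x : ℝ) (v f : L2Rad) : ℂ :=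
  ∫ z, heatIntegrand ℓ x v f z ∂(radialMeasure.prod radialMeasure)

lemma norm_heatForm_le (ℓ : ℕ) {x : ℝ} (hx : 0 < x) (v f : L2Rad) :
    ‖heatForm ℓ x v f‖ ≤ (‖v‖ ^ 2 + ‖f‖ ^ 2) / 2 := by
  have h := (enorm_integral_le_lintegral_enorm (heatIntegrand ℓ x v f)).trans
    (lintegral_enorm_heatIntegrand_le ℓ hx v f)
  rw [← ofReal_norm, ENNReal.ofReal_le_ofReal_iff (by positivity)] at h
  exact h

/-- The form of the heat semigroup, as a continuous functional of its second argument. -/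
noncomputable def heatFunctional (ℓ : ℕ) {x : ℝ} (hx : 0 < x) (v : L2Rad) : L2Rad →L[ℂ] ℂ :=
  LinearMap.mkContinuous
    { toFun := heatForm ℓ x v
      map_add' := fun f g => by
        rw [heatForm, heatForm, heatForm, ← integral_add (integrable_heatIntegrand ℓ hx v f)
          (integrable_heatIntegrand ℓ hx v g)]
        refine integral_congr_ae ?_
        filter_upwards [Measure.quasiMeasurePreserving_snd.ae (Lp.coeFn_add f g)] with z hz
        simp only [heatIntegrand, hz, Pi.add_apply]
        ring
      map_smul' := fun c f => by
        rw [heatForm, heatForm, RingHom.id_apply, smul_eq_mul, ← integral_const_mul]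
        refine integral_congr_ae ?_
        filter_upwards [Measure.quasiMeasurePreserving_snd.ae (Lp.coeFn_smul c f)] with z hz
        simp only [heatIntegrand, hz, Pi.smul_apply, smul_eq_mul]
        ring } ((‖v‖ ^ 2 + 1) / 2 / 1) (fun f => by
      -- The bound `(‖v‖² + ‖f‖²)/2` is not homogeneous in `f`; it is used on the unit sphere and
      -- extended by linearity.
      refine LinearMap.bound_of_sphere_bound (𝕜 := ℂ) one_pos _ _ (fun g hg => ?_) f
      have h := norm_heatForm_le ℓ hx v g
      rw [mem_sphere_zero_iff_norm.1 hg, one_pow] at h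
      exact h)

lemma heatFunctional_apply (ℓ : ℕ) {x : ℝ} (hx : 0 < x) (v f : L2Rad) :
    heatFunctional ℓ hx v f = heatForm ℓ x v f := rfl

lemma integral_heatKernel_mul_gauss (ℓ : ℕ) {x : ℝ} (hx : 0 < x) {a : ℝ} (ha : 0 < a) {r : ℝ}
    (hr : 0 < r) :
    ∫ s, radialGaussFun ℓ a s * (heatKernel ℓ x r s : ℂ) ∂radialMeasure =
      (((x / (a + x)) ^ (ℓ + 3 / 2 : ℝ) : ℝ) : ℂ) * radialGaussFun ℓ (a * x / (a + x)) r := by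
  have e : ∀ s, radialGaussFun ℓ a s * (heatKernel ℓ x r s : ℂ) =
      ((heatKernel ℓ x r s * (s ^ ℓ * Real.exp (-(Real.pi * a) * s ^ 2)) : ℝ) : ℂ) := fun s => by
    rw [radialGaussFun]; push_cast; ring
  simp_rw [e]
  rw [integral_complex_ofReal, integral_eq_lintegral_of_nonneg_ae,
    lintegral_heatKernel_mul_gauss ℓ hx ha.le hr.le, ENNReal.toReal_ofReal (by positivity),
    radialGaussFun, Complex.ofReal_mul]
  · filter_upwards [ae_radialMeasure_pos] with s hs
    have := heatKernel_nonneg ℓ hx hr.le hs.le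
    positivity
  · refine Continuous.aestronglyMeasurable ?_
    refine Continuous.mul ?_ (by fun_prop)
    exact (continuous_heatKernel ℓ x).comp (f := fun s : ℝ => (r, s)) (by fun_prop)

lemma heatForm_radialGauss (ℓ : ℕ) {x : ℝ} (hx : 0 < x) {a : ℝ} (ha : 0 < a) (v : L2Rad) :
    heatForm ℓ x v (radialGauss ℓ ha) = (((x / (a + x)) ^ (ℓ + 3 / 2 : ℝ) : ℝ) : ℂ) *
      inner ℂ v (radialGauss ℓ (a := a * x / (a + x)) (by positivity)) := by
  have ha' : 0 < a * x / (a + x) := by positivity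
  rw [heatForm, integral_prod _ (integrable_heatIntegrand ℓ hx v _), L2.inner_def,
    ← integral_const_mul]
  refine integral_congr_ae ?_
  filter_upwards [ae_radialMeasure_pos, (memLp_radialGaussFun ℓ ha').coeFn_toLp] with r hr h1
  have e : ∫ s, heatIntegrand ℓ x v (radialGauss ℓ ha) (r, s) ∂radialMeasure =
      ∫ s, starRingEnd ℂ (v r) * (radialGaussFun ℓ a s * (heatKernel ℓ x r s : ℂ))
        ∂radialMeasure := by
    refine integral_congr_ae ?_
    filter_upwards [(memLp_radialGaussFun ℓ ha).coeFn_toLp] with s hs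
    simp only [heatIntegrand, radialGauss, hs]
    ring
  rw [e, integral_const_mul, integral_heatKernel_mul_gauss ℓ hx ha hr, RCLike.inner_apply,
    radialGauss, h1]
  ring

/-! ### The heat semigroup on the Fourier side -/

/-- The Fourier transform of a function in the `ℓ`-th sector. -/
noncomputable def fourierSector (ℓ : ℕ) : L2Rad →L[ℂ] L2R3 :=
  (fourierL2.toContinuousLinearEquiv : L2R3 →L[ℂ] L2R3).comp
    ⟨sector (axialHarmonic ℓ), continuous_sector _⟩

lemma fourierSector_apply (ℓ : ℕ) (u : L2Rad) :
    fourierSector ℓ u = fourierL2 (sector (axialHarmonic ℓ) u) := rfl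

lemma inner_fourierSector (ℓ : ℕ) (u v : L2Rad) :
    inner ℂ (fourierSector ℓ u) (fourierSector ℓ v) =
      ((sphereWeight (axialHarmonic ℓ)).toReal : ℂ) * inner ℂ u v := by
  rw [fourierSector_apply, fourierSector_apply, LinearIsometryEquiv.inner_map_map, inner_sector]

/-- The Fourier multiplier `e^{-π |ξ|² / x}` of the heat semigroup. -/
noncomputable def damping (x : ℝ) (ξ : R3) : ℝ := Real.exp (-(Real.pi * x⁻¹) * ‖ξ‖ ^ 2)

lemma continuous_damping (x : ℝ) : Continuous (damping x) := by
  unfold damping; fun_prop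

lemma norm_damping_le {x : ℝ} (hx : 0 < x) (ξ : R3) : ‖((damping x ξ : ℝ) : ℂ)‖ ≤ 1 := by
  rw [Complex.norm_real, damping, Real.norm_of_nonneg (Real.exp_pos _).le, Real.exp_le_one_iff]
  have : 0 ≤ Real.pi * x⁻¹ * ‖ξ‖ ^ 2 := by positivity
  linarith

lemma memLp_damping_mul {x : ℝ} (hx : 0 < x) (g : L2R3) :
    MemLp (fun ξ => (damping x ξ : ℂ) * g ξ) 2 volume := by
  refine (Lp.memLp g).of_le ((Complex.continuous_ofReal.comp
    (continuous_damping x)).aestronglyMeasurable.mul (Lp.aestronglyMeasurable g))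
    (.of_forall fun ξ => ?_)
  rw [norm_mul]
  exact mul_le_of_le_one_left (norm_nonneg _) (norm_damping_le hx ξ)

/-- On the Fourier side a Gaussian of parameter `a` has exponent `1/a`, and the multiplier adds
`1/x`; the sum is the inverse of `ax/(a+x)`. The quotient of the constants in Bochner's relation is
the same `(x/(a+x))^{ℓ+3/2}` as in `heatForm_radialGauss`. -/
lemma damping_mul_fourierSector_radialGauss (ℓ : ℕ) {x a : ℝ} (hx : 0 < x) (ha : 0 < a) :
    (fun ξ => (damping x ξ : ℂ) * fourierSector ℓ (radialGauss ℓ ha) ξ) =ᵐ[volume]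
      ⇑((((x / (a + x)) ^ (ℓ + 3 / 2 : ℝ) : ℝ) : ℂ) •
        fourierSector ℓ (radialGauss ℓ (a := a * x / (a + x)) (by positivity))) := by
  have ha' : 0 < a * x / (a + x) := by positivity
  have h := fun (b : ℝ) (hb : 0 < b) => fourierL2_sector_radialGauss (axialHarmonic_mem ℓ) hb
  have hg : ∀ (b : ℝ) (hb : 0 < b), ⇑(fourierSector ℓ (radialGauss ℓ hb)) =ᵐ[volume] fun ξ =>
      ((-Complex.I) ^ ℓ * ((b ^ (-(ℓ + 3 / 2 : ℝ)) : ℝ) : ℂ)) *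
        polyGauss (axialHarmonic ℓ) b⁻¹ ξ := fun b hb => by
    rw [fourierSector_apply, h b hb, map_smul, sector_radialGauss (axialHarmonic_mem ℓ).1]
    refine (Lp.coeFn_smul _ _).trans ?_
    filter_upwards [(memLp_two_polyGauss (axialHarmonic ℓ) (inv_pos.2 hb)).coeFn_toLp] with ξ hξ
    rw [Pi.smul_apply, hξ, smul_eq_mul]
  filter_upwards [hg a ha, hg _ ha', Lp.coeFn_smul (((x / (a + x)) ^ (ℓ + 3 / 2 : ℝ) : ℝ) : ℂ)
    (fourierSector ℓ (radialGauss ℓ ha'))] with ξ h1 h2 h3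
  rw [h3, Pi.smul_apply, h1, h2, smul_eq_mul, polyGauss, polyGauss, damping]
  have e1 : Real.exp (-(Real.pi * (a * x / (a + x))⁻¹) * ‖ξ‖ ^ 2) =
      Real.exp (-(Real.pi * x⁻¹) * ‖ξ‖ ^ 2) * Real.exp (-(Real.pi * a⁻¹) * ‖ξ‖ ^ 2) := by
    rw [← Real.exp_add]
    congr 1
    field_simp
    ring
  have e2 : a ^ (-(ℓ + 3 / 2 : ℝ)) =
      (x / (a + x)) ^ (ℓ + 3 / 2 : ℝ) * (a * x / (a + x)) ^ (-(ℓ + 3 / 2 : ℝ)) := by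
    rw [mul_div_assoc, Real.mul_rpow ha.le (by positivity), Real.rpow_neg (by positivity),
      Real.rpow_neg (by positivity)]
    have : (x / (a + x)) ^ (ℓ + 3 / 2 : ℝ) ≠ 0 := (Real.rpow_pos_of_pos (by positivity) _).ne'
    field_simp
  rw [e1, e2]
  push_cast
  ring

/-- The form of the heat semigroup in the sector `ℓ` is given by the kernel `heatKernel`. -/
lemma integral_damping_fourierSector (ℓ : ℕ) {x : ℝ} (hx : 0 < x) (v f : L2Rad) :
    ∫ ξ, starRingEnd ℂ (fourierSector ℓ v ξ) * fourierSector ℓ f ξ * (damping x ξ : ℂ) =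
      ((sphereWeight (axialHarmonic ℓ)).toReal : ℂ) * heatForm ℓ x v f := by
  set g : L2R3 := (memLp_damping_mul hx (fourierSector ℓ v)).toLp with hg
  have hgi : ∀ f, ∫ ξ, starRingEnd ℂ (fourierSector ℓ v ξ) * fourierSector ℓ f ξ *
      (damping x ξ : ℂ) = inner ℂ g (fourierSector ℓ f) := fun f => by
    rw [L2.inner_def]
    refine integral_congr_ae ?_
    filter_upwards [(memLp_damping_mul hx (fourierSector ℓ v)).coeFn_toLp] with ξ hξ
    rw [hg, hξ, RCLike.inner_apply, map_mul, Complex.conj_ofReal]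
    ring
  -- Both sides are continuous linear functionals of `f`. The kernel of their difference is closed
  -- and contains the radial Gaussians, hence is everything.
  set A : L2Rad →L[ℂ] ℂ := (innerSL ℂ g).comp (fourierSector ℓ) -
    ((sphereWeight (axialHarmonic ℓ)).toReal : ℂ) • heatFunctional ℓ hx v with hA
  have htop := eq_top_of_radialGauss_mem ℓ A.ker A.isClosed_ker fun a ha => by
    change A _ = 0
    simp only [hA, sub_apply, ContinuousLinearMap.comp_apply,
      smul_apply, innerSL_apply_apply, heatFunctional_apply]
    rw [heatForm_radialGauss ℓ hx ha, sub_eq_zero, smul_eq_mul, ← hgi, mul_left_comm,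
      ← inner_fourierSector, ← inner_smul_right, L2.inner_def]
    refine integral_congr_ae ?_
    filter_upwards [damping_mul_fourierSector_radialGauss ℓ hx ha] with ξ hξ
    rw [← hξ, RCLike.inner_apply]
    ring
  have hf : f ∈ A.ker := by rw [htop]; trivial
  rw [hgi]
  exact sub_eq_zero.1 hf

/-! ### Subordination -/

/-- The integrand of the subordination formula for the square root. -/
noncomputable def subordinator (lam x : ℝ) : ℝ := (1 - Real.exp (-lam / x)) * (√x)⁻¹

lemma measurable_subordinator : Measurable (Function.uncurry subordinator) := by
  unfold subordinator Function.uncurry; fun_prop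

lemma subordinator_nonneg {lam x : ℝ} (hl : 0 ≤ lam) (hx : 0 < x) : 0 ≤ subordinator lam x := by
  have : Real.exp (-lam / x) ≤ 1 := Real.exp_le_one_iff.2 (by
    rw [neg_div]; exact neg_nonpos.2 (by positivity))
  unfold subordinator
  exact mul_nonneg (by linarith) (by positivity)

/-- The constant of the subordination formula. -/
noncomputable def subordConst : ℝ := ∫ x in Ioi 0, subordinator 1 x

/-- Near `0` the integrand is at most `x^{-1/2}`; at infinity `1 - e^{-1/x} ≤ 1/x` gives `x^{-3/2}`.
-/
lemma integrableOn_subordinator_one : IntegrableOn (subordinator 1) (Ioi 0) := by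
  rw [← Ioc_union_Ioi_eq_Ioi (zero_le_one (α := ℝ))]
  have hm : Measurable (subordinator 1) := measurable_subordinator.of_uncurry_left
  refine IntegrableOn.union ?_ ?_
  · have h := (intervalIntegral.intervalIntegrable_rpow' (a := 0) (b := 1)
      (r := -(1 / 2)) (by norm_num)).1
    refine Integrable.mono' h hm.aestronglyMeasurable ?_
    filter_upwards [ae_restrict_mem measurableSet_Ioc] with x hx
    rw [Real.norm_of_nonneg (subordinator_nonneg zero_le_one hx.1), subordinator,
      Real.rpow_neg hx.1.le, ← Real.sqrt_eq_rpow]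
    refine mul_le_of_le_one_left (by positivity) ?_
    linarith [Real.exp_pos (-1 / x)]
  · have h := integrableOn_Ioi_rpow_of_lt (a := -(3 / 2)) (by norm_num) (zero_lt_one (α := ℝ))
    refine Integrable.mono' h hm.aestronglyMeasurable ?_
    filter_upwards [ae_restrict_mem measurableSet_Ioi] with x hx
    have hx0 : (0 : ℝ) < x := zero_lt_one.trans hx
    rw [Real.norm_of_nonneg (subordinator_nonneg zero_le_one hx0), subordinator]
    have h1 := Real.add_one_le_exp (-1 / x)
    have h2 : x ^ (-(3 / 2) : ℝ) = x⁻¹ * (√x)⁻¹ := by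
      rw [show (-(3 / 2) : ℝ) = -1 + -(1 / 2) by norm_num, Real.rpow_add hx0, Real.rpow_neg_one,
        Real.rpow_neg hx0.le, ← Real.sqrt_eq_rpow]
    rw [h2]
    gcongr
    rw [neg_div, one_div] at h1
    rw [neg_div, one_div]
    linarith

/-- Only the sign of the constant matters, since it is divided out at the end. -/
lemma subordConst_pos : 0 < subordConst := by
  rw [subordConst, setIntegral_pos_iff_support_of_nonneg_ae _ integrableOn_subordinator_one]
  · have : Function.support (subordinator 1) ∩ Ioi 0 = Ioi 0 := by
      refine inter_eq_right.2 fun x hx => ?_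
      have hx0 : (0 : ℝ) < x := hx
      have : Real.exp (-1 / x) < 1 := Real.exp_lt_one_iff.2 (by
        rw [neg_div]; exact neg_neg_iff_pos.2 (by positivity))
      have h2 : 0 < subordinator 1 x := mul_pos (by linarith) (by positivity)
      exact h2.ne'
    rw [this]; simp
  · filter_upwards [ae_restrict_mem measurableSet_Ioi] with x hx
    exact subordinator_nonneg zero_le_one hx

lemma subordinator_eq {lam x : ℝ} (hl : 0 < lam) :
    subordinator lam x = (√lam)⁻¹ * subordinator 1 (lam⁻¹ * x) := by
  have h : √(lam⁻¹ * x) = (√lam)⁻¹ * √x := by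
    rw [Real.sqrt_mul (by positivity), Real.sqrt_inv]
  have h2 : -1 / (lam⁻¹ * x) = -lam / x := by
    rcases eq_or_ne x 0 with rfl | hx
    · simp
    · field_simp
  rw [subordinator, subordinator, h, h2, mul_inv, inv_inv]
  have : √lam ≠ 0 := (Real.sqrt_pos.2 hl).ne'
  field_simp

lemma integrableOn_subordinator {lam : ℝ} (hl : 0 ≤ lam) :
    IntegrableOn (subordinator lam) (Ioi 0) := by
  rcases hl.eq_or_lt with rfl | hl
  · have : subordinator 0 = fun _ => 0 := by ext x; simp [subordinator]
    rw [this]; exact integrableOn_zero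
  · have h := (integrableOn_Ioi_comp_mul_left_iff (subordinator 1) 0 (inv_pos.2 hl)).2
      (by rw [mul_zero]; exact integrableOn_subordinator_one)
    refine (h.const_mul (√lam)⁻¹).congr (.of_forall fun x => (subordinator_eq hl).symm)

lemma integral_subordinator {lam : ℝ} (hl : 0 ≤ lam) :
    ∫ x in Ioi 0, subordinator lam x = subordConst * √lam := by
  rcases hl.eq_or_lt with rfl | hl
  · simp [subordinator]
  · simp_rw [subordinator_eq hl]
    rw [integral_const_mul, integral_comp_mul_left_Ioi (subordinator 1) 0 (inv_pos.2 hl), mul_zero,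
      inv_inv, smul_eq_mul, ← subordConst]
    have h := Real.mul_self_sqrt hl.le
    have : √lam ≠ 0 := (Real.sqrt_pos.2 hl).ne'
    field_simp
    rw [Real.sq_sqrt hl.le]

/-- The contribution of the mass to the heat semigroup. -/
noncomputable def massDamping (m x : ℝ) : ℝ := Real.exp (-(m ^ 2 / (4 * Real.pi)) / x)

/-- The only bound on the mass in the estimates: the final constant is uniform in `m` because of it.
-/
lemma massDamping_le_one (m : ℝ) {x : ℝ} (hx : 0 < x) : massDamping m x ≤ 1 := by
  have := Real.pi_pos
  refine Real.exp_le_one_iff.2 ?_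
  rw [neg_div]
  exact neg_nonpos.2 (by positivity)

/-- Dividing the squared symbol by `4π` splits the exponential into a mass factor and exactly the
Gaussian multiplier whose kernel is known. -/
lemma subordinator_symbol (m x : ℝ) (ξ : R3) :
    subordinator (m ^ 2 / (4 * Real.pi) + Real.pi * ‖ξ‖ ^ 2) x =
      (√x)⁻¹ * (1 - massDamping m x * damping x ξ) := by
  rw [subordinator, massDamping, damping, ← Real.exp_add, mul_comm]
  congr 3
  ring

lemma sqrt_symbol (m : ℝ) (ξ : R3) :
    √(m ^ 2 / (4 * Real.pi) + Real.pi * ‖ξ‖ ^ 2) = (2 * √Real.pi)⁻¹ * dispersion m ‖ξ‖ := by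
  have hpi := Real.pi_pos
  have h : m ^ 2 / (4 * Real.pi) + Real.pi * ‖ξ‖ ^ 2 =
      ((2 * √Real.pi)⁻¹) ^ 2 * (m ^ 2 + (2 * Real.pi * ‖ξ‖) ^ 2) := by
    rw [inv_pow, mul_pow, Real.sq_sqrt hpi.le]
    field_simp
    ring
  rw [h, Real.sqrt_mul (by positivity), Real.sqrt_sq (by positivity), dispersion]

/-- The form of `K_ℓ` is a superposition of the forms of the heat semigroup. -/
lemma subordination_kineticGraph {m : ℝ} {ℓ : ℕ} {f w : L2Rad} (h : (f, w) ∈ kineticGraph m ℓ)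
    (v : L2Rad) :
    IntegrableOn (fun x : ℝ => (((√x)⁻¹ : ℝ) : ℂ) *
      (inner ℂ v f - (massDamping m x : ℂ) * heatForm ℓ x v f)) (Ioi 0) ∧
    ∫ x in Ioi 0, (((√x)⁻¹ : ℝ) : ℂ) * (inner ℂ v f - (massDamping m x : ℂ) * heatForm ℓ x v f) =
      ((subordConst * (2 * √Real.pi)⁻¹ : ℝ) : ℂ) * inner ℂ v w := by
  have hgr : ⇑(fourierSector ℓ w) =ᵐ[volume] fun ξ => (dispersion m ‖ξ‖ : ℂ) * fourierSector ℓ f ξ :=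
    mem_graph_sqrtOp.1 (mem_kineticGraph.1 h _ (axialHarmonic_mem ℓ))
  set c := (sphereWeight (axialHarmonic ℓ)).toReal with hc
  have hc0 : (c : ℂ) ≠ 0 := by exact_mod_cast (sphereWeight_axialHarmonic_pos ℓ).ne'
  set V := fourierSector ℓ v
  set F := fourierSector ℓ f
  set lam : R3 → ℝ := fun ξ => m ^ 2 / (4 * Real.pi) + Real.pi * ‖ξ‖ ^ 2 with hlam
  have hlam0 : ∀ ξ, 0 ≤ lam ξ := fun ξ => by have := Real.pi_pos; positivity
  set G : R3 × ℝ → ℂ := fun z =>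
    (starRingEnd ℂ (V z.1) * F z.1) * (subordinator (lam z.1) z.2 : ℂ) with hG
  have hVF : StronglyMeasurable fun ξ => starRingEnd ℂ (V ξ) * F ξ :=
    (Complex.continuous_conj.comp_stronglyMeasurable (Lp.stronglyMeasurable V)).mul
      (Lp.stronglyMeasurable F)
  have hsubm : Measurable fun z : R3 × ℝ => subordinator (lam z.1) z.2 :=
    measurable_subordinator.comp (f := fun z : R3 × ℝ => (lam z.1, z.2)) (by fun_prop)
  have hGm : AEStronglyMeasurable G (volume.prod (volume.restrict (Ioi 0))) := by
    refine AEStronglyMeasurable.mul ?_ (Complex.measurable_ofReal.comp hsubm).aestronglyMeasurable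
    exact (hVF.comp_measurable measurable_fst).aestronglyMeasurable
  have hdisp : ∀ᵐ ξ, (starRingEnd ℂ (V ξ) * F ξ) * ((subordConst * √(lam ξ) : ℝ) : ℂ) =
      ((subordConst * (2 * √Real.pi)⁻¹ : ℝ) : ℂ) *
        (starRingEnd ℂ (V ξ) * fourierSector ℓ w ξ) := by
    filter_upwards [hgr] with ξ hξ
    rw [hξ, hlam]
    simp only [sqrt_symbol]
    push_cast
    ring
  have hVW : Integrable fun ξ => starRingEnd ℂ (V ξ) * fourierSector ℓ w ξ := by
    have := L2.integrable_inner (𝕜 := ℂ) V (fourierSector ℓ w)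
    refine this.congr (.of_forall fun ξ => ?_)
    simp only [RCLike.inner_apply]
    ring
  have hVFi : Integrable fun ξ => starRingEnd ℂ (V ξ) * F ξ := by
    have := L2.integrable_inner (𝕜 := ℂ) V F
    refine this.congr (.of_forall fun ξ => ?_)
    simp only [RCLike.inner_apply]
    ring
  -- Absolute integrability for Fubini: as the subordinator is nonnegative, integrating in `x` first
  -- leaves a multiple of `|V| √λ |F|`, which is integrable because `√λ F` is a multiple of the
  -- transform of `w`.
  have hGi : Integrable G (volume.prod (volume.restrict (Ioi 0))) := by
    rw [integrable_prod_iff hGm]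
    refine ⟨.of_forall fun ξ => (Integrable.ofReal (𝕜 := ℂ)
      (integrableOn_subordinator (hlam0 ξ))).const_mul (starRingEnd ℂ (V ξ) * F ξ), ?_⟩
    have e : ∀ ξ, ∫ x in Ioi 0, ‖G (ξ, x)‖ =
        ‖(starRingEnd ℂ (V ξ) * F ξ) * ((subordConst * √(lam ξ) : ℝ) : ℂ)‖ := fun ξ => by
      rw [norm_mul, Complex.norm_real, Real.norm_of_nonneg
        (mul_nonneg subordConst_pos.le (Real.sqrt_nonneg _)), ← integral_subordinator (hlam0 ξ),
        ← integral_const_mul]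
      refine setIntegral_congr_fun measurableSet_Ioi fun x hx => ?_
      simp only [hG]
      rw [norm_mul, Complex.norm_real, Real.norm_of_nonneg (subordinator_nonneg (hlam0 ξ) hx)]
    simp_rw [e]
    refine Integrable.norm ?_
    exact (hVW.const_mul _).congr (hdisp.mono fun ξ hξ => hξ.symm)
  have hinner : ∀ x ∈ Ioi (0 : ℝ), ∫ ξ, G (ξ, x) = (c : ℂ) * ((((√x)⁻¹ : ℝ) : ℂ) *
      (inner ℂ v f - (massDamping m x : ℂ) * heatForm ℓ x v f)) := by
    intro x hx
    have e : ∀ ξ, G (ξ, x) = (((√x)⁻¹ : ℝ) : ℂ) * (starRingEnd ℂ (V ξ) * F ξ -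
        (massDamping m x : ℂ) * (starRingEnd ℂ (V ξ) * F ξ * (damping x ξ : ℂ))) := fun ξ => by
      simp only [hG, hlam, subordinator_symbol]
      push_cast
      ring
    have hdi : Integrable fun ξ => starRingEnd ℂ (V ξ) * F ξ * (damping x ξ : ℂ) := by
      refine hVFi.mul_bdd (c := 1) (Complex.continuous_ofReal.comp
        (continuous_damping x)).aestronglyMeasurable (.of_forall fun ξ => norm_damping_le hx ξ)
    simp_rw [e]
    rw [integral_const_mul, integral_sub hVFi (hdi.const_mul _), integral_const_mul,
      integral_damping_fourierSector ℓ hx]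
    have e2 : ∫ ξ, starRingEnd ℂ (V ξ) * F ξ = (c : ℂ) * inner ℂ v f := by
      rw [hc, ← inner_fourierSector, L2.inner_def]
      refine integral_congr_ae (.of_forall fun ξ => ?_)
      simp only [RCLike.inner_apply]
      ring
    rw [e2]
    ring
  have hint := hGi.integral_prod_right
  have hcong : (fun x => ∫ ξ, G (ξ, x)) =ᵐ[volume.restrict (Ioi 0)] fun x => (c : ℂ) *
      ((((√x)⁻¹ : ℝ) : ℂ) * (inner ℂ v f - (massDamping m x : ℂ) * heatForm ℓ x v f)) := by
    filter_upwards [ae_restrict_mem measurableSet_Ioi] with x hx using hinner x hx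
  constructor
  · have h1 := (hint.congr hcong).const_mul ((c : ℂ)⁻¹)
    refine h1.congr (.of_forall fun x => ?_)
    simp only
    rw [← mul_assoc, inv_mul_cancel₀ hc0, one_mul]
  · refine mul_left_cancel₀ hc0 ?_
    rw [← integral_const_mul, ← integral_congr_ae hcong,
      ← integral_integral_swap (f := fun ξ x => G (ξ, x)) hGi, mul_left_comm,
      ← inner_fourierSector, L2.inner_def, ← integral_const_mul]
    refine integral_congr_ae ?_
    filter_upwards [hdisp] with ξ hξ
    have : ∫ x in Ioi 0, G (ξ, x) =
        (starRingEnd ℂ (V ξ) * F ξ) * ((subordConst * √(lam ξ) : ℝ) : ℂ) := by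
      simp only [hG]
      rw [integral_const_mul, integral_complex_ofReal, integral_subordinator (hlam0 ξ)]
    rw [this, hξ, RCLike.inner_apply, mul_comm (fourierSector ℓ w ξ)]

/-! ### The kernel of the difference and its Schur bound -/

lemma chordSq_pos {r s τ : ℝ} (hr : 0 < r) (hs : 0 < s) (hτ : τ < 1) : 0 < chordSq r s τ := by
  unfold chordSq
  nlinarith [sq_nonneg (r - s), mul_pos (mul_pos hr hs) (sub_pos.2 hτ)]

lemma chordSq_comm (r s τ : ℝ) : chordSq r s τ = chordSq s r τ := by
  unfold chordSq; ring

/-- The kernel `∫ (1 - τ) / (r² + s² - 2 r s τ)² dτ`, which controls the differences `K_ℓ - K_ℓ'`. -/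
noncomputable def logKernel (r s : ℝ) : ℝ≥0∞ :=
  ∫⁻ τ in Ioo (-1) 1, ENNReal.ofReal ((1 - τ) / chordSq r s τ ^ 2)

lemma measurable_logKernel : Measurable (Function.uncurry logKernel) := by
  have : Measurable fun p : (ℝ × ℝ) × ℝ =>
      ENNReal.ofReal ((1 - p.2) / chordSq p.1.1 p.1.2 p.2 ^ 2) := by
    unfold chordSq; fun_prop
  exact this.lintegral_prod_right'

lemma logKernel_comm (r s : ℝ) : logKernel r s = logKernel s r := by
  unfold logKernel; simp_rw [chordSq_comm r s]

/-- The difference of consecutive heat kernels, integrated over the semigroup parameter. -/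
lemma lintegral_heatKernel_sub_succ_le (n : ℕ) {r s : ℝ} (hr : 0 < r) (hs : 0 < s) :
    ∫⁻ x in Ioi 0, ENNReal.ofReal ((√x)⁻¹ * (heatKernel n x r s - heatKernel (n + 1) x r s)) ≤
      ENNReal.ofReal (2 / Real.pi * (n + 1)) * logKernel r s := by
  have hpi := Real.pi_pos
  set B : ℝ → ℝ := fun τ => 2 * Real.pi * ((Real.pi * r * s) ^ n / n.factorial) *
    ((1 - τ) * (1 - τ ^ 2) ^ n) with hB
  have hB0 : ∀ τ ∈ Ioo (-1 : ℝ) 1, 0 ≤ B τ := fun τ hτ => by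
    have h1 := one_sub_sq_nonneg (Ioo_subset_Icc_self hτ)
    have h2 : 0 ≤ 1 - τ := by linarith [hτ.2]
    positivity
  have e1 : ∀ x ∈ Ioi (0 : ℝ), ENNReal.ofReal
      ((√x)⁻¹ * (heatKernel n x r s - heatKernel (n + 1) x r s)) =
      ∫⁻ τ in Ioo (-1) 1, ENNReal.ofReal
        (B τ * (x ^ (n + 1) * Real.exp (-(Real.pi * chordSq r s τ) * x))) := by
    intro x hx
    have hx0 : (0 : ℝ) < x := hx
    have h32 : x ^ (3 / 2 : ℝ) = x * √x := by
      rw [show (3 / 2 : ℝ) = 1 + 1 / 2 by norm_num, Real.rpow_add hx0, Real.rpow_one,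
        ← Real.sqrt_eq_rpow]
    rw [heatKernel_sub_succ, ← mul_assoc, ← intervalIntegral.integral_const_mul,
      ofReal_intervalIntegral]
    · refine lintegral_congr fun τ => ?_
      congr 1
      have : √x ≠ 0 := (Real.sqrt_pos.2 hx0).ne'
      rw [hB, h32, show Real.pi * x * r * s = x * (Real.pi * r * s) by ring, mul_pow x,
        show -(Real.pi * chordSq r s τ) * x = -(Real.pi * x) * chordSq r s τ by ring]
      field_simp
      ring
    · unfold chordSq; fun_prop
    · intro τ hτ
      have h1 := one_sub_sq_nonneg hτ
      have h2 : 0 ≤ 1 - τ := by linarith [hτ.2]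
      positivity
  rw [setLIntegral_congr_fun measurableSet_Ioi e1, lintegral_lintegral_swap, logKernel,
    ← lintegral_const_mul' _ _ ENNReal.ofReal_ne_top]
  · refine setLIntegral_mono' measurableSet_Ioo fun τ hτ => ?_
    have hq := chordSq_pos hr hs hτ.2
    have h1 := one_sub_sq_nonneg (Ioo_subset_Icc_self hτ)
    have h2 : 0 < 1 - τ := by linarith [hτ.2]
    simp_rw [ENNReal.ofReal_mul (hB0 τ hτ)]
    rw [lintegral_const_mul' _ _ ENNReal.ofReal_ne_top,
      lintegral_pow_mul_exp_neg (n + 1) (b := Real.pi * chordSq r s τ) (by positivity),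
      ← ENNReal.ofReal_mul (hB0 τ hτ), ← ENNReal.ofReal_mul (by positivity)]
    refine ENNReal.ofReal_le_ofReal ?_
    -- From `1 + τ ≤ 2` and `(r-s)² ≥ 0`: `rs(1-τ²) ≤ 2rs(1-τ) ≤ chordSq`. The `n`-th power of this
    -- ratio is then discarded.
    have h3 : r * s * (1 - τ ^ 2) / chordSq r s τ ≤ 1 := by
      rw [div_le_one hq]
      unfold chordSq
      have h4 : r * s * (1 - τ ^ 2) ≤ 2 * (r * s * (1 - τ)) := by
        have : r * s * (1 - τ ^ 2) = (1 + τ) * (r * s * (1 - τ)) := by ring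
        rw [this]
        have : 0 ≤ r * s * (1 - τ) := by positivity
        have : 1 + τ ≤ 2 := by linarith [hτ.2]
        gcongr
      nlinarith [sq_nonneg (r - s)]
    have h5 : (r * s * (1 - τ ^ 2) / chordSq r s τ) ^ n ≤ 1 := pow_le_one₀ (by positivity) h3
    have h6 : B τ * ((n + 1).factorial / (Real.pi * chordSq r s τ) ^ (n + 1 + 1)) =
        2 / Real.pi * (n + 1) * ((1 - τ) / chordSq r s τ ^ 2) *
          (r * s * (1 - τ ^ 2) / chordSq r s τ) ^ n := by
      have hf : (n.factorial : ℝ) ≠ 0 := by exact_mod_cast n.factorial_ne_zero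
      rw [hB, Nat.factorial_succ, div_pow, mul_pow (r * s), mul_assoc Real.pi r s,
        mul_pow Real.pi, mul_pow Real.pi]
      push_cast
      field_simp
      ring
    rw [h6]
    refine mul_le_of_le_one_right (by positivity) h5
  · refine Measurable.aemeasurable ?_
    rw [hB]; unfold chordSq Function.uncurry; fun_prop

lemma lintegral_inv_sq_add {D : ℝ} (hD : 0 < D) (y : ℝ) :
    ∫⁻ s, ENNReal.ofReal (1 / ((s - y) ^ 2 + D)) = ENNReal.ofReal (Real.pi / √D) := by
  rw [lintegral_sub_right_eq_self (fun s => ENNReal.ofReal (1 / (s ^ 2 + D)))]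
  have hD' := Real.sqrt_pos.2 hD
  have e : ∀ s : ℝ, 1 / (s ^ 2 + D) = D⁻¹ * (1 + ((√D)⁻¹ * s) ^ 2)⁻¹ := fun s => by
    rw [mul_pow, inv_pow, Real.sq_sqrt hD.le]
    field_simp
    ring
  have hi : Integrable fun s : ℝ => (1 + ((√D)⁻¹ * s) ^ 2)⁻¹ :=
    integrable_inv_one_add_sq.comp_mul_left' (inv_pos.2 hD').ne'
  simp_rw [e]
  rw [← ofReal_integral_eq_lintegral_ofReal (hi.const_mul _) (.of_forall fun s => by positivity),
    integral_const_mul, Measure.integral_comp_mul_left (fun s => (1 + s ^ 2)⁻¹),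
    integral_univ_inv_one_add_sq, inv_inv, abs_of_pos hD', smul_eq_mul]
  congr 1
  field_simp
  rw [Real.sq_sqrt hD.le]

lemma lintegral_inv_sqrt_one_sub :
    ∫⁻ τ in Ioo (-1) 1, ENNReal.ofReal ((√(1 - τ))⁻¹) = ENNReal.ofReal (2 * √2) := by
  have h0 : ∀ y : ℝ, 0 ≤ y → y ^ (-(1 / 2) : ℝ) = (√y)⁻¹ := fun y hy => by
    rw [Real.rpow_neg hy, ← Real.sqrt_eq_rpow]
  have hI : IntervalIntegrable (fun τ : ℝ => (1 - τ) ^ (-(1 / 2) : ℝ)) volume (-1) 1 := by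
    have := (intervalIntegral.intervalIntegrable_rpow' (a := 2) (b := 0)
      (r := -(1 / 2)) (by norm_num)).comp_sub_left 1
    convert this using 1 <;> norm_num
  have h1 : ∫ τ in (-1 : ℝ)..1, (1 - τ) ^ (-(1 / 2) : ℝ) = 2 * √2 := by
    rw [intervalIntegral.integral_comp_sub_left (fun y => y ^ (-(1 / 2) : ℝ)) 1,
      integral_rpow (Or.inl (by norm_num))]
    rw [Real.sqrt_eq_rpow]
    norm_num
    ring
  rw [← h1, intervalIntegral.integral_of_le (by norm_num), integral_Ioc_eq_integral_Ioo,
    ofReal_integral_eq_lintegral_ofReal]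
  · refine setLIntegral_congr_fun measurableSet_Ioo fun τ hτ => ?_
    rw [h0 _ (by linarith [hτ.2])]
  · exact hI.1.mono_set Ioo_subset_Ioc_self
  · filter_upwards [ae_restrict_mem measurableSet_Ioo] with τ hτ
    exact Real.rpow_nonneg (by linarith [hτ.2]) _

/-- The factor `r² + s²` dominates both `s²` and `rs`, so this one bound serves the two halves of
the Schur test. For fixed `τ` the integrand is at most `10/((s-y)² + D)` with `D = r²(1-τ)/2`; its
integral in `s` is of order `(1-τ)^{-1/2}/r`, which is integrable in `τ`. -/
lemma lintegral_sq_add_sq_mul_logKernel_le {r : ℝ} (hr : 0 < r) :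
    ∫⁻ s in Ioi 0, ENNReal.ofReal (r ^ 2 + s ^ 2) * logKernel r s ≤
      ENNReal.ofReal (40 * Real.pi / r) := by
  have hpi := Real.pi_pos
  have e1 : ∀ s, ENNReal.ofReal (r ^ 2 + s ^ 2) * logKernel r s =
      ∫⁻ τ in Ioo (-1) 1, ENNReal.ofReal ((r ^ 2 + s ^ 2) * ((1 - τ) / chordSq r s τ ^ 2)) := by
    intro s
    rw [logKernel, ← lintegral_const_mul' _ _ ENNReal.ofReal_ne_top]
    simp_rw [← ENNReal.ofReal_mul (show (0 : ℝ) ≤ r ^ 2 + s ^ 2 by positivity)]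
  simp_rw [e1]
  rw [lintegral_lintegral_swap]
  swap
  · refine Measurable.aemeasurable ?_
    unfold chordSq Function.uncurry; fun_prop
  have e2 : ∀ τ ∈ Ioo (-1 : ℝ) 1, ∫⁻ s in Ioi 0, ENNReal.ofReal
      ((r ^ 2 + s ^ 2) * ((1 - τ) / chordSq r s τ ^ 2)) ≤
      ENNReal.ofReal (10 * Real.pi * √2 / r) * ENNReal.ofReal ((√(1 - τ))⁻¹) := by
    intro τ hτ
    have ht : 0 < 1 - τ := by linarith [hτ.2]
    set D := r ^ 2 * (1 - τ) / 2 with hD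
    have hD0 : 0 < D := by positivity
    set y := r * max τ 0 with hy
    have hpt : ∀ s ∈ Ioi (0 : ℝ), ENNReal.ofReal
        ((r ^ 2 + s ^ 2) * ((1 - τ) / chordSq r s τ ^ 2)) ≤
        ENNReal.ofReal 10 * ENNReal.ofReal (1 / ((s - y) ^ 2 + D)) := by
      intro s hs
      have hs0 : (0 : ℝ) < s := hs
      rw [← ENNReal.ofReal_mul (by norm_num)]
      refine ENNReal.ofReal_le_ofReal ?_
      have hM : 0 < (s - y) ^ 2 + D := by positivity
      -- One has `chordSq = (s - rτ)² + r²(1-τ²)`. For `τ ≥ 0`, `1 + τ ≥ 1/2` gives the claim; for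
      -- `τ ≤ 0`, `chordSq ≥ s² + r²` and `1 - τ ≤ 2` suffice, with `y = 0`.
      have hq : (s - y) ^ 2 + D ≤ chordSq r s τ := by
        rw [hy, hD, chordSq]
        rcases le_total τ 0 with h | h
        · rw [max_eq_right h]
          have h1 : 0 ≤ r * s * (-τ) := mul_nonneg (by positivity) (by linarith)
          nlinarith [hτ.1, sq_nonneg r, mul_nonneg (sq_nonneg r) (by linarith [hτ.1] : 0 ≤ 1 + τ)]
        · rw [max_eq_left h]
          nlinarith [mul_nonneg (sq_nonneg r) (mul_nonneg ht.le (by linarith : 0 ≤ 1 + 2 * τ))]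
      have hnum : (r ^ 2 + s ^ 2) * (1 - τ) ≤ 10 * ((s - y) ^ 2 + D) := by
        have hmax : max τ 0 ≤ 1 := max_le hτ.2.le zero_le_one
        have hmax0 : 0 ≤ max τ 0 := le_max_right _ _
        have hy2 : y ^ 2 ≤ r ^ 2 := by
          rw [hy, mul_pow]
          exact mul_le_of_le_one_right (sq_nonneg r) (pow_le_one₀ hmax0 hmax)
        have h1 : r ^ 2 + s ^ 2 ≤ 2 * (s - y) ^ 2 + 3 * r ^ 2 := by
          nlinarith [sq_nonneg (s - 2 * y)]
        calc (r ^ 2 + s ^ 2) * (1 - τ) ≤ (2 * (s - y) ^ 2 + 3 * r ^ 2) * (1 - τ) := by gcongr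
          _ = 2 * (1 - τ) * (s - y) ^ 2 + 6 * D := by rw [hD]; ring
          _ ≤ 10 * (s - y) ^ 2 + 10 * D := by
            gcongr
            · linarith [hτ.1]
            · norm_num
          _ = _ := by ring
      have hq0 : 0 < chordSq r s τ := hM.trans_le hq
      rw [mul_div_assoc', mul_one_div, div_le_div_iff₀ (by positivity) hM]
      calc (r ^ 2 + s ^ 2) * (1 - τ) * ((s - y) ^ 2 + D)
          ≤ 10 * ((s - y) ^ 2 + D) * ((s - y) ^ 2 + D) := by gcongr
        _ = 10 * ((s - y) ^ 2 + D) ^ 2 := by ring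
        _ ≤ 10 * chordSq r s τ ^ 2 := by gcongr
    refine (setLIntegral_mono' measurableSet_Ioi hpt).trans ?_
    refine (setLIntegral_le_lintegral _ _).trans ?_
    rw [lintegral_const_mul' _ _ ENNReal.ofReal_ne_top, lintegral_inv_sq_add hD0,
      ← ENNReal.ofReal_mul (by norm_num), ← ENNReal.ofReal_mul (by positivity)]
    refine le_of_eq ?_
    congr 1
    have h1 : √D = r * √(1 - τ) / √2 := by
      rw [hD, Real.sqrt_div (by positivity), Real.sqrt_mul (by positivity), Real.sqrt_sq hr.le]
    have h2 : √(1 - τ) ≠ 0 := (Real.sqrt_pos.2 ht).ne'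
    rw [h1]
    field_simp
  refine (setLIntegral_mono' measurableSet_Ioo e2).trans ?_
  rw [lintegral_const_mul' _ _ ENNReal.ofReal_ne_top, lintegral_inv_sqrt_one_sub,
    ← ENNReal.ofReal_mul (by positivity)]
  refine le_of_eq ?_
  congr 1
  have : √2 * √2 = (2 : ℝ) := Real.mul_self_sqrt (by norm_num)
  field_simp
  nlinarith [this]

/-- The operator with kernel `logKernel r s * s` is bounded on `L²([0, ∞), r² dr)`. -/
lemma lintegral_logKernel_le (v u : L2Rad) :
    ∫⁻ r, ∫⁻ s, ENNReal.ofReal (‖v r‖ * ‖u s‖) * (ENNReal.ofReal s * logKernel r s)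
      ∂radialMeasure ∂radialMeasure ≤
      ENNReal.ofReal (40 * Real.pi * ((‖v‖ ^ 2 + ‖u‖ ^ 2) / 2)) := by
  have hK : Measurable (Function.uncurry fun r s => ENNReal.ofReal s * logKernel r s) :=
    Measurable.mul (by fun_prop) measurable_logKernel
  have hA : ∀ r : ℝ, ENNReal.ofReal (40 * Real.pi / r) =
      ENNReal.ofReal (40 * Real.pi) * ENNReal.ofReal r⁻¹ := fun r => by
    rw [← ENNReal.ofReal_mul (by positivity), div_eq_mul_inv]
  -- With the weight `1/r` and the measure, the integrands carry `s²·s·s⁻¹ = s²` in one variable and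
  -- `r²·s·r⁻¹ = rs` in the other.
  refine lintegral_schur_Lp_le hK (p := fun r => r⁻¹) measurable_inv
    (fun r hr => inv_pos.2 hr) (by positivity) (fun r hr => ?_) (fun s hs => ?_) v u
  · rw [lintegral_radialMeasure, ← hA]
    refine le_trans (setLIntegral_mono' measurableSet_Ioi fun s hs => ?_)
      (lintegral_sq_add_sq_mul_logKernel_le hr)
    have hs0 : (0 : ℝ) < s := hs
    have e : ENNReal.ofReal (s ^ 2) * (ENNReal.ofReal s * logKernel r s * ENNReal.ofReal s⁻¹) =
        ENNReal.ofReal (s ^ 2) * logKernel r s := by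
      have h1 : ENNReal.ofReal s * ENNReal.ofReal s⁻¹ = 1 := by
        rw [← ENNReal.ofReal_mul hs0.le, mul_inv_cancel₀ hs0.ne', ENNReal.ofReal_one]
      rw [mul_right_comm, h1, one_mul]
    rw [e]
    gcongr
    nlinarith [sq_nonneg r]
  · rw [lintegral_radialMeasure, ← hA]
    refine le_trans (setLIntegral_mono' measurableSet_Ioi fun r hr => ?_)
      (lintegral_sq_add_sq_mul_logKernel_le hs)
    have hr0 : (0 : ℝ) < r := hr
    have e : ENNReal.ofReal (r ^ 2) * (ENNReal.ofReal s * logKernel r s * ENNReal.ofReal r⁻¹) =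
        ENNReal.ofReal (r * s) * logKernel s r := by
      have h1 : ENNReal.ofReal (r ^ 2) * (ENNReal.ofReal s * ENNReal.ofReal r⁻¹) =
          ENNReal.ofReal (r * s) := by
        rw [← ENNReal.ofReal_mul hs.le, ← ENNReal.ofReal_mul (by positivity)]
        congr 1
        field_simp
      rw [mul_right_comm, ← mul_assoc, h1, logKernel_comm]
    rw [e]
    gcongr
    nlinarith [sq_nonneg (s - r), sq_nonneg r, sq_nonneg s]

/-! ### Summation over the sectors and the operator bound -/

/-- The majorant of the difference of the forms of two consecutive heat semigroups. -/
noncomputable def heatMajorant (n : ℕ) (v f : L2Rad) (x : ℝ) : ℝ≥0∞ :=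
  ∫⁻ z, ENNReal.ofReal (‖v z.1‖ * ‖f z.2‖) *
    ENNReal.ofReal (heatKernel n x z.1 z.2 - heatKernel (n + 1) x z.1 z.2)
    ∂(radialMeasure.prod radialMeasure)

lemma measurable_heatMajorant_integrand (n : ℕ) (v f : L2Rad) :
    Measurable fun q : ℝ × ℝ × ℝ => ENNReal.ofReal (‖v q.2.1‖ * ‖f q.2.2‖) *
      ENNReal.ofReal (heatKernel n q.1 q.2.1 q.2.2 - heatKernel (n + 1) q.1 q.2.1 q.2.2) := by
  have h1 := measurable_norm_coeFn v
  have h2 := measurable_norm_coeFn f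
  have h3 := measurable_heatKernel n
  have h4 := measurable_heatKernel (n + 1)
  exact Measurable.mul (by fun_prop) (h3.sub h4).ennreal_ofReal

lemma measurable_heatMajorant (n : ℕ) (v f : L2Rad) : Measurable (heatMajorant n v f) :=
  (measurable_heatMajorant_integrand n v f).lintegral_prod_right'

lemma enorm_heatForm_sub_succ_le (n : ℕ) {x : ℝ} (hx : 0 < x) (v f : L2Rad) :
    ‖heatForm n x v f - heatForm (n + 1) x v f‖ₑ ≤ heatMajorant n v f x := by
  rw [heatForm, heatForm, ← integral_sub (integrable_heatIntegrand n hx v f)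
    (integrable_heatIntegrand (n + 1) hx v f)]
  refine (enorm_integral_le_lintegral_enorm _).trans (lintegral_mono_ae ?_)
  filter_upwards [ae_prod_radialMeasure_pos] with z hz
  have h := sub_nonneg.2 (heatKernel_succ_le n hx hz.1.le hz.2.le)
  rw [← ENNReal.ofReal_mul (by positivity), ← ofReal_norm]
  refine ENNReal.ofReal_le_ofReal (le_of_eq ?_)
  rw [heatIntegrand, heatIntegrand, ← mul_sub, ← Complex.ofReal_sub, norm_mul, norm_mul,
    Complex.norm_real, RCLike.norm_conj, Real.norm_of_nonneg h]

lemma enorm_heatForm_sub_le {ℓ ℓ' : ℕ} (h : ℓ ≤ ℓ') {x : ℝ} (hx : 0 < x) (v f : L2Rad) :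
    ‖heatForm ℓ x v f - heatForm ℓ' x v f‖ₑ ≤ ∑ n ∈ Finset.Ico ℓ ℓ', heatMajorant n v f x := by
  rw [← edist_eq_enorm_sub]
  refine (edist_le_Ico_sum_edist (fun n => heatForm n x v f) h).trans
    (Finset.sum_le_sum fun n _ => ?_)
  rw [edist_eq_enorm_sub]
  exact enorm_heatForm_sub_succ_le n hx v f

/-- By Tonelli the integral in `x` is done first and produces `logKernel`. The hypothesis `‖f s‖ = s
‖u s‖` supplies the factor `s` needed by the Schur test; the constant is `(2/π) · 40π / 2 = 40`. -/
lemma lintegral_heatMajorant_le (n : ℕ) (v u f : L2Rad)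
    (hf : ∀ᵐ s ∂radialMeasure, ‖f s‖ = s * ‖u s‖) :
    ∫⁻ x in Ioi 0, ENNReal.ofReal (√x)⁻¹ * heatMajorant n v f x ≤
      ENNReal.ofReal (40 * (n + 1) * (‖v‖ ^ 2 + ‖u‖ ^ 2)) := by
  have e1 : ∀ x, ENNReal.ofReal (√x)⁻¹ * heatMajorant n v f x =
      ∫⁻ z, ENNReal.ofReal (‖v z.1‖ * ‖f z.2‖) *
        ENNReal.ofReal ((√x)⁻¹ * (heatKernel n x z.1 z.2 - heatKernel (n + 1) x z.1 z.2))
        ∂(radialMeasure.prod radialMeasure) := fun x => by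
    rw [heatMajorant, ← lintegral_const_mul' _ _ ENNReal.ofReal_ne_top]
    refine lintegral_congr fun z => ?_
    rw [ENNReal.ofReal_mul (by positivity : (0 : ℝ) ≤ (√x)⁻¹), mul_left_comm]
  simp_rw [e1]
  rw [lintegral_lintegral_swap]
  swap
  · refine Measurable.aemeasurable ?_
    have h1 := measurable_norm_coeFn v
    have h2 := measurable_norm_coeFn f
    have h3 := measurable_heatKernel n
    have h4 := measurable_heatKernel (n + 1)
    unfold Function.uncurry
    exact Measurable.mul (by fun_prop) (Measurable.ennreal_ofReal
      (Measurable.mul (by fun_prop) (h3.sub h4)))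
  have hf2 := Measure.quasiMeasurePreserving_snd (μ := radialMeasure) (ν := radialMeasure) |>.ae hf
  have h1 := measurable_norm_coeFn v
  have h2 := measurable_norm_coeFn u
  calc _ ≤ ∫⁻ z, ENNReal.ofReal (2 / Real.pi * (n + 1)) * (ENNReal.ofReal (‖v z.1‖ * ‖u z.2‖) *
        (ENNReal.ofReal z.2 * logKernel z.1 z.2)) ∂(radialMeasure.prod radialMeasure) := by
        refine lintegral_mono_ae ?_
        filter_upwards [ae_prod_radialMeasure_pos, hf2] with z hz hfz
        rw [lintegral_const_mul' _ _ ENNReal.ofReal_ne_top]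
        refine (mul_le_mul_right (lintegral_heatKernel_sub_succ_le n hz.1 hz.2) _).trans_eq ?_
        rw [hfz, show ‖v z.1‖ * (z.2 * ‖u z.2‖) = ‖v z.1‖ * ‖u z.2‖ * z.2 by ring,
          ENNReal.ofReal_mul (by positivity : 0 ≤ ‖v z.1‖ * ‖u z.2‖)]
        ring
    _ = ENNReal.ofReal (2 / Real.pi * (n + 1)) * ∫⁻ r, ∫⁻ s, ENNReal.ofReal (‖v r‖ * ‖u s‖) *
        (ENNReal.ofReal s * logKernel r s) ∂radialMeasure ∂radialMeasure := by
        rw [lintegral_const_mul' _ _ ENNReal.ofReal_ne_top, lintegral_prod]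
        exact (Measurable.mul (by fun_prop) (Measurable.mul (by fun_prop)
          measurable_logKernel)).aemeasurable
    _ ≤ ENNReal.ofReal (2 / Real.pi * (n + 1)) *
        ENNReal.ofReal (40 * Real.pi * ((‖v‖ ^ 2 + ‖u‖ ^ 2) / 2)) := by
        gcongr
        exact lintegral_logKernel_le v u
    _ = _ := by
        rw [← ENNReal.ofReal_mul (by positivity)]
        congr 1
        have := Real.pi_ne_zero
        field_simp

/-- Each of the `ℓ' - ℓ` terms is at most `1 + ℓ + ℓ'`. -/
lemma sum_Ico_succ_le {ℓ ℓ' : ℕ} (h : ℓ ≤ ℓ') :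
    ∑ n ∈ Finset.Ico ℓ ℓ', ((n : ℝ) + 1) ≤ (1 + ℓ + ℓ') * (ℓ' - ℓ) := by
  have h1 : ∀ n ∈ Finset.Ico ℓ ℓ', ((n : ℝ) + 1) ≤ 1 + ℓ + ℓ' := fun n hn => by
    have h2 : (n : ℝ) ≤ ℓ' := by exact_mod_cast (Finset.mem_Ico.1 hn).2.le
    have h3 : (0 : ℝ) ≤ ℓ := by positivity
    linarith
  refine (Finset.sum_le_card_nsmul _ _ _ h1).trans_eq ?_
  rw [Nat.card_Ico, nsmul_eq_mul, Nat.cast_sub h, mul_comm]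

/-- The constant in front of the form of `K_ℓ` in the subordination formula. -/
noncomputable def formConst : ℝ := subordConst * (2 * √Real.pi)⁻¹

lemma formConst_pos : 0 < formConst := by
  have h1 := subordConst_pos
  have h2 := Real.pi_pos
  unfold formConst
  positivity

/-- Subtracting the two subordination formulas cancels the terms `inner ℂ v f` and leaves the
difference of the heat forms, which telescopes over consecutive sectors. The integrability clause of
`subordination_kineticGraph` is what permits the subtraction. -/
lemma norm_inner_kinetic_sub_le_of_le {m : ℝ} {ℓ ℓ' : ℕ} (h : ℓ ≤ ℓ') {u f w w' : L2Rad}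
    (hf : ∀ᵐ s ∂radialMeasure, ‖f s‖ = s * ‖u s‖)
    (hw : (f, w) ∈ kineticGraph m ℓ) (hw' : (f, w') ∈ kineticGraph m ℓ') (v : L2Rad) :
    ‖inner ℂ v (w - w')‖ ≤
      40 / formConst * ((1 + ℓ + ℓ') * (ℓ' - ℓ)) * (‖v‖ ^ 2 + ‖u‖ ^ 2) := by
  obtain ⟨hi, he⟩ := subordination_kineticGraph hw v
  obtain ⟨hi', he'⟩ := subordination_kineticGraph hw' v
  have hdiff : (formConst : ℂ) * inner ℂ v (w - w') = ∫ x in Ioi 0, (((√x)⁻¹ : ℝ) : ℂ) *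
      ((massDamping m x : ℂ) * (heatForm ℓ' x v f - heatForm ℓ x v f)) := by
    rw [inner_sub_right, mul_sub, formConst, ← he, ← he', ← integral_sub hi hi']
    congr 1
    ext x
    ring
  have hbound : ‖(formConst : ℂ) * inner ℂ v (w - w')‖ₑ ≤
      ENNReal.ofReal (40 * ((1 + ℓ + ℓ') * (ℓ' - ℓ)) * (‖v‖ ^ 2 + ‖u‖ ^ 2)) := by
    rw [hdiff]
    calc _ ≤ ∫⁻ x in Ioi 0, ∑ n ∈ Finset.Ico ℓ ℓ',
          ENNReal.ofReal (√x)⁻¹ * heatMajorant n v f x := by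
          refine (enorm_integral_le_lintegral_enorm _).trans
            (setLIntegral_mono' measurableSet_Ioi fun x hx => ?_)
          rw [enorm_mul, enorm_mul, ← Finset.mul_sum]
          have e1 : ‖(((√x)⁻¹ : ℝ) : ℂ)‖ₑ = ENNReal.ofReal (√x)⁻¹ := by
            rw [← ofReal_norm, Complex.norm_real, Real.norm_of_nonneg (by positivity)]
          have e2 : ‖(massDamping m x : ℂ)‖ₑ ≤ 1 := by
            rw [← ofReal_norm, Complex.norm_real, Real.norm_of_nonneg (show 0 ≤ massDamping m x from (Real.exp_pos _).le),
              ENNReal.ofReal_le_one]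
            exact massDamping_le_one m hx
          rw [e1]
          gcongr
          refine (mul_le_of_le_one_left' e2).trans ?_
          rw [← neg_sub, enorm_neg]
          exact enorm_heatForm_sub_le h hx v f
      _ = ∑ n ∈ Finset.Ico ℓ ℓ', ∫⁻ x in Ioi 0,
          ENNReal.ofReal (√x)⁻¹ * heatMajorant n v f x := by
          refine lintegral_finsetSum _ fun n _ => ?_
          exact Measurable.mul (by fun_prop) (measurable_heatMajorant n v f)
      _ ≤ ∑ n ∈ Finset.Ico ℓ ℓ', ENNReal.ofReal (40 * (n + 1) * (‖v‖ ^ 2 + ‖u‖ ^ 2)) :=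
          Finset.sum_le_sum fun n _ => lintegral_heatMajorant_le n v u f hf
      _ = ENNReal.ofReal (40 * (∑ n ∈ Finset.Ico ℓ ℓ', ((n : ℝ) + 1)) *
          (‖v‖ ^ 2 + ‖u‖ ^ 2)) := by
          rw [← ENNReal.ofReal_sum_of_nonneg fun n _ => by positivity, Finset.mul_sum,
            Finset.sum_mul]
      _ ≤ _ := by
          gcongr
          exact sum_Ico_succ_le h
  have hl : (0 : ℝ) ≤ (ℓ' : ℝ) - ℓ := sub_nonneg.2 (by exact_mod_cast h)
  rw [← ofReal_norm, ENNReal.ofReal_le_ofReal_iff (by positivity), norm_mul, Complex.norm_real,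
    Real.norm_of_nonneg formConst_pos.le] at hbound
  have e : 40 / formConst * ((1 + ℓ + ℓ') * (ℓ' - ℓ)) * (‖v‖ ^ 2 + ‖u‖ ^ 2) =
      (40 * ((1 + ℓ + ℓ') * ((ℓ' : ℝ) - ℓ)) * (‖v‖ ^ 2 + ‖u‖ ^ 2)) / formConst := by ring
  rw [e, le_div_iff₀ formConst_pos, mul_comm]
  exact hbound

lemma norm_inner_kinetic_sub_le {m : ℝ} {ℓ ℓ' : ℕ} {u f w w' : L2Rad}
    (hf : ∀ᵐ s ∂radialMeasure, ‖f s‖ = s * ‖u s‖)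
    (hw : (f, w) ∈ kineticGraph m ℓ) (hw' : (f, w') ∈ kineticGraph m ℓ') (v : L2Rad) :
    ‖inner ℂ v (w - w')‖ ≤
      40 / formConst * ((1 + ℓ + ℓ') * |(ℓ : ℝ) - ℓ'|) * (‖v‖ ^ 2 + ‖u‖ ^ 2) := by
  rcases le_total ℓ ℓ' with h | h
  · have hl : (ℓ : ℝ) ≤ ℓ' := by exact_mod_cast h
    rw [abs_sub_comm, abs_of_nonneg (sub_nonneg.2 hl)]
    exact norm_inner_kinetic_sub_le_of_le h hf hw hw' v
  · have hl : (ℓ' : ℝ) ≤ ℓ := by exact_mod_cast h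
    rw [abs_of_nonneg (sub_nonneg.2 hl), ← neg_sub w' w, inner_neg_right, norm_neg,
      show (1 : ℝ) + ℓ + ℓ' = 1 + ℓ' + ℓ by ring]
    exact norm_inner_kinetic_sub_le_of_le h hf hw' hw v

/-- The additive bound becomes a product bound by testing with a multiple `t d` of `d` itself and
taking `t = 1/(2A)`; the case `A = 0` is separate. -/
lemma norm_le_of_forall_norm_inner_le {E : Type*} [NormedAddCommGroup E] [InnerProductSpace ℂ E]
    {d : E} {A b : ℝ} (hA : 0 ≤ A) (hb : 0 ≤ b)
    (h : ∀ v : E, ‖(inner ℂ v d : ℂ)‖ ≤ A * (‖v‖ ^ 2 + b ^ 2)) : ‖d‖ ≤ 2 * A * b := by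
  have h1 : ∀ t : ℝ, 0 ≤ t → t * ‖d‖ ^ 2 ≤ A * (t ^ 2 * ‖d‖ ^ 2 + b ^ 2) := fun t ht => by
    have := h ((t : ℂ) • d)
    rwa [inner_smul_left, Complex.conj_ofReal, norm_mul, norm_smul, Complex.norm_real,
      Real.norm_of_nonneg ht, inner_self_eq_norm_sq_to_K, norm_pow, RCLike.norm_ofReal, abs_norm,
      mul_pow] at this
  rcases hA.eq_or_lt with rfl | hA
  · have := h1 1 zero_le_one
    have hd : ‖d‖ ^ 2 ≤ 0 := by simpa using this
    have : ‖d‖ = 0 := by nlinarith [sq_nonneg ‖d‖]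
    simp [this]
  · have h2 := h1 (2 * A)⁻¹ (by positivity)
    have h3 : ‖d‖ ^ 2 ≤ (2 * A * b) ^ 2 := by
      have e1 : A * (((2 * A)⁻¹) ^ 2 * ‖d‖ ^ 2 + b ^ 2) = (4 * A)⁻¹ * ‖d‖ ^ 2 + A * b ^ 2 := by
        field_simp; ring
      have e2 : (2 * A)⁻¹ * ‖d‖ ^ 2 = (4 * A)⁻¹ * ‖d‖ ^ 2 + (4 * A)⁻¹ * ‖d‖ ^ 2 := by
        field_simp; ring
      rw [e1, e2] at h2
      have h4 : (4 * A)⁻¹ * ‖d‖ ^ 2 ≤ A * b ^ 2 := by linarith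
      rw [inv_mul_le_iff₀ (by positivity)] at h4
      linarith
    exact (pow_le_pow_iff_left₀ (norm_nonneg _) (by positivity) two_ne_zero).1 h3

lemma norm_kineticDiffMul_le (m : ℝ) (ℓ ℓ' : ℕ) (u : (kineticDiffMul m ℓ ℓ').domain) :
    ‖kineticDiffMul m ℓ ℓ' u‖ ≤
      80 / formConst * (1 + (ℓ : ℝ) + ℓ') * |(ℓ : ℝ) - ℓ'| * ‖(u : L2Rad)‖ := by
  obtain ⟨u, y, hyA, rfl⟩ := u
  set f : L2Rad := mulOp radialMeasure (fun r => r) y with hfd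
  have hfa : ⇑f =ᵐ[radialMeasure] fun r => ((r : ℝ) : ℂ) * (y : L2Rad) r := MemLp.coeFn_toLp y.2
  have hf : ∀ᵐ s ∂radialMeasure, ‖f s‖ = s * ‖(y : L2Rad) s‖ := by
    filter_upwards [hfa, ae_radialMeasure_pos] with s hs hs0
    rw [hs, norm_mul, Complex.norm_real, Real.norm_of_nonneg hs0.le]
  have hg : ∀ (n : ℕ) (hn : f ∈ (kineticOp m n).domain),
      (f, kineticOp m n ⟨f, hn⟩) ∈ kineticGraph m n := fun n hn => by
    rw [← kineticOp_graph]
    exact (kineticOp m n).mem_graph ⟨f, hn⟩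
  have hpos := formConst_pos
  have h := norm_le_of_forall_norm_inner_le (by positivity) (norm_nonneg _)
    (norm_inner_kinetic_sub_le hf (hg ℓ hyA.1) (hg ℓ' hyA.2))
  refine h.trans_eq ?_
  change _ = _ * ‖(y : L2Rad)‖
  ring

end RadialKinetic

theorem lemma8 :
    ∃ C : ℝ, ∀ m : ℝ, 0 ≤ m → ∀ ℓ ℓ' : ℕ,
      Dense ((RadialKinetic.kineticDiffMul m ℓ ℓ').domain : Set RadialKinetic.L2Rad) ∧
      ∃ T : RadialKinetic.L2Rad →L[ℂ] RadialKinetic.L2Rad,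
        (∀ u : (RadialKinetic.kineticDiffMul m ℓ ℓ').domain,
          T (u : RadialKinetic.L2Rad) = RadialKinetic.kineticDiffMul m ℓ ℓ' u) ∧
        ‖T‖ ≤ C * (1 + (ℓ : ℝ) + (ℓ' : ℝ)) * |(ℓ : ℝ) - (ℓ' : ℝ)| := by
  refine ⟨80 / RadialKinetic.formConst, fun m _ ℓ ℓ' => ?_⟩
  have hd := RadialKinetic.dense_domain_kineticDiffMul m ℓ ℓ'
  have hpos := RadialKinetic.formConst_pos
  have hdr : DenseRange (RadialKinetic.kineticDiffMul m ℓ ℓ').domain.subtype := by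
    rw [DenseRange, Submodule.coe_subtype, Subtype.range_coe]
    exact hd
  have hn := RadialKinetic.norm_kineticDiffMul_le m ℓ ℓ'
  -- The bound on the dense domain extends the operator by continuity without increasing its norm.
  exact ⟨hd, (RadialKinetic.kineticDiffMul m ℓ ℓ').toFun.extendOfNorm
    (RadialKinetic.kineticDiffMul m ℓ ℓ').domain.subtype,
    fun u => LinearMap.extendOfNorm_eq hdr ⟨_, hn⟩ u,
    LinearMap.opNorm_extendOfNorm_le hdr (by positivity) hn⟩
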